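/- For integers $d\ge 1$ and $m\ge 0$ put $G=G(d,m)=d^{d(d-1)/2}(m+1)^d$. There is a single deterministic algorithm with the following property. Its input consists of a finite field $\mathbb F_q$ (presented as $\mathbb F_p[X]/(f)$ by its characteristic $p$ and a monic irreducible polynomial $f$ over $\mathbb F_p$, so that field elements are written as coefficient lists with respect to the powers of the residue class of $X$), integers $d$ and $m$ such that $d$ divides $q-1$, and $G=G(d,m)$ vectors $v_1,\dots,v_G\in\mathbb F_q^m$. In time (number of bit operations) bounded by a fixed polynomial in $G$ and $\log q$, where the polynomial does not depend on the input, it outputs two disjoint subsets $I,J\subseteq\{1,\dots,G\}$ with $I\neq\emptyset$ and nonzero field elements $\gamma_j\in\mathbb F_q^*$ ($j\in I\cup J$) such that $$\sum_{i\in I}\gamma_i^d v_i=\sum_{j\in J}\gamma_j^d v_j .$$ -/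

import Mathlib

open Polynomial

namespace DiagonalSystems

/-! ### A deterministic programming language with logarithmic (bit-size) cost

Data are natural numbers, pairs and finite lists.  Every elementary operation can be carried out
by a Turing machine in time polynomial in the number of bits of its operands and of its result,
and it is charged exactly that number of bits; tests, copies and each round of a loop are charged
as well.  Hence polynomial time in this model is polynomial time in the usual (bit) sense. -/

/-- The data types of the language. -/
inductive Ty : Type
  | nat : Ty
  | prod : Ty → Ty → Ty
  | list : Ty → Ty

/-- The values of a data type. -/
abbrev Ty.Val : Ty → Type
  | .nat => ℕ
  | .prod a b => a.Val × b.Val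
  | .list a => List a.Val

/-- The number of symbols needed to write down a value, numbers being written in binary. -/
def Ty.size : (a : Ty) → a.Val → ℕ
  | .nat, n => Nat.size n + 1
  | .prod a b, x => a.size x.1 + b.size x.2 + 1
  | .list a, l => (l.map a.size).sum + l.length + 1

/-- The elementary operations. -/
inductive Prim : Ty → Ty → Type
  | id {a : Ty} : Prim a a
  | const {a : Ty} (n : ℕ) : Prim a .nat
  | add : Prim (.prod .nat .nat) .nat
  | sub : Prim (.prod .nat .nat) .nat
  | mul : Prim (.prod .nat .nat) .nat
  | div : Prim (.prod .nat .nat) .nat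
  | mod : Prim (.prod .nat .nat) .nat
  | fst {a b : Ty} : Prim (.prod a b) a
  | snd {a b : Ty} : Prim (.prod a b) b
  | nil {a b : Ty} : Prim a (.list b)
  | cons {a : Ty} : Prim (.prod a (.list a)) (.list a)
  | headD {a : Ty} : Prim (.prod a (.list a)) a
  | tail {a : Ty} : Prim (.list a) (.list a)
  | length {a : Ty} : Prim (.list a) .nat

/-- The result of an elementary operation (subtraction is truncated at `0`; division by `0` gives
`0` and leaves the dividend as remainder; `headD (x, l)` is the first entry of `l`, or `x` if `l`
is empty). -/
def Prim.apply : {a b : Ty} → Prim a b → a.Val → b.Val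
  | _, _, .id => fun x => x
  | _, _, .const n => fun _ => n
  | _, _, .add => fun x => x.1 + x.2
  | _, _, .sub => fun x => x.1 - x.2
  | _, _, .mul => fun x => x.1 * x.2
  | _, _, .div => fun x => x.1 / x.2
  | _, _, .mod => fun x => x.1 % x.2
  | _, _, .fst => fun x => x.1
  | _, _, .snd => fun x => x.2
  | _, _, .nil => fun _ => []
  | _, _, .cons => fun x => x.1 :: x.2
  | _, _, .headD => fun x => x.2.headD x.1
  | _, _, .tail => fun l => l.tail
  | _, _, .length => fun l => l.length

/-- Programs with input in `a` and output in `b`: elementary operations, sequential composition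
(first `f`, then `g`), pairing, branching and unbounded loops.  A test counts as passed if it
evaluates to a nonzero number. -/
inductive Prog : Ty → Ty → Type
  | prim {a b : Ty} (o : Prim a b) : Prog a b
  | comp {a b c : Ty} (f : Prog a b) (g : Prog b c) : Prog a c
  | pair {a b c : Ty} (f : Prog a b) (g : Prog a c) : Prog a (.prod b c)
  | cond {a b : Ty} (test : Prog a .nat) (f g : Prog a b) : Prog a b
  | loop {a : Ty} (test : Prog a .nat) (body : Prog a a) : Prog a a

/-- `Prog.Runs A x y t`: on input `x` the program `A` halts with output `y` in time `t`. -/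
inductive Prog.Runs : {a b : Ty} → Prog a b → a.Val → b.Val → ℕ → Prop
  | prim {a b : Ty} (o : Prim a b) (x : a.Val) :
      Runs (.prim o) x (o.apply x) (a.size x + b.size (o.apply x))
  | comp {a b c : Ty} {f : Prog a b} {g : Prog b c} {x : a.Val} {y : b.Val} {z : c.Val} {s t : ℕ} :
      Runs f x y s → Runs g y z t → Runs (.comp f g) x z (s + t)
  | pair {a b c : Ty} {f : Prog a b} {g : Prog a c} {x : a.Val} {y : b.Val} {z : c.Val} {s t : ℕ} :
      Runs f x y s → Runs g x z t →
        Runs (.pair f g) x (y, z) (s + t + a.size x + b.size y + c.size z)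
  | cond_true {a b : Ty} {test : Prog a .nat} {f g : Prog a b} {x : a.Val} {n : ℕ} {y : b.Val}
      {s t : ℕ} :
      Runs test x n s → n ≠ 0 → Runs f x y t → Runs (.cond test f g) x y (s + t + a.size x)
  | cond_false {a b : Ty} {test : Prog a .nat} {f g : Prog a b} {x : a.Val} {n : ℕ} {y : b.Val}
      {s t : ℕ} :
      Runs test x n s → n = 0 → Runs g x y t → Runs (.cond test f g) x y (s + t + a.size x)
  | loop_stop {a : Ty} {test : Prog a .nat} {body : Prog a a} {x : a.Val} {n : ℕ} {s : ℕ} :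
      Runs test x n s → n = 0 → Runs (.loop test body) x x (s + a.size x)
  | loop_step {a : Ty} {test : Prog a .nat} {body : Prog a a} {x y z : a.Val} {n : ℕ}
      {s t u : ℕ} :
      Runs test x n s → n ≠ 0 → Runs body x y t → Runs (.loop test body) y z u →
        Runs (.loop test body) x z (s + t + u + a.size x)

/-- Output and running time are determined by the program and its input. -/
theorem Prog.Runs.deterministic {a b : Ty} {A : Prog a b} {x : a.Val} {y : b.Val} {t : ℕ}
    (h : A.Runs x y t) : ∀ {y' : b.Val} {t' : ℕ}, A.Runs x y' t' → y = y' ∧ t = t' := by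
  induction h with
  | prim o x => intro y' t' h'; cases h'; exact ⟨rfl, rfl⟩
  | comp _ _ ih₁ ih₂ =>
    intro y' t' h'; cases h' with
    | comp h₁ h₂ =>
      obtain ⟨rfl, rfl⟩ := ih₁ h₁; obtain ⟨rfl, rfl⟩ := ih₂ h₂; exact ⟨rfl, rfl⟩
  | pair _ _ ih₁ ih₂ =>
    intro y' t' h'; cases h' with
    | pair h₁ h₂ =>
      obtain ⟨rfl, rfl⟩ := ih₁ h₁; obtain ⟨rfl, rfl⟩ := ih₂ h₂; exact ⟨rfl, rfl⟩
  | cond_true _ hn _ ih₁ ih₂ =>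
    intro y' t' h'; cases h' with
    | cond_true h₁ _ h₂ =>
      obtain ⟨rfl, rfl⟩ := ih₁ h₁; obtain ⟨rfl, rfl⟩ := ih₂ h₂; exact ⟨rfl, rfl⟩
    | cond_false h₁ h0 _ => obtain ⟨rfl, rfl⟩ := ih₁ h₁; exact absurd h0 hn
  | cond_false _ hn _ ih₁ ih₂ =>
    intro y' t' h'; cases h' with
    | cond_true h₁ h0 _ => obtain ⟨rfl, rfl⟩ := ih₁ h₁; exact absurd hn h0
    | cond_false h₁ _ h₂ =>
      obtain ⟨rfl, rfl⟩ := ih₁ h₁; obtain ⟨rfl, rfl⟩ := ih₂ h₂; exact ⟨rfl, rfl⟩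
  | loop_stop _ hn ih₁ =>
    intro y' t' h'; cases h' with
    | loop_stop h₁ _ => obtain ⟨rfl, rfl⟩ := ih₁ h₁; exact ⟨rfl, rfl⟩
    | loop_step h₁ h0 _ _ => obtain ⟨rfl, rfl⟩ := ih₁ h₁; exact absurd hn h0
  | loop_step _ hn _ _ ih₁ ih₂ ih₃ =>
    intro y' t' h'; cases h' with
    | loop_stop h₁ h0 => obtain ⟨rfl, rfl⟩ := ih₁ h₁; exact absurd h0 hn
    | loop_step h₁ _ h₂ h₃ =>
      obtain ⟨rfl, rfl⟩ := ih₁ h₁; obtain ⟨rfl, rfl⟩ := ih₂ h₂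
      obtain ⟨rfl, rfl⟩ := ih₃ h₃; exact ⟨rfl, rfl⟩

/-! ### Finite fields, vectors and index sets as data -/

/-- The polynomial `c₀ + c₁ X + ⋯` over `ℤ/p` with the listed coefficients. -/
noncomputable def listPoly (p : ℕ) (c : List ℕ) : (ZMod p)[X] :=
  ∑ i : Fin c.length, C ((c.get i : ℕ) : ZMod p) * X ^ (i : ℕ)

/-- The finite field `F` of characteristic `p` is presented by the list `f = [f₀, …, f_{k-1}]` of
residues modulo `p`: the polynomial `X ^ k + f_{k-1} X ^ (k-1) + ⋯ + f₀` is irreducible over `ℤ/p`,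
`θ ∈ F` is a root of it, and `F` has `p ^ k` elements (so `F = 𝔽_p(θ) ≅ 𝔽_p[X]/(f)`). -/
structure Presents (p : ℕ) {F : Type*} [Field F] [Algebra (ZMod p) F] (f : List ℕ) (θ : F) :
    Prop where
  lt : ∀ a ∈ f, a < p
  irreducible : Irreducible (X ^ f.length + listPoly p f)
  root : aeval θ (X ^ f.length + listPoly p f) = 0
  card : Nat.card F = p ^ f.length

/-- The list `c = [c₀, …, c_{k-1}]` of residues modulo `p` is the code of the field element
`c₀ + c₁ θ + ⋯ + c_{k-1} θ ^ (k-1)`. -/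
def CodesElem (p k : ℕ) {F : Type*} [Field F] [Algebra (ZMod p) F] (θ : F)
    (c : List ℕ) (x : F) : Prop :=
  c.length = k ∧ (∀ a ∈ c, a < p) ∧ aeval θ (listPoly p c) = x

/-- A list codes the tuple `v` if it has the same length and codes it entry by entry. -/
def CodesTuple {α β : Type*} (R : α → β → Prop) {n : ℕ} (l : List α) (v : Fin n → β) : Prop :=
  List.Forall₂ R l (List.ofFn v)

/-- The list `l` enumerates the index set `I` without repetition (indices are counted from `0`). -/
def CodesSet {n : ℕ} (l : List ℕ) (I : Finset (Fin n)) : Prop :=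
  l.Nodup ∧ ∀ a : ℕ, a ∈ l ↔ ∃ i ∈ I, (i : ℕ) = a

/-! ### The problem -/

/-- The number of input vectors. -/
def numVectors (d m : ℕ) : ℕ := d ^ (d * (d - 1) / 2) * (m + 1) ^ d

/-- Inputs `(p, f, d, m, vectors)`; a field element is a list of numbers. -/
abbrev inputTy : Ty :=
  .prod .nat (.prod (.list .nat) (.prod .nat (.prod .nat (.list (.list (.list .nat))))))

/-- Outputs `(I, J, γ)`. -/
abbrev outputTy : Ty :=
  .prod (.list .nat) (.prod (.list .nat) (.list (.list .nat)))

/-- Two colliding representations with disjoint supports `I ≠ ∅` and `J` whose coefficients are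
`d`th powers of nonzero elements. -/
def IsCollision {F : Type*} [Field F] {n m : ℕ} (d : ℕ) (v : Fin n → Fin m → F)
    (I J : Finset (Fin n)) (γ : Fin n → F) : Prop :=
  Disjoint I J ∧ I.Nonempty ∧ (∀ j ∈ I ∪ J, γ j ≠ 0) ∧
    ∑ i ∈ I, γ i ^ d • v i = ∑ j ∈ J, γ j ^ d • v j

end DiagonalSystems

/-! The algorithm works with lists of triples (vector, label in {0,…,d-1}^k, coefficient). Such a
list represents a tensor in (F^d)^{⊗k} ⊗ F^m: its entry at the label l is the sum of γ^d v over the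
triples labelled l. Fix ζ in F and put z = (1, ζ, …, ζ^(d-1)). In round k, d^k (m+1) of these
tensors lie in a space of dimension d^k m, so elimination gives a nontrivial relation Σ β_j T_j = 0
(`relation_spec`). Writing β_j = ζ^(b_j) γ_j^d, the factor γ_j is moved into the coefficients and
b_j is appended to the labels. The relation then says that the new tensor contracts to zero with z
in its last slot, and the contractions in the older slots remain zero (`objInv_combine`). The d
rounds use up the product of the numbers d^k (m+1) for k < d, which is G, and leave a single tensor
all of whose d slots contract with z to zero.

Such a tensor has vanishing alternating sum: since z ≠ 0, Cramer's rule expresses the determinant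
form as a combination of contractions with z (`sum_det_smul_eq_zero`). Hence the vectors whose
labels are even permutations and those whose labels are odd permutations have equal weighted sums;
they form I and J. Adding a constant to all b_j multiplies a relation by a power of ζ only, so in
round k some surviving term can be given the new entry k. The label (0, 1, …, d-1), an even
permutation, therefore occurs and I is nonempty (`isCollision_finalTerms`).

No generator of the d-part of F^* is known deterministically. Instead ζ has a known order e, a
product of primes dividing d, starting from ζ = 1. Let r be the largest divisor of q-1 prime to d.
If x^(re) = 1, a discrete logarithm to the smooth order e yields x = ζ^b γ^d (`decomp_spec`). If
some coefficient x ≠ 0 violates this, powers of x provide an element enlarging the group by a prime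
factor (`isGenerator_enlarge`), and the computation is repeated. Since e divides q-1, this happens
fewer than `Nat.size q` times (`decomposable_passes`).

For the running time, programs are not written out: `PolyTime` is shown to be closed under the usual
constructions on numbers, lists and field elements, and every function of the algorithm is built
from these. The intermediate tensors stay small because each input vector occurs exactly once among
all triples, and the number of labels is at most d^d ≤ d G. -/

namespace DiagonalSystems

/-! ### Polynomially bounded families -/

/-- The family `t` is bounded by a fixed polynomial in `N`. -/
def PolyBdd {ι : Type*} (N t : ι → ℕ) : Prop := ∃ c : ℕ, ∀ i, t i ≤ (N i + 2) ^ c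

namespace PolyBdd

variable {ι κ : Type*} {N s t : ι → ℕ}

theorem mono (ht : PolyBdd N t) (h : ∀ i, s i ≤ t i) : PolyBdd N s :=
  ht.imp fun _ hc i => (h i).trans (hc i)

theorem const (n : ℕ) : PolyBdd N fun _ => n :=
  ⟨n, fun i => (Nat.lt_two_pow_self.le).trans (Nat.pow_le_pow_left (by omega) n)⟩

theorem self : PolyBdd N N := ⟨1, fun i => by simp⟩

theorem mul (hs : PolyBdd N s) (ht : PolyBdd N t) : PolyBdd N fun i => s i * t i := by
  obtain ⟨c, hc⟩ := hs
  obtain ⟨c', hc'⟩ := ht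
  exact ⟨c + c', fun i => by rw [pow_add]; exact Nat.mul_le_mul (hc i) (hc' i)⟩

theorem add (hs : PolyBdd N s) (ht : PolyBdd N t) : PolyBdd N fun i => s i + t i := by
  have h1 : PolyBdd N fun i => (s i + 1) * (t i + 1) := by
    have aux : ∀ {u : ι → ℕ}, PolyBdd N u → PolyBdd N fun i => u i + 1 := by
      rintro u ⟨c, hc⟩
      refine ⟨c + 1, fun i => ?_⟩
      have h2 : 1 ≤ (N i + 2) ^ c := Nat.one_le_pow _ _ (by omega)
      rw [pow_succ]
      nlinarith [hc i]
    exact (aux hs).mul (aux ht)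
  exact h1.mono fun i => by nlinarith [Nat.zero_le (s i * t i)]

theorem comp (ht : PolyBdd N t) (φ : κ → ι) : PolyBdd (fun k => N (φ k)) fun k => t (φ k) :=
  ht.imp fun _ hc k => hc (φ k)

/-- The summands form one family indexed by pairs, so a single exponent serves all of them; bounds
with exponents depending on the summation index would not suffice. -/
theorem sum_range {n : ι → ℕ} {t : ι → ℕ → ℕ} (hn : PolyBdd N n)
    (ht : PolyBdd (fun j : {j : ι × ℕ // j.2 < n j.1} => N j.1.1) fun j => t j.1.1 j.1.2) :
    PolyBdd N fun i => ∑ j ∈ Finset.range (n i), t i j := by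
  obtain ⟨c, hc⟩ := ht
  refine (hn.mul ⟨c, fun i => le_rfl⟩).mono fun i => ?_
  calc ∑ j ∈ Finset.range (n i), t i j ≤ ∑ _j ∈ Finset.range (n i), (N i + 2) ^ c :=
        Finset.sum_le_sum fun j hj => hc ⟨(i, j), Finset.mem_range.1 hj⟩
    _ = _ := by simp

end PolyBdd

/-! ### Sizes -/

theorem Ty.one_le_size : (a : Ty) → (x : a.Val) → 1 ≤ a.size x
  | .nat, _ => Nat.le_add_left _ _
  | .prod _ _, _ => Nat.le_add_left _ _
  | .list _, _ => Nat.le_add_left _ _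

/-- Reading the input and writing the output are always charged. A time bound is thus also a size
bound, and sizes of computed values need no separate treatment. -/
theorem Prog.Runs.size_le {a b : Ty} {A : Prog a b} {x : a.Val} {y : b.Val} {t : ℕ}
    (h : A.Runs x y t) : a.size x ≤ t ∧ b.size y ≤ t := by
  induction h with
  | prim o x => exact ⟨by omega, by omega⟩
  | comp _ _ ih₁ ih₂ => exact ⟨by omega, by omega⟩
  | @pair a b c f g x y z s t _ _ ih₁ ih₂ =>
    have := Ty.one_le_size _ x
    refine ⟨by omega, ?_⟩
    change b.size y + c.size z + 1 ≤ _
    omega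
  | cond_true _ _ _ ih₁ ih₂ => exact ⟨by omega, by omega⟩
  | cond_false _ _ _ ih₁ ih₂ => exact ⟨by omega, by omega⟩
  | loop_stop _ _ ih₁ => exact ⟨by omega, by omega⟩
  | loop_step _ _ _ _ ih₁ ih₂ ih₃ => exact ⟨by omega, by omega⟩

theorem Ty.size_le_of_mem {b : Ty} {l : List b.Val} {x : b.Val} (h : x ∈ l) :
    b.size x ≤ (Ty.list b).size l := by
  change _ ≤ (l.map b.size).sum + l.length + 1
  have := List.le_sum_of_mem (List.mem_map_of_mem (f := b.size) h)
  omega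

theorem Ty.length_le_size {b : Ty} (l : List b.Val) : l.length ≤ (Ty.list b).size l := by
  change _ ≤ (l.map b.size).sum + l.length + 1
  omega

theorem Ty.size_list_le {b : Ty} {l : List b.Val} {n s : ℕ} (hl : l.length ≤ n)
    (hs : ∀ x ∈ l, b.size x ≤ s) : (Ty.list b).size l ≤ n * (s + 1) + 1 := by
  change (l.map b.size).sum + l.length + 1 ≤ _
  have h := List.sum_le_card_nsmul (l.map b.size) s (by simpa using hs)
  simp only [List.length_map, smul_eq_mul] at h
  have : l.length * s ≤ n * s := Nat.mul_le_mul_right _ hl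
  nlinarith

theorem Nat.size_le_self (n : ℕ) : Nat.size n ≤ n := by
  rw [Nat.size_le]
  exact Nat.lt_two_pow_self

theorem Nat.size_add_le (a b : ℕ) : Nat.size (a + b) ≤ Nat.size a + Nat.size b + 1 := by
  rw [Nat.size_le]
  have h1 := Nat.lt_size_self a
  have h2 := Nat.lt_size_self b
  have h3 : 2 ^ a.size ≤ 2 ^ (a.size + b.size) := Nat.pow_le_pow_right (by omega) (by omega)
  have h4 : 2 ^ b.size ≤ 2 ^ (a.size + b.size) := Nat.pow_le_pow_right (by omega) (by omega)
  rw [pow_succ]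
  omega

theorem Nat.size_mul_le (a b : ℕ) : Nat.size (a * b) ≤ Nat.size a + Nat.size b := by
  rw [Nat.size_le, pow_add]
  exact Nat.mul_lt_mul'' (Nat.lt_size_self a) (Nat.lt_size_self b)

theorem Nat.size_pow_le (a n : ℕ) : Nat.size (a ^ n) ≤ n * Nat.size a + 1 := by
  induction n with
  | zero => simp
  | succ n ih =>
    have := Nat.size_mul_le (a ^ n) a
    rw [pow_succ, Nat.succ_mul]
    omega

theorem Ty.size_tail_le {a : Ty} (l : List a.Val) :
    (Ty.list a).size l.tail ≤ (Ty.list a).size l := by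
  cases l with
  | nil => exact le_rfl
  | cons x l =>
    change (l.map a.size).sum + l.length + 1 ≤ ((x :: l).map a.size).sum + (x :: l).length + 1
    simp only [List.map_cons, List.sum_cons, List.length_cons]
    omega

/-- Bit lengths add under multiplication, and the other operations lengthen their operands by at
most a constant. So each elementary operation takes polynomial time on data of polynomial size. -/
theorem Prim.size_apply_le {a b : Ty} (o : Prim a b) :
    ∃ C : ℕ, ∀ x : a.Val, b.size (o.apply x) ≤ a.size x + C := by
  cases o with
  | id => exact ⟨0, fun x => le_rfl⟩
  | const n => exact ⟨Nat.size n + 1, fun x => Nat.le_add_left _ _⟩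
  | add =>
    refine ⟨0, fun x => ?_⟩
    change Nat.size (x.1 + x.2) + 1 ≤ (Nat.size x.1 + 1) + (Nat.size x.2 + 1) + 1 + 0
    have := Nat.size_add_le x.1 x.2
    omega
  | sub =>
    refine ⟨0, fun x => ?_⟩
    change Nat.size (x.1 - x.2) + 1 ≤ (Nat.size x.1 + 1) + (Nat.size x.2 + 1) + 1 + 0
    have := Nat.size_le_size (Nat.sub_le x.1 x.2)
    omega
  | mul =>
    refine ⟨0, fun x => ?_⟩
    change Nat.size (x.1 * x.2) + 1 ≤ (Nat.size x.1 + 1) + (Nat.size x.2 + 1) + 1 + 0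
    have := Nat.size_mul_le x.1 x.2
    omega
  | div =>
    refine ⟨0, fun x => ?_⟩
    change Nat.size (x.1 / x.2) + 1 ≤ (Nat.size x.1 + 1) + (Nat.size x.2 + 1) + 1 + 0
    have := Nat.size_le_size (Nat.div_le_self x.1 x.2)
    omega
  | mod =>
    refine ⟨0, fun x => ?_⟩
    change Nat.size (x.1 % x.2) + 1 ≤ (Nat.size x.1 + 1) + (Nat.size x.2 + 1) + 1 + 0
    have := Nat.size_le_size (Nat.mod_le x.1 x.2)
    omega
  | fst =>
    refine ⟨0, fun x => ?_⟩
    change Ty.size _ x.1 ≤ Ty.size _ x.1 + Ty.size _ x.2 + 1 + 0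
    omega
  | snd =>
    refine ⟨0, fun x => ?_⟩
    change Ty.size _ x.2 ≤ Ty.size _ x.1 + Ty.size _ x.2 + 1 + 0
    omega
  | nil => exact ⟨1, fun x => Nat.le_add_left _ _⟩
  | @cons a =>
    refine ⟨1, fun x => ?_⟩
    change ((x.1 :: x.2).map a.size).sum + (x.1 :: x.2).length + 1 ≤
      a.size x.1 + ((x.2.map a.size).sum + x.2.length + 1) + 1 + 1
    simp only [List.map_cons, List.sum_cons, List.length_cons]
    omega
  | headD =>
    refine ⟨0, ?_⟩
    rintro ⟨x, l⟩
    change b.size (l.headD x) ≤ b.size x + (Ty.list b).size l + 1 + 0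
    cases l with
    | nil => simp only [List.headD_nil]; omega
    | cons y l =>
      have := Ty.size_le_of_mem (b := b) (List.mem_cons_self (a := y) (l := l))
      simp only [List.headD_cons]
      omega
  | tail => exact ⟨0, fun x => Ty.size_tail_le x⟩
  | @length a =>
    refine ⟨1, fun x => ?_⟩
    have h1 := Nat.size_le_self (List.length x)
    have h2 := Ty.length_le_size (b := a) x
    change Nat.size (List.length x) + 1 ≤ _
    omega

/-! ### Families computable in polynomial time -/

/-- A single program computes `y i` from `x i` for all `i`, in time polynomial in `N i`. -/
def RawPolyTime {ι : Type*} (N : ι → ℕ) {a b : Ty} (x : ι → a.Val) (y : ι → b.Val) : Prop :=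
  ∃ (A : Prog a b) (t : ι → ℕ), PolyBdd N t ∧ ∀ i, A.Runs (x i) (y i) (t i)

/-- The family `x` of values has polynomially bounded size. -/
def Small {ι : Type*} (N : ι → ℕ) {a : Ty} (x : ι → a.Val) : Prop :=
  PolyBdd N fun i => a.size (x i)

namespace RawPolyTime

variable {ι κ : Type*} {N : ι → ℕ} {a b c e : Ty} {x : ι → a.Val} {y : ι → b.Val} {z : ι → c.Val}

theorem small_left (h : RawPolyTime N x y) : Small N x := by
  obtain ⟨A, t, ht, h⟩ := h
  exact ht.mono fun i => (h i).size_le.1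

theorem small (h : RawPolyTime N x y) : Small N y := by
  obtain ⟨A, t, ht, h⟩ := h
  exact ht.mono fun i => (h i).size_le.2

theorem reindex (h : RawPolyTime N x y) (φ : κ → ι) :
    RawPolyTime (fun k => N (φ k)) (fun k => x (φ k)) fun k => y (φ k) := by
  obtain ⟨A, t, ht, h⟩ := h
  exact ⟨A, fun k => t (φ k), ht.comp φ, fun k => h (φ k)⟩

theorem trans (h : RawPolyTime N x y) (h' : RawPolyTime N y z) : RawPolyTime N x z := by
  obtain ⟨A, t, ht, h⟩ := h
  obtain ⟨B, s, hs, h'⟩ := h'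
  exact ⟨A.comp B, fun i => t i + s i, ht.add hs, fun i => (h i).comp (h' i)⟩

theorem weaken (h : RawPolyTime N x y) {φ : κ → ι} {x' : κ → c.Val}
    (hx : RawPolyTime (fun k => N (φ k)) x' fun k => x (φ k)) :
    RawPolyTime (fun k => N (φ k)) x' fun k => y (φ k) :=
  hx.trans (h.reindex φ)

theorem pair (h : RawPolyTime N x y) (h' : RawPolyTime N x z) :
    RawPolyTime N x (b := .prod b c) fun i => (y i, z i) := by
  obtain ⟨A, t, ht, h⟩ := h
  obtain ⟨B, s, hs, h'⟩ := h'
  refine ⟨A.pair B, fun i => t i + s i + a.size (x i) + b.size (y i) + c.size (z i), ?_,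
    fun i => (h i).pair (h' i)⟩
  exact (((ht.add hs).add (ht.mono fun i => (h i).size_le.1)).add
    (ht.mono fun i => (h i).size_le.2)).add (hs.mono fun i => (h' i).size_le.2)

theorem prim (o : Prim a b) (hx : Small N x) : RawPolyTime N x fun i => o.apply (x i) := by
  obtain ⟨C, hC⟩ := o.size_apply_le
  exact ⟨.prim o, _, hx.add ((hx.add (.const C)).mono fun i => hC (x i)), fun i => .prim o (x i)⟩

theorem app (h : RawPolyTime N x y) (o : Prim b c) : RawPolyTime N x fun i => o.apply (y i) :=
  h.trans (prim o h.small)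

theorem id (hx : Small N x) : RawPolyTime N x x := prim .id hx

theorem self (h : RawPolyTime N x y) : RawPolyTime N x x := id h.small_left

/-- Each branch has to be handled only on the indices that take it, so the outcome of the test may
be used there. -/
theorem ite {P : ι → Prop} [∀ i, Decidable (P i)] {y z : ι → b.Val} {n : ι → ℕ}
    (hn : RawPolyTime N x (b := .nat) n) (hP : ∀ i, P i ↔ n i ≠ 0)
    (hy : RawPolyTime (fun i : {i // P i} => N i.1) (fun i => x i.1) fun i => y i.1)
    (hz : RawPolyTime (fun i : {i // ¬ P i} => N i.1) (fun i => x i.1) fun i => z i.1) :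
    RawPolyTime N x fun i => if P i then y i else z i := by
  classical
  obtain ⟨A, t, ht, hA⟩ := hn
  obtain ⟨B, s, ⟨k, hs⟩, hB⟩ := hy
  obtain ⟨C, u, ⟨l, hu⟩, hC⟩ := hz
  refine ⟨.cond A B C,
    fun i => t i + (if h : P i then s ⟨i, h⟩ else u ⟨i, h⟩) + a.size (x i), ?_, fun i => ?_⟩
  · have h1 : PolyBdd N fun i => (N i + 2) ^ k := ⟨k, fun _ => le_rfl⟩
    have h2 : PolyBdd N fun i => (N i + 2) ^ l := ⟨l, fun _ => le_rfl⟩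
    refine (ht.add ?_).add (ht.mono fun i => (hA i).size_le.1)
    refine (h1.add h2).mono fun i => ?_
    split_ifs with h
    · exact (hs ⟨i, h⟩).trans (Nat.le_add_right _ _)
    · exact (hu ⟨i, h⟩).trans (Nat.le_add_left _ _)
  · by_cases h : P i
    · simp only [h, if_true, dif_pos]
      exact (hA i).cond_true ((hP i).1 h) (hB ⟨i, h⟩)
    · simp only [h, if_false, dif_neg, not_false_eq_true]
      exact (hA i).cond_false (by simpa using mt (hP i).2 h) (hC ⟨i, h⟩)

/-- A loop which stops after `n i` rounds, the values after `j` rounds being `s i j`. -/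
theorem loop {s : ι → ℕ → a.Val} {n : ι → ℕ} (hn : PolyBdd N n) {v : ι → ℕ → ℕ}
    (hv : RawPolyTime (fun j : {j : ι × ℕ // j.2 ≤ n j.1} => N j.1.1) (b := .nat)
      (fun j => s j.1.1 j.1.2) fun j => v j.1.1 j.1.2)
    (hend : ∀ i, v i (n i) = 0) (hgo : ∀ i, ∀ j < n i, v i j ≠ 0)
    (hs : RawPolyTime (fun j : {j : ι × ℕ // j.2 < n j.1} => N j.1.1)
      (fun j => s j.1.1 j.1.2) fun j => s j.1.1 (j.1.2 + 1)) :
    RawPolyTime N (fun i => s i 0) fun i => s i (n i) := by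
  classical
  obtain ⟨A, t, ht, hA⟩ := hv
  obtain ⟨B, u, hu, hB⟩ := hs
  let t' : ι → ℕ → ℕ := fun i j => if h : j ≤ n i then t ⟨(i, j), h⟩ else 0
  let u' : ι → ℕ → ℕ := fun i j => if h : j < n i then u ⟨(i, j), h⟩ else 0
  have hA' : ∀ i, ∀ j ≤ n i, A.Runs (s i j) (v i j) (t' i j) := fun i j hj => by
    simpa [t', hj] using hA ⟨(i, j), hj⟩
  have hB' : ∀ i, ∀ j < n i, B.Runs (s i j) (s i (j + 1)) (u' i j) := fun i j hj => by
    simpa [u', hj] using hB ⟨(i, j), hj⟩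
  -- `T i j` is the time of the last `j` rounds together with the final test. Counting from the end
  -- matches `loop_step`, which puts one round in front of a run of the remaining loop.
  let T : ι → ℕ → ℕ := fun i j =>
    (∑ k ∈ Finset.range j, (t' i (n i - 1 - k) + u' i (n i - 1 - k) +
      a.size (s i (n i - 1 - k)))) + (t' i (n i) + a.size (s i (n i)))
  have key : ∀ i, ∀ j ≤ n i, (Prog.loop A B).Runs (s i (n i - j)) (s i (n i)) (T i j) := by
    intro i j
    induction j with
    | zero =>
      intro _
      have h := Prog.Runs.loop_stop (body := B) (hA' i (n i) le_rfl) (hend i)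
      simpa [T] using h
    | succ j ih =>
      intro hj
      have e1 : n i - (j + 1) + 1 = n i - j := by omega
      have e2 : n i - 1 - j = n i - (j + 1) := by omega
      have h := Prog.Runs.loop_step (hA' i (n i - (j + 1)) (by omega)) (hgo i _ (by omega))
        (hB' i (n i - (j + 1)) (by omega)) (by rw [e1]; exact ih (by omega))
      convert h using 1
      simp only [T, Finset.sum_range_succ, e2]
      omega
  refine ⟨.loop A B, fun i => T i (n i), ?_, fun i => by simpa using key i (n i) le_rfl⟩
  have ht' : PolyBdd (fun j : {j : ι × ℕ // j.2 ≤ n j.1} => N j.1.1)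
      (fun j => t' j.1.1 j.1.2) := ht.mono fun j => by simp [t', j.2]
  have hu' : PolyBdd (fun j : {j : ι × ℕ // j.2 < n j.1} => N j.1.1)
      (fun j => u' j.1.1 j.1.2) := hu.mono fun j => by simp [u', j.2]
  have hz : PolyBdd (fun j : {j : ι × ℕ // j.2 ≤ n j.1} => N j.1.1)
      (fun j => a.size (s j.1.1 j.1.2)) := ht'.mono fun j => (hA' _ _ j.2).size_le.1
  have hz' : PolyBdd (fun j : {j : ι × ℕ // j.2 < n j.1} => N j.1.1)
      (fun j => a.size (s j.1.1 j.1.2)) := hu'.mono fun j => (hB' _ _ j.2).size_le.1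
  refine PolyBdd.add ?_ ?_
  · have h := PolyBdd.sum_range hn
      (t := fun i j => t' i j + u' i j + a.size (s i j))
      (((ht'.comp (fun j : {j : ι × ℕ // j.2 < n j.1} => ⟨j.1, j.2.le⟩)).add hu').add hz')
    exact h.mono fun i => (Finset.sum_range_reflect
      (fun j => t' i j + u' i j + a.size (s i j)) (n i)).le
  · exact (ht'.comp (fun i => ⟨(i, n i), le_rfl⟩)).add (hz.comp (fun i => ⟨(i, n i), le_rfl⟩))

end RawPolyTime

/-- Some value of a type. -/
def Ty.dflt : (a : Ty) → a.Val
  | .nat => (0 : ℕ)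
  | .prod a b => (a.dflt, b.dflt)
  | .list _ => []

namespace RawPolyTime

variable {ι κ : Type*} {N : ι → ℕ} {a b c e : Ty} {x : ι → a.Val} {y : ι → b.Val} {z : ι → c.Val}

theorem dflt (hx : Small N x) : ∀ b : Ty, RawPolyTime N x fun _ => b.dflt
  | .nat => prim (.const 0) hx
  | .prod b c => (dflt hx b).pair (dflt hx c)
  | .list _ => prim .nil hx

theorem fst {y : ι → (Ty.prod b c).Val} (h : RawPolyTime N x y) : RawPolyTime N x fun i => (y i).1 :=
  h.app .fst

theorem snd {y : ι → (Ty.prod b c).Val} (h : RawPolyTime N x y) : RawPolyTime N x fun i => (y i).2 :=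
  h.app .snd

/-- Folding along a list `l i`, the accumulator after `j` entries being `acc i j`. -/
theorem foldSeq {l : ι → (Ty.list b).Val} {acc : ι → ℕ → c.Val} (hl : RawPolyTime N x l)
    (h0 : RawPolyTime N x fun i => acc i 0)
    (hacc : Small (fun j : {j : ι × ℕ // j.2 ≤ (l j.1).length} => N j.1.1)
      fun j => acc j.1.1 j.1.2)
    (hstep : ∀ {e : Ty} {x' : {j : ι × ℕ // j.2 < (l j.1).length} → e.Val},
      RawPolyTime (fun j => N j.1.1) x' (fun j => x j.1.1) →
      RawPolyTime (fun j => N j.1.1) x' (fun j => (l j.1.1)[j.1.2]'j.2) →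
      RawPolyTime (fun j => N j.1.1) x' (fun j => acc j.1.1 j.1.2) →
      RawPolyTime (fun j => N j.1.1) x' (fun j => acc j.1.1 (j.1.2 + 1))) :
    RawPolyTime N x fun i => acc i (l i).length := by
  have hn : PolyBdd N fun i => (l i).length := hl.small.mono fun i => Ty.length_le_size _
  -- The loop state carries the context, which every step may need, the entries still to be read and
  -- the accumulator; the loop runs while entries are left.
  let s : ι → ℕ → (Ty.prod a (.prod (.list b) c)).Val := fun i j =>
    (x i, (l i).drop j, acc i j)
  have hs : Small (fun j : {j : ι × ℕ // j.2 ≤ (l j.1).length} => N j.1.1)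
      fun j => s j.1.1 j.1.2 := by
    have h1 : PolyBdd (fun j : {j : ι × ℕ // j.2 ≤ (l j.1).length} => N j.1.1)
        fun j => a.size (x j.1.1) := hl.small_left.comp _
    have h2 : PolyBdd (fun j : {j : ι × ℕ // j.2 ≤ (l j.1).length} => N j.1.1)
        fun j => (Ty.list b).size ((l j.1.1).drop j.1.2) := by
      refine PolyBdd.mono (hl.small.comp
        (fun j : {j : ι × ℕ // j.2 ≤ (l j.1).length} => j.1.1)) fun j => ?_
      have : ∀ (k : ℕ) (l : List b.Val), (Ty.list b).size (l.drop k) ≤ (Ty.list b).size l := by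
        intro k
        induction k with
        | zero => intro l; simp
        | succ k ih =>
          intro l
          rw [← List.tail_drop]
          exact (Ty.size_tail_le _).trans (ih l)
      exact this _ _
    exact (h1.add ((h2.add hacc).add (.const 1))).add (.const 1)
  have main : RawPolyTime N (fun i => s i 0) fun i => s i (l i).length := by
    refine loop (v := fun i j => ((l i).drop j).length) hn ?_ ?_ ?_ ?_
    · exact ((id hs).snd.fst).app .length
    · intro i; simp
    · intro i j hj; simp; omega
    · have hs' : RawPolyTime (fun j : {j : ι × ℕ // j.2 < (l j.1).length} => N j.1.1)
          (fun j => s j.1.1 j.1.2) fun j => s j.1.1 j.1.2 :=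
        id (hs.comp (fun j : {j : ι × ℕ // j.2 < (l j.1).length} => ⟨j.1, j.2.le⟩))
      refine hs'.fst.pair (RawPolyTime.pair ?_ (hstep hs'.fst ?_ hs'.snd.snd))
      · have h := hs'.snd.fst.app .tail
        simpa [s, Prim.apply] using h
      -- The default is never returned, since the remaining list is nonempty inside the loop.
      · have h := ((dflt hs'.small b).pair hs'.snd.fst).app .headD
        have e : ∀ j : {j : ι × ℕ // j.2 < (l j.1).length},
            ((l j.1.1).drop j.1.2).headD b.dflt = (l j.1.1)[j.1.2]'j.2 := by
          rintro ⟨⟨i, j⟩, hj⟩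
          simp only at hj ⊢
          rw [List.drop_eq_getElem_cons hj, List.headD_cons]
        simp only [Prim.apply, s, e] at h
        exact h
  have h := (hl.self.pair (hl.pair h0)).trans (z := fun i => s i (l i).length) (by simpa [s] using main)
  exact h.snd.snd

end RawPolyTime

/-! ### Coded types -/

/-- The elements of `X` are represented by values of the data type `b`. -/
class Code (b : outParam Ty) (X : Type*) where
  /-- The representation of an element. -/
  enc : X → b.Val

instance Code.nat : Code .nat ℕ := ⟨fun n => n⟩

instance Code.prod {b c : Ty} {X Y : Type*} [Code b X] [Code c Y] : Code (.prod b c) (X × Y) :=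
  ⟨fun x => (enc x.1, enc x.2)⟩

instance Code.list {b : Ty} {X : Type*} [Code b X] : Code (.list b) (List X) :=
  ⟨fun l => l.map enc⟩

/-- The size of the code of an element. -/
def csize {b : Ty} {X : Type*} [Code b X] (x : X) : ℕ := b.size (Code.enc x)

section csize

variable {b c : Ty} {X Y : Type*} [Code b X] [Code c Y]

theorem csize_nat (n : ℕ) : csize n = Nat.size n + 1 := rfl

theorem csize_prod (x : X × Y) : csize x = csize x.1 + csize x.2 + 1 := rfl

theorem csize_list (l : List X) : csize l = (l.map csize).sum + l.length + 1 := by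
  change ((l.map Code.enc).map b.size).sum + (l.map Code.enc).length + 1 = _
  rw [List.map_map, List.length_map]
  rfl

theorem csize_list_le {l : List X} {n s : ℕ} (hl : l.length ≤ n) (hs : ∀ x ∈ l, csize x ≤ s) :
    csize l ≤ n * (s + 1) + 1 := by
  refine Ty.size_list_le (b := b) (by change (l.map Code.enc).length ≤ n; simpa using hl) fun x hx => ?_
  obtain ⟨y, hy, rfl⟩ := List.mem_map.1 hx
  exact hs y hy

theorem csize_le_of_mem {l : List X} {x : X} (h : x ∈ l) : csize x ≤ csize l :=
  Ty.size_le_of_mem (List.mem_map_of_mem h)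

theorem length_le_csize (l : List X) : l.length ≤ csize l := by
  rw [csize_list]; omega

theorem csize_append (l l' : List X) : csize (l ++ l') + 1 = csize l + csize l' := by
  simp only [csize_list, List.map_append, List.sum_append, List.length_append]; omega

theorem csize_prefix_le {l pre suf : List X} (h : l = pre ++ suf) : csize pre ≤ csize l := by
  have := csize_append pre suf
  have := Ty.one_le_size _ (Code.enc suf)
  change 1 ≤ csize suf at this
  rw [h]; omega

theorem csize_flatten_le (L : List (List X)) : csize L.flatten ≤ csize L := by
  induction L with
  | nil => exact le_rfl
  | cons l L ih =>
    have := csize_append l L.flatten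
    rw [List.flatten_cons]
    rw [csize_list (l := l :: L)]
    rw [csize_list (l := L)] at ih
    simp only [List.map_cons, List.sum_cons, List.length_cons]
    omega

end csize

/-! ### Polynomial time families of coded elements -/

/-- A single program computes (the code of) `y i` from `x i` for all `i`, in time polynomial
in `N i`. -/
def PolyTime {ι : Type*} (N : ι → ℕ) {a : Ty} (x : ι → a.Val) {b : Ty} {Y : ι → Type*}
    [∀ i, Code b (Y i)] (y : ∀ i, Y i) : Prop :=
  RawPolyTime N x fun i => Code.enc (y i)

open Classical in
/-- A single program decides `P i` from `x i` for all `i`, in time polynomial in `N i`. -/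
def PolyTimeDec {ι : Type*} (N : ι → ℕ) {a : Ty} (x : ι → a.Val) (P : ι → Prop) : Prop :=
  RawPolyTime N x (b := .nat) fun i => if P i then 1 else 0

theorem foldl_cons_eq {α β : Type*} (g : α → β) (l : List α) (s : List β) :
    l.foldl (fun acc e => g e :: acc) s = (l.map g).reverse ++ s := by
  induction l generalizing s with
  | nil => rfl
  | cons e l ih => simp [ih]

theorem foldl_append_eq_flatten {α : Type*} (L : List (List α)) :
    L.foldl (fun acc e => acc ++ e) [] = L.flatten := by
  induction L using List.reverseRecOn with
  | nil => rfl
  | append_singleton L l ih => simp [ih]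

/-- The positions in a family of lists. -/
structure FoldIdx {ι : Type*} {X : ι → Type*} (l : ∀ i, List (X i)) where
  /-- The index of the list. -/
  i : ι
  /-- The part of the list before the position. -/
  pre : List (X i)
  /-- The entry at the position. -/
  e : X i
  /-- The part of the list after the position. -/
  suf : List (X i)
  eq : l i = pre ++ e :: suf

/-- The entries of a family of lists. -/
structure MemIdx {ι : Type*} {X : ι → Type*} (l : ∀ i, List (X i)) where
  /-- The index of the list. -/
  i : ι
  /-- The entry. -/
  e : X i
  mem : e ∈ l i

section

variable {ι κ : Type*} {N : ι → ℕ} {a b c e : Ty} {x : ι → a.Val}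
  {X Y Z : ι → Type*} [∀ i, Code b (X i)] [∀ i, Code c (Y i)] [∀ i, Code e (Z i)]

namespace PolyTime

theorem polyBdd {y : ∀ i, Y i} (h : PolyTime N x y) : PolyBdd N fun i => csize (y i) := h.small

theorem ctx {y : ∀ i, Y i} (h : PolyTime N x y) : RawPolyTime N x x := h.self

theorem weaken {y : ∀ i, Y i} (h : PolyTime N x y) {φ : κ → ι} {d : Ty} {x' : κ → d.Val}
    (hx : RawPolyTime (fun k => N (φ k)) x' fun k => x (φ k)) :
    PolyTime (fun k => N (φ k)) x' (fun k => y (φ k)) :=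
  RawPolyTime.weaken h hx

theorem congr {y z : ∀ i, Y i} (h : PolyTime N x y) (hyz : ∀ i, y i = z i) : PolyTime N x z := by
  obtain rfl : y = z := funext hyz
  exact h

theorem prod {y : ∀ i, Y i} {z : ∀ i, Z i} (hy : PolyTime N x y) (hz : PolyTime N x z) :
    PolyTime N x fun i => (y i, z i) := RawPolyTime.pair hy hz

theorem fst {y : ∀ i, Y i × Z i} (h : PolyTime N x y) : PolyTime N x fun i => (y i).1 :=
  RawPolyTime.fst h

theorem snd {y : ∀ i, Y i × Z i} (h : PolyTime N x y) : PolyTime N x fun i => (y i).2 :=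
  RawPolyTime.snd h

theorem natConst (hx : RawPolyTime N x x) (n : ℕ) : PolyTime N x fun _ => n :=
  RawPolyTime.prim (.const n) hx.small

variable {m n : ι → ℕ}

theorem add (hm : PolyTime N x m) (hn : PolyTime N x n) : PolyTime N x fun i => m i + n i :=
  (RawPolyTime.pair hm hn).app .add

theorem sub (hm : PolyTime N x m) (hn : PolyTime N x n) : PolyTime N x fun i => m i - n i :=
  (RawPolyTime.pair hm hn).app .sub

theorem mul (hm : PolyTime N x m) (hn : PolyTime N x n) : PolyTime N x fun i => m i * n i :=
  (RawPolyTime.pair hm hn).app .mul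

theorem div (hm : PolyTime N x m) (hn : PolyTime N x n) : PolyTime N x fun i => m i / n i :=
  (RawPolyTime.pair hm hn).app .div

theorem mod (hm : PolyTime N x m) (hn : PolyTime N x n) : PolyTime N x fun i => m i % n i :=
  (RawPolyTime.pair hm hn).app .mod

theorem nil (hx : RawPolyTime N x x) : PolyTime N x fun i => ([] : List (Y i)) :=
  RawPolyTime.prim (.nil (b := c)) hx.small

theorem cons {y : ∀ i, Y i} {l : ∀ i, List (Y i)} (hy : PolyTime N x y) (hl : PolyTime N x l) :
    PolyTime N x fun i => y i :: l i :=
  (RawPolyTime.pair hy hl).app .cons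

theorem singleton {y : ∀ i, Y i} (hy : PolyTime N x y) : PolyTime N x fun i => [y i] :=
  hy.cons (nil hy.ctx)

theorem tail {l : ∀ i, List (Y i)} (hl : PolyTime N x l) : PolyTime N x fun i => (l i).tail := by
  have h := RawPolyTime.app hl .tail
  have e : ∀ i, ((l i).map Code.enc).tail = Code.enc (l i).tail := fun i => List.map_tail.symm
  change RawPolyTime N x (b := .list c) fun i => ((l i).map Code.enc).tail at h
  simp only [e] at h
  exact h

theorem length {l : ∀ i, List (Y i)} (hl : PolyTime N x l) :
    PolyTime N x fun i => (l i).length := by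
  have h := RawPolyTime.app hl .length
  change RawPolyTime N x (b := .nat) fun i => ((l i).map Code.enc).length at h
  simp only [List.length_map] at h
  exact h

theorem headD {y : ∀ i, Y i} {l : ∀ i, List (Y i)} (hl : PolyTime N x l) (hy : PolyTime N x y) :
    PolyTime N x fun i => (l i).headD (y i) := by
  have h := (RawPolyTime.pair hy hl).app .headD
  change RawPolyTime N x fun i => ((l i).map Code.enc).headD (Code.enc (y i)) at h
  have e : ∀ i, ((l i).map Code.enc).headD (Code.enc (y i)) = Code.enc ((l i).headD (y i)) := by
    intro i
    cases l i <;> rfl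
  simp only [e] at h
  exact h

theorem ite' {P : ι → Prop} [∀ i, Decidable (P i)] {y z : ∀ i, Y i} (hP : PolyTimeDec N x P)
    (hy : PolyTime (fun i : {i // P i} => N i.1) (fun i => x i.1) fun i => y i.1)
    (hz : PolyTime (fun i : {i // ¬ P i} => N i.1) (fun i => x i.1) fun i => z i.1) :
    PolyTime N x fun i => if P i then y i else z i := by
  have h := RawPolyTime.ite (P := P) (y := fun i => Code.enc (y i)) (z := fun i => Code.enc (z i))
    hP (fun i => by by_cases h : P i <;> simp [h]) hy hz
  have e : ∀ i, (if P i then Code.enc (y i) else Code.enc (z i)) =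
      Code.enc (if P i then y i else z i) := by
    intro i; split_ifs <;> rfl
  simp only [e] at h
  exact h

theorem ite {P : ι → Prop} [∀ i, Decidable (P i)] {y z : ∀ i, Y i} (hP : PolyTimeDec N x P)
    (hy : PolyTime N x y) (hz : PolyTime N x z) :
    PolyTime N x fun i => if P i then y i else z i :=
  ite' hP (RawPolyTime.reindex hy Subtype.val) (RawPolyTime.reindex hz Subtype.val)

/-- Iterating a polynomial time step can let sizes grow exponentially, hence the bound `B` for all
partial folds. The step is given for an arbitrary context from which the old context, the entry and
the accumulator are computable; this lets proofs about nested functions be composed without naming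
the data a program carries along. -/
theorem foldl {l : ∀ i, List (X i)} {s : ∀ i, Y i} {g : ∀ i, Y i → X i → Y i} {B : ι → ℕ}
    (hl : PolyTime N x l) (hs : PolyTime N x s) (hB : PolyBdd N B)
    (hsize : ∀ i pre suf, l i = pre ++ suf → csize (pre.foldl (g i) (s i)) ≤ B i)
    (hg : ∀ {d : Ty} {x' : FoldIdx l → d.Val}, RawPolyTime (fun j => N j.i) x' (fun j => x j.i) →
      PolyTime (fun j => N j.i) x' (fun j => j.e) →
      PolyTime (fun j => N j.i) x' (fun j => j.pre.foldl (g j.i) (s j.i)) →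
      PolyTime (fun j => N j.i) x' (fun j => g j.i (j.pre.foldl (g j.i) (s j.i)) j.e)) :
    PolyTime N x fun i => (l i).foldl (g i) (s i) := by
  -- The step hypothesis is instantiated once, in the smallest context providing its three inputs.
  let x'' : FoldIdx l → (Ty.prod a (.prod b c)).Val := fun j =>
    (x j.i, Code.enc j.e, Code.enc (j.pre.foldl (g j.i) (s j.i)))
  have hx'' : RawPolyTime (fun j : FoldIdx l => N j.i) x'' x'' := by
    refine RawPolyTime.id ?_
    have h1 : PolyBdd (fun j : FoldIdx l => N j.i) fun j => a.size (x j.i) :=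
      hl.small_left.comp FoldIdx.i
    have h2 : PolyBdd (fun j : FoldIdx l => N j.i) fun j => csize j.e :=
      (hl.polyBdd.comp FoldIdx.i).mono fun j => csize_le_of_mem (by rw [j.eq]; simp)
    have h3 : PolyBdd (fun j : FoldIdx l => N j.i)
        fun j => csize (j.pre.foldl (g j.i) (s j.i)) :=
      (hB.comp FoldIdx.i).mono fun j => hsize _ _ _ j.eq
    exact (h1.add ((h2.add h3).add (.const 1))).add (.const 1)
  have hstep := hg hx''.fst hx''.snd.fst hx''.snd.snd
  have h := RawPolyTime.foldSeq (l := fun i => Code.enc (l i))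
    (acc := fun i j => Code.enc (((l i).take j).foldl (g i) (s i))) hl hs ?_ ?_
  · change RawPolyTime N x fun i =>
      Code.enc (((l i).take ((l i).map Code.enc).length).foldl (g i) (s i)) at h
    simp only [List.length_map, List.take_length] at h
    exact h
  · exact (hB.comp (fun j : {j : ι × ℕ // j.2 ≤ _} => j.1.1)).mono fun j =>
      hsize _ _ ((l j.1.1).drop j.1.2) (List.take_append_drop _ _).symm
  · intro d x' hx he hacc
    have hlt : ∀ j : {j : ι × ℕ // j.2 < (Code.enc (l j.1)).length},
        j.1.2 < (l j.1.1).length := by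
      rintro ⟨⟨i, j⟩, hj⟩
      change j < ((l i).map Code.enc).length at hj
      simpa using hj
    let φ : {j : ι × ℕ // j.2 < (Code.enc (l j.1)).length} → FoldIdx l := fun j =>
      ⟨j.1.1, (l j.1.1).take j.1.2, (l j.1.1)[j.1.2]'(hlt j), (l j.1.1).drop (j.1.2 + 1), by
        rw [List.getElem_cons_drop, List.take_append_drop]⟩
    have he' : RawPolyTime (fun j => N (φ j).i) x' fun j => Code.enc (φ j).e := by
      convert he using 2 with j
      change _ = ((l j.1.1).map Code.enc)[j.1.2]'_
      rw [List.getElem_map]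
    have h1 := (hx.pair (he'.pair hacc)).trans (z := fun j => Code.enc
      (g (φ j).i ((φ j).pre.foldl (g (φ j).i) (s (φ j).i)) (φ j).e)) (hstep.reindex φ)
    have e : ∀ j : {j : ι × ℕ // j.2 < (Code.enc (l j.1)).length},
        g (φ j).i ((φ j).pre.foldl (g (φ j).i) (s (φ j).i)) (φ j).e =
        ((l j.1.1).take (j.1.2 + 1)).foldl (g j.1.1) (s j.1.1) := by
      intro j
      rw [List.take_add_one, List.getElem?_eq_getElem (hlt j), List.foldl_append]
      rfl
    simp only [e] at h1
    exact h1

theorem reverse {l : ∀ i, List (X i)} (hl : PolyTime N x l) :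
    PolyTime N x fun i => (l i).reverse := by
  have h := foldl (g := fun i (acc : List (X i)) e => e :: acc) (s := fun i => [])
    (B := fun i => csize (l i) * (csize (l i) + 1) + 1) hl (nil hl.ctx)
    (((hl.polyBdd.mul (hl.polyBdd.add (.const 1))).add (.const 1))) ?_ ?_
  · refine h.congr fun i => ?_
    simp [foldl_cons_eq (fun e => e)]
  · intro i pre suf h
    refine csize_list_le (s := csize (l i)) ?_ fun y hy => ?_
    · refine le_trans ?_ (length_le_csize _)
      simp [foldl_cons_eq (fun e => e), h]
    · refine csize_le_of_mem ?_
      rw [h]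
      simp only [foldl_cons_eq (fun e => e), List.append_nil, List.mem_reverse,
        List.map_id'] at hy
      exact List.mem_append_left _ hy
  · intro d x' _ he hacc
    exact he.cons hacc

theorem append {l l' : ∀ i, List (X i)} (hl : PolyTime N x l) (hl' : PolyTime N x l') :
    PolyTime N x fun i => l i ++ l' i := by
  have h := foldl (g := fun i (acc : List (X i)) e => e :: acc) (s := l')
    (B := fun i => csize (l i ++ l' i) * (csize (l i ++ l' i) + 1) + 1) hl.reverse hl' ?_ ?_ ?_
  · refine h.congr fun i => ?_
    simp [foldl_cons_eq (fun e => e)]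
  · have h : PolyBdd N fun i => csize (l i ++ l' i) :=
      (hl.polyBdd.add hl'.polyBdd).mono fun i => by
        have := csize_append (l i) (l' i); omega
    exact (h.mul (h.add (.const 1))).add (.const 1)
  · intro i pre suf h
    have h' : l i = suf.reverse ++ pre.reverse := by
      rw [← List.reverse_append, ← h, List.reverse_reverse]
    refine csize_list_le (s := csize (l i ++ l' i)) ?_ fun y hy => ?_
    · refine le_trans ?_ (length_le_csize _)
      simp [foldl_cons_eq (fun e => e), h']
    · refine csize_le_of_mem ?_
      rw [h']
      simp only [foldl_cons_eq (fun e => e), List.mem_append, List.mem_reverse,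
        List.map_id'] at hy ⊢
      tauto
  · intro d x' _ he hacc
    exact he.cons hacc

/-- No bound for partial results is needed: they have at most `csize (l i)` entries, each of
polynomial size because it is computed in polynomial time with an exponent uniform in the entry. -/
theorem map {l : ∀ i, List (X i)} {g : ∀ i, X i → Y i} (hl : PolyTime N x l)
    (hg : ∀ {d : Ty} {x' : MemIdx l → d.Val}, RawPolyTime (fun j => N j.i) x' (fun j => x j.i) →
      PolyTime (fun j => N j.i) x' (fun j => j.e) →
      PolyTime (fun j => N j.i) x' (fun j => g j.i j.e)) :
    PolyTime N x fun i => (l i).map (g i) := by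
  let x'' : MemIdx l → (Ty.prod a b).Val := fun j => (x j.i, Code.enc j.e)
  have hx'' : RawPolyTime (fun j : MemIdx l => N j.i) x'' x'' := by
    refine RawPolyTime.id ?_
    have h1 : PolyBdd (fun j : MemIdx l => N j.i) fun j => a.size (x j.i) :=
      hl.small_left.comp MemIdx.i
    have h2 : PolyBdd (fun j : MemIdx l => N j.i) fun j => csize j.e :=
      (hl.polyBdd.comp MemIdx.i).mono fun j => csize_le_of_mem j.mem
    exact (h1.add h2).add (.const 1)
  have hstep := hg hx''.fst hx''.snd
  obtain ⟨k, hk⟩ := hstep.polyBdd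
  have h := foldl (g := fun i (acc : List (Y i)) e => g i e :: acc) (s := fun i => [])
    (B := fun i => csize (l i) * ((N i + 2) ^ k + 1) + 1) hl (nil hl.ctx)
    (((hl.polyBdd.mul (PolyBdd.add ⟨k, fun _ => le_rfl⟩ (.const 1))).add (.const 1))) ?_ ?_
  · refine h.reverse.congr fun i => ?_
    simp [foldl_cons_eq (g i)]
  · intro i pre suf h
    refine csize_list_le ?_ fun y hy => ?_
    · refine le_trans ?_ (length_le_csize _)
      simp [foldl_cons_eq (g i), h]
    · simp only [foldl_cons_eq (g i), List.append_nil, List.mem_reverse, List.mem_map] at hy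
      obtain ⟨e, he, rfl⟩ := hy
      exact hk ⟨i, e, by rw [h]; exact List.mem_append_left _ he⟩
  · intro d x' hx he hacc
    let φ : FoldIdx l → MemIdx l := fun j => ⟨j.i, j.e, by rw [j.eq]; simp⟩
    have h1 : PolyTime (fun j => N j.i) x' fun j => g j.i j.e :=
      RawPolyTime.trans (hx.pair he) (RawPolyTime.reindex hstep φ)
    exact h1.cons hacc

theorem flatten {L : ∀ i, List (List (X i))} (hL : PolyTime N x L) :
    PolyTime N x fun i => (L i).flatten := by
  have h := foldl (g := fun i (acc : List (X i)) e => acc ++ e) (s := fun i => [])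
    (B := fun i => csize (L i)) hL (nil hL.ctx) hL.polyBdd ?_ ?_
  · refine h.congr fun i => ?_
    rw [foldl_append_eq_flatten]
  · intro i pre suf h
    have := csize_flatten_le pre
    rw [← foldl_append_eq_flatten] at this
    exact this.trans (csize_prefix_le h)
  · intro d x' hx he hacc
    exact hacc.append he

theorem flatMap {l : ∀ i, List (X i)} {g : ∀ i, X i → List (Y i)} (hl : PolyTime N x l)
    (hg : ∀ {d : Ty} {x' : MemIdx l → d.Val}, RawPolyTime (fun j => N j.i) x' (fun j => x j.i) →
      PolyTime (fun j => N j.i) x' (fun j => j.e) →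
      PolyTime (fun j => N j.i) x' (fun j => g j.i j.e)) :
    PolyTime N x fun i => (l i).flatMap (g i) := by
  simp only [List.flatMap]
  exact (map hl hg).flatten

theorem filter {l : ∀ i, List (X i)} {P : ∀ i, X i → Prop} [∀ i e, Decidable (P i e)]
    (hl : PolyTime N x l)
    (hP : ∀ {d : Ty} {x' : MemIdx l → d.Val}, RawPolyTime (fun j => N j.i) x' (fun j => x j.i) →
      PolyTime (fun j => N j.i) x' (fun j => j.e) →
      PolyTimeDec (fun j => N j.i) x' (fun j => P j.i j.e)) :
    PolyTime N x fun i => (l i).filter (fun e => P i e) := by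
  have h := flatMap (g := fun i e => if P i e then [e] else []) hl fun hx he =>
    ite (hP hx he) (singleton he) (nil he.ctx)
  refine h.congr fun i => ?_
  induction l i with
  | nil => rfl
  | cons e l ih =>
    rw [List.flatMap_cons, ih]
    by_cases h : P i e <;> simp [h]

theorem range (hn : PolyTime N x n) (hn' : PolyBdd N n) :
    PolyTime N x fun i => List.range (n i) := by
  -- Counting down and consing produces the list in increasing order; the counter serves as the loop
  -- test.
  let s : ι → ℕ → (Ty.prod .nat (.list .nat)).Val := fun i j => (n i - j, List.range' (n i - j) j)
  have hs : Small (fun j : {j : ι × ℕ // j.2 ≤ n j.1} => N j.1.1) fun j => s j.1.1 j.1.2 := by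
    have h1 : PolyBdd (fun j : {j : ι × ℕ // j.2 ≤ n j.1} => N j.1.1) fun j => n j.1.1 :=
      hn'.comp _
    refine (((h1.add (.const 1)).add ((h1.mul (h1.add (.const 2))).add (.const 1))).add
      (.const 1)).mono fun j => ?_
    have h2 : ∀ k, (Ty.nat).size k ≤ k + 1 := fun k =>
      Nat.add_le_add_right (Nat.size_le_self k) 1
    have h3 := Ty.size_list_le (b := .nat) (l := List.range' (n j.1.1 - j.1.2) j.1.2)
      (n := n j.1.1) (s := n j.1.1 + 1) (by simpa using j.2) fun k hk => by
        have h4 : (k : ℕ) ≤ n j.1.1 := by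
          have h5 : j.1.2 ≤ n j.1.1 := j.2
          have h6 := (List.mem_range'_1.1 hk).2
          rw [Nat.sub_add_cancel h5] at h6
          exact h6.le
        exact (h2 k).trans (Nat.add_le_add_right h4 1)
    change (Ty.nat).size (n j.1.1 - j.1.2) + (Ty.list .nat).size _ + 1 ≤ _
    have h6 := h2 (n j.1.1 - j.1.2)
    have h7 : n j.1.1 - j.1.2 ≤ n j.1.1 := Nat.sub_le _ _
    refine Nat.add_le_add_right (Nat.add_le_add (by omega) h3) 1
  have main : RawPolyTime N (fun i => s i 0) fun i => s i (n i) := by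
    refine RawPolyTime.loop (v := fun i j => n i - j) hn' (RawPolyTime.id hs).fst ?_ ?_ ?_
    · intro i; simp
    · intro i j hj; omega
    · have hs' : RawPolyTime (fun j : {j : ι × ℕ // j.2 < n j.1} => N j.1.1)
          (fun j => s j.1.1 j.1.2) fun j => s j.1.1 j.1.2 :=
        RawPolyTime.id (hs.comp (fun j : {j : ι × ℕ // j.2 < n j.1} => ⟨j.1, j.2.le⟩))
      have h1 : PolyTime (fun j : {j : ι × ℕ // j.2 < n j.1} => N j.1.1)
          (fun j => s j.1.1 j.1.2) fun j => n j.1.1 - j.1.2 - 1 :=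
        sub (n := fun _ => 1) hs'.fst (natConst hs' 1)
      have h2 := RawPolyTime.pair h1 ((RawPolyTime.pair h1 hs'.snd).app .cons)
      have e : ∀ j : {j : ι × ℕ // j.2 < n j.1},
          s j.1.1 (j.1.2 + 1) = (n j.1.1 - j.1.2 - 1, (n j.1.1 - j.1.2 - 1) :: (s j.1.1 j.1.2).2) := by
        rintro ⟨⟨i, j⟩, hj⟩
        simp only at hj
        have e1 : n i - (j + 1) + 1 = n i - j := by omega
        simp only [s, Nat.sub_sub, List.range'_succ, e1]
      simp only [e]
      exact h2
  have h := (RawPolyTime.pair hn (nil hn.ctx (Y := fun _ => ℕ))).trans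
    (z := fun i => s i (n i)) (by
      have e : ∀ i, s i 0 = (n i, []) := fun i => by simp [s]
      simp only [e] at main
      exact main)
  have h' := h.snd
  refine (show PolyTime N x (fun i => List.range' (n i - n i) (n i)) from ?_).congr fun i => ?_
  · have e : ∀ l : List ℕ, Code.enc l = l := fun l => List.map_id' l
    simp only [PolyTime, e]
    exact h'
  · rw [Nat.sub_self, List.range_eq_range']

/-- Entries are dropped one at a time, so the value of `n`, not just its bit length, has to be
polynomially bounded. -/
theorem drop {l : ∀ i, List (Y i)} (hl : PolyTime N x l) (hn : PolyTime N x n)  (hn' : PolyBdd N n) :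
    PolyTime N x fun i => (l i).drop (n i) := by
  have key : ∀ (i : ι) (r : List ℕ),
      r.foldl (fun (acc : List (Y i)) (_ : ℕ) => acc.tail) (l i) = (l i).drop r.length := by
    intro i r
    induction r using List.reverseRecOn with
    | nil => rfl
    | append_singleton r k ih => simp [ih, List.tail_drop]
  have h := foldl (g := fun i (acc : List (Y i)) (_ : ℕ) => acc.tail) (s := l)
    (B := fun i => csize (l i)) (range hn hn') hl hl.polyBdd ?_ ?_
  · refine h.congr fun i => ?_
    rw [key, List.length_range]
  · intro i pre suf _
    rw [key]
    have h1 := csize_append ((l i).take pre.length) ((l i).drop pre.length)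
    have h2 := Ty.one_le_size _ (Code.enc ((l i).take pre.length))
    rw [List.take_append_drop] at h1
    change 1 ≤ csize _ at h2
    omega
  · intro d x' hx he hacc
    exact hacc.tail

theorem getD {l : ∀ i, List (Y i)} {y : ∀ i, Y i} (hl : PolyTime N x l) (hn : PolyTime N x n)
    (hn' : PolyBdd N n) (hy : PolyTime N x y) : PolyTime N x fun i => (l i).getD (n i) (y i) := by
  refine ((hl.drop hn hn').headD hy).congr fun i => ?_
  rw [List.headD_eq_head?_getD, List.head?_drop, List.getD_eq_getElem?_getD]

/-- Taking is dropping from the reversed list. The number of entries dropped is at most the length,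
so `n` itself need not be bounded in value. -/
theorem take {l : ∀ i, List (Y i)} (hl : PolyTime N x l) (hn : PolyTime N x n) :
    PolyTime N x fun i => (l i).take (n i) := by
  refine ((hl.reverse.drop (hl.length.sub hn) ?_).reverse).congr fun i => ?_
  · exact hl.polyBdd.mono fun i => (Nat.sub_le _ _).trans (length_le_csize _)
  · rw [List.drop_reverse, List.reverse_reverse]
    rcases le_total (n i) (l i).length with h | h
    · congr 1; omega
    · rw [List.take_of_length_le h, List.take_of_length_le (by omega)]

end PolyTime

theorem polyTimeDec_iff {P : ι → Prop} [∀ i, Decidable (P i)] :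
    PolyTimeDec N x P ↔ PolyTime N x fun i => if P i then 1 else 0 := by
  have e : ∀ i, Code.enc (if P i then 1 else 0) =
      @ite ℕ (P i) (Classical.propDecidable (P i)) 1 0 := by
    intro i
    by_cases h : P i <;> simp [h, Code.enc]
  simp only [PolyTime, PolyTimeDec, e]

namespace PolyTimeDec

variable {P Q : ι → Prop} {m n : ι → ℕ}

theorem ctx (h : PolyTimeDec N x P) : RawPolyTime N x x := RawPolyTime.self h

theorem congr (h : PolyTimeDec N x P) (hPQ : ∀ i, P i ↔ Q i) : PolyTimeDec N x Q := by
  obtain rfl : P = Q := funext fun i => propext (hPQ i)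
  exact h

theorem ne_zero (h : PolyTime N x n) : PolyTimeDec N x fun i => n i ≠ 0 := by
  rw [polyTimeDec_iff]
  exact RawPolyTime.ite (b := .nat) (P := fun i => n i ≠ 0) (y := fun _ => (1 : ℕ))
    (z := fun _ => (0 : ℕ)) h (fun _ => Iff.rfl)
    ((PolyTime.natConst h.ctx 1).reindex _) ((PolyTime.natConst h.ctx 0).reindex _)

theorem not (h : PolyTimeDec N x P) : PolyTimeDec N x fun i => ¬ P i := by
  classical
  have h1 := polyTimeDec_iff.1 h
  refine (ne_zero ((PolyTime.natConst h.ctx 1).sub h1)).congr fun i => ?_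
  by_cases hi : P i <;> simp [hi]

theorem and' (hP : PolyTimeDec N x P)
    (hQ : PolyTimeDec (fun i : {i // P i} => N i.1) (fun i => x i.1) fun i => Q i.1) :
    PolyTimeDec N x fun i => P i ∧ Q i := by
  classical
  have h1 : PolyTime N x fun i => if P i then (if Q i then 1 else 0) else 0 := by
    refine PolyTime.ite' hP ?_ ((PolyTime.natConst hP.ctx 0).reindex _)
    exact polyTimeDec_iff.1 hQ
  refine (ne_zero h1).congr fun i => ?_
  by_cases hi : P i <;> by_cases hi' : Q i <;> simp [hi, hi']

theorem and (hP : PolyTimeDec N x P) (hQ : PolyTimeDec N x Q) :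
    PolyTimeDec N x fun i => P i ∧ Q i :=
  hP.and' (RawPolyTime.reindex hQ Subtype.val)

theorem eq_zero (h : PolyTime N x n) : PolyTimeDec N x fun i => n i = 0 :=
  (ne_zero h).not.congr fun _ => not_not

theorem natLe (hm : PolyTime N x m) (hn : PolyTime N x n) : PolyTimeDec N x fun i => m i ≤ n i :=
  (eq_zero (hm.sub hn)).congr fun _ => Nat.sub_eq_zero_iff_le

theorem natLt (hm : PolyTime N x m) (hn : PolyTime N x n) : PolyTimeDec N x fun i => m i < n i :=
  (natLe hn hm).not.congr fun _ => not_le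

theorem natEq (hm : PolyTime N x m) (hn : PolyTime N x n) : PolyTimeDec N x fun i => m i = n i :=
  ((natLe hm hn).and (natLe hn hm)).congr fun _ => le_antisymm_iff.symm

theorem natDvd (hm : PolyTime N x m) (hn : PolyTime N x n) : PolyTimeDec N x fun i => m i ∣ n i :=
  (eq_zero (hn.mod hm)).congr fun _ => (Nat.dvd_iff_mod_eq_zero).symm

theorem eq_nil {l : ∀ i, List (Y i)} (hl : PolyTime N x l) : PolyTimeDec N x fun i => l i = [] :=
  (eq_zero hl.length).congr fun _ => List.length_eq_zero_iff

theorem forall_mem {l : ∀ i, List (X i)} {P : ∀ i, X i → Prop} (hl : PolyTime N x l)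
    (hP : ∀ {d : Ty} {x' : MemIdx l → d.Val}, RawPolyTime (fun j => N j.i) x' (fun j => x j.i) →
      PolyTime (fun j => N j.i) x' (fun j => j.e) →
      PolyTimeDec (fun j => N j.i) x' (fun j => P j.i j.e)) :
    PolyTimeDec N x fun i => ∀ e ∈ l i, P i e := by
  classical
  refine (eq_nil (PolyTime.filter (P := fun i e => ¬ P i e) hl
    fun hx he => (hP hx he).not)).congr fun i => ?_
  simp [List.filter_eq_nil_iff]

end PolyTimeDec

end

/-! ### Further arithmetic in polynomial time -/

/-- The binary digits of a number, the least significant digit first. -/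
def bitList (n : ℕ) : List ℕ := (List.range (Nat.size n)).map fun k => n / 2 ^ k % 2

theorem Nat.size_prod_le (l : List ℕ) : Nat.size l.prod ≤ (l.map Nat.size).sum + 1 := by
  induction l with
  | nil => simp
  | cons n l ih =>
    have := Nat.size_mul_le n l.prod
    simp only [List.prod_cons, List.map_cons, List.sum_cons]
    omega

theorem Nat.div_size_eq_zero_iff {n j : ℕ} : n / 2 ^ j = 0 ↔ Nat.size n ≤ j := by
  rw [Nat.size_le, Nat.div_eq_zero_iff]
  have : 2 ^ j ≠ 0 := by positivity
  tauto

/-- Exponentiation by repeated squaring. -/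
theorem foldr_bitList {M : Type*} [Monoid M] (a : M) (n : ℕ) :
    (bitList n).foldr (fun b acc => acc * acc * if b = 0 then 1 else a) 1 = a ^ n := by
  -- Generalized to the lowest `s` digits, so that the induction can split off the last digit and
  -- pass to `n / 2`.
  have key : ∀ s n : ℕ, ((List.range s).map fun k => n / 2 ^ k % 2).foldr
      (fun b acc => acc * acc * if b = 0 then 1 else a) 1 = a ^ (n % 2 ^ s) := by
    intro s
    induction s with
    | zero => intro n; simp [Nat.mod_one]
    | succ s ih =>
      intro n
      have e : (fun k => n / 2 ^ k % 2) ∘ Nat.succ = fun k => n / 2 / 2 ^ k % 2 := by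
        funext k
        simp only [Function.comp, Nat.succ_eq_add_one, pow_succ', Nat.div_div_eq_div_mul]
      rw [List.range_succ_eq_map, List.map_cons, List.map_map, List.foldr_cons, e, ih,
        ← pow_add, pow_succ', Nat.mod_mul]
      have h2 : n % 2 = 0 ∨ n % 2 = 1 := by omega
      rcases h2 with h | h
      · simp [h]; congr 1; omega
      · simp [h]; rw [← pow_succ]; congr 1; omega
  rw [bitList, key, Nat.mod_eq_of_lt (Nat.lt_size_self n)]

section

variable {ι κ : Type*} {N : ι → ℕ} {a b c e : Ty} {x : ι → a.Val} {m n : ι → ℕ}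

theorem enc_natList (l : List ℕ) : Code.enc l = l := List.map_id' l

namespace PolyTime

theorem polyBdd_size (hm : PolyTime N x m) : PolyBdd N fun i => Nat.size (m i) :=
  hm.polyBdd.mono fun i => by rw [csize_nat]; omega

theorem natPow (hm : PolyTime N x m) (hn : PolyTime N x n) (hn' : PolyBdd N n) :
    PolyTime N x fun i => m i ^ n i := by
  have key : ∀ (i : ι) (r : List ℕ), r.foldl (fun (acc : ℕ) (_ : ℕ) => acc * m i) 1 =
      m i ^ r.length := by
    intro i r
    induction r using List.reverseRecOn with
    | nil => rfl
    | append_singleton r k ih => simp [ih, pow_succ]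
  have h := foldl (g := fun i (acc : ℕ) (_ : ℕ) => acc * m i) (s := fun _ => 1)
    (B := fun i => n i * Nat.size (m i) + 1 + 1) (range hn hn') (natConst hn.ctx 1)
    (((hn'.mul hm.polyBdd_size).add (.const 1)).add (.const 1)) ?_ ?_
  · refine h.congr fun i => ?_
    rw [key, List.length_range]
  · intro i pre suf h
    have h1 := congrArg List.length h
    simp only [List.length_range, List.length_append] at h1
    have h2 := Nat.size_pow_le (m i) pre.length
    have h3 : pre.length * Nat.size (m i) ≤ n i * Nat.size (m i) :=
      Nat.mul_le_mul_right _ (by omega)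
    rw [key, csize_nat]
    omega
  · intro d x' hx he hacc
    exact hacc.mul (hm.weaken hx)

theorem natProd {l : ι → List ℕ} (hl : PolyTime N x l) : PolyTime N x fun i => (l i).prod := by
  have h := foldl (g := fun i (acc : ℕ) (k : ℕ) => acc * k) (s := fun _ => 1)
    (B := fun i => csize (l i) + 1) hl (natConst hl.ctx 1) (hl.polyBdd.add (.const 1)) ?_ ?_
  · refine h.congr fun i => ?_
    rw [List.prod_eq_foldl]
  · intro i pre suf h
    have h1 := csize_prefix_le h
    have h2 := Nat.size_prod_le pre
    have h3 : (pre.map Nat.size).sum ≤ (pre.map csize).sum :=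
      List.sum_le_sum fun k _ => by rw [csize_nat]; omega
    rw [csize_list] at h1
    rw [← List.prod_eq_foldl, csize_nat]
    omega
  · intro d x' hx he hacc
    exact hacc.mul he

theorem bitList (hn : PolyTime N x n) : PolyTime N x fun i => bitList (n i) := by
  -- The quotient is halved until it is zero, which takes `Nat.size (n i)` rounds. Consing leaves
  -- the most significant digit in front, so the list is reversed at the end.
  let s : ι → ℕ → (Ty.prod .nat (.list .nat)).Val := fun i j =>
    (n i / 2 ^ j, ((List.range j).map fun k => n i / 2 ^ k % 2).reverse)
  have hb := hn.polyBdd_size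
  have hs : Small (fun j : {j : ι × ℕ // j.2 ≤ Nat.size (n j.1)} => N j.1.1)
      fun j => s j.1.1 j.1.2 := by
    have h1 : PolyBdd (fun j : {j : ι × ℕ // j.2 ≤ Nat.size (n j.1)} => N j.1.1)
      fun j => Nat.size (n j.1.1) := hb.comp _
    refine (((h1.add (.const 1)).add ((h1.mul (.const 4)).add (.const 1))).add
      (.const 1)).mono fun j => ?_
    refine Nat.add_le_add_right (Nat.add_le_add (Nat.add_le_add_right
      (Nat.size_le_size (Nat.div_le_self _ _)) 1) ?_) 1
    refine Ty.size_list_le (b := .nat) (s := 3)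
      (by simp only [s, List.length_reverse, List.length_map, List.length_range]; exact j.2)
      fun k hk => ?_
    obtain ⟨r, -, rfl⟩ := List.mem_map.1 (List.mem_reverse.1 hk)
    have h2 := Nat.size_le_self (n j.1.1 / 2 ^ r % 2)
    have h3 : n j.1.1 / 2 ^ r % 2 < 2 := Nat.mod_lt _ (by norm_num)
    change Nat.size (n j.1.1 / 2 ^ r % 2) + 1 ≤ 3
    omega
  have main : RawPolyTime N (fun i => s i 0) fun i => s i (Nat.size (n i)) := by
    refine RawPolyTime.loop (v := fun i j => n i / 2 ^ j) hb (RawPolyTime.id hs).fst ?_ ?_ ?_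
    · intro i
      exact Nat.div_size_eq_zero_iff.2 le_rfl
    · intro i j hj h
      exact absurd (Nat.div_size_eq_zero_iff.1 h) (by omega)
    · have hs' : RawPolyTime (fun j : {j : ι × ℕ // j.2 < Nat.size (n j.1)} => N j.1.1)
          (fun j => s j.1.1 j.1.2) fun j => s j.1.1 j.1.2 :=
        RawPolyTime.id (hs.comp
          (fun j : {j : ι × ℕ // j.2 < Nat.size (n j.1)} => ⟨j.1, j.2.le⟩))
      have h0 : PolyTime (fun j : {j : ι × ℕ // j.2 < Nat.size (n j.1)} => N j.1.1)
          (fun j => s j.1.1 j.1.2) fun j => n j.1.1 / 2 ^ j.1.2 := hs'.fst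
      have h1 := h0.div (natConst hs' 2)
      have h2 := h0.mod (natConst hs' 2)
      have h3 := RawPolyTime.pair h1 ((RawPolyTime.pair h2 hs'.snd).app .cons)
      have e : ∀ j : {j : ι × ℕ // j.2 < Nat.size (n j.1)}, s j.1.1 (j.1.2 + 1) =
          (n j.1.1 / 2 ^ j.1.2 / 2, (n j.1.1 / 2 ^ j.1.2 % 2) :: (s j.1.1 j.1.2).2) := by
        rintro ⟨⟨i, j⟩, hj⟩
        simp [s, List.range_succ, pow_succ, Nat.div_div_eq_div_mul]
      simp only [e]
      exact h3
  have h := (RawPolyTime.pair hn (nil hn.ctx (Y := fun _ => ℕ))).trans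
    (z := fun i => s i (Nat.size (n i))) (by
      have e : ∀ i, s i 0 = (n i, []) := fun i => by simp [s]
      simp only [e] at main
      exact main)
  have h' : PolyTime N x fun i => (s i (Nat.size (n i))).2 := by
    simp only [PolyTime, enc_natList]
    exact h.snd
  refine h'.reverse.congr fun i => ?_
  exact List.reverse_reverse _

end PolyTime

theorem PolyTimeDec.natListEq {l l' : ι → List ℕ} (hl : PolyTime N x l) (hl' : PolyTime N x l') :
    PolyTimeDec N x fun i => l i = l' i := by
  have hb : PolyBdd N fun i => (l i).length := hl.polyBdd.mono fun i => length_le_csize _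
  refine ((natEq hl.length hl'.length).and (forall_mem
    (P := fun i k => (l i).getD k 0 = (l' i).getD k 0) (PolyTime.range hl.length hb)
    fun {d x'} hx he => ?_)).congr fun i => ?_
  · have hk : PolyBdd (fun j : MemIdx fun i => List.range (l i).length => N j.i)
        fun j => j.e := (hb.comp MemIdx.i).mono fun j => (List.mem_range.1 j.mem).le
    exact natEq ((hl.weaken hx).getD he hk (PolyTime.natConst hx.self 0))
      ((hl'.weaken hx).getD he hk (PolyTime.natConst hx.self 0))
  · constructor
    · rintro ⟨h1, h2⟩
      refine List.ext_getElem h1 fun k hk hk' => ?_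
      have := h2 k (List.mem_range.2 hk)
      rwa [List.getD_eq_getElem _ _ hk, List.getD_eq_getElem _ _ hk'] at this
    · intro h
      simp [h]

end

universe u

/-! ### Finite fields -/

/-- A finite field with a presentation. -/
structure FieldData : Type (u + 1) where
  /-- The characteristic. -/
  p : ℕ
  /-- The field. -/
  F : Type u
  [prime : Fact p.Prime]
  [field : Field F]
  [algebra : Algebra (ZMod p) F]
  /-- The coefficients of the defining polynomial. -/
  f : List ℕ
  /-- The generator. -/
  θ : F
  pres : Presents p f θ

attribute [instance] FieldData.prime FieldData.field FieldData.algebra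

theorem listPoly_cons (p a : ℕ) (c : List ℕ) :
    listPoly p (a :: c) = C (a : ZMod p) + X * listPoly p c := by
  unfold listPoly
  change ∑ i : Fin (c.length + 1), _ = _
  rw [Fin.sum_univ_succ, Finset.mul_sum]
  congr 1
  · simp
  · refine Finset.sum_congr rfl fun i _ => ?_
    simp [pow_succ]
    ring

theorem listPoly_eq_sum (p : ℕ) (c : List ℕ) :
    listPoly p c = ∑ j ∈ Finset.range c.length, C ((c.getD j 0 : ℕ) : ZMod p) * X ^ j := by
  rw [Finset.sum_range]
  unfold listPoly
  refine Finset.sum_congr rfl fun i _ => ?_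
  simp

theorem degree_listPoly_lt (p : ℕ) [Fact p.Prime] (c : List ℕ) :
    (listPoly p c).degree < c.length := by
  rw [listPoly_eq_sum]
  refine (Polynomial.degree_sum_le _ _).trans_lt ?_
  rw [Finset.sup_lt_iff (by exact WithBot.bot_lt_coe _)]
  intro j hj
  refine (Polynomial.degree_C_mul_X_pow_le _ _).trans_lt ?_
  exact_mod_cast Finset.mem_range.1 hj

theorem degree_X_pow_add_listPoly (p : ℕ) [Fact p.Prime] (c : List ℕ) :
    (X ^ c.length + listPoly p c).degree = (c.length : WithBot ℕ) := by
  rw [degree_add_eq_left_of_degree_lt] <;> rw [degree_X_pow]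
  exact degree_listPoly_lt p c

namespace FieldData

variable (D : FieldData.{u})

/-- The degree of the field over its prime field. -/
def k : ℕ := D.f.length

/-- The number of elements of the field. -/
def q : ℕ := D.p ^ D.k

theorem card_eq : Nat.card D.F = D.q := D.pres.card

theorem q_pos : 0 < D.q := pow_pos D.prime.out.pos _

instance : Finite D.F := Nat.finite_of_card_ne_zero (by rw [card_eq]; exact D.q_pos.ne')

instance : CharP D.F D.p := charP_of_injective_algebraMap (algebraMap (ZMod D.p) D.F).injective D.p

theorem aeval_listPoly (c : List ℕ) : aeval D.θ (listPoly D.p c) =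
    ∑ j ∈ Finset.range c.length, ((c.getD j 0 : ℕ) : D.F) * D.θ ^ j := by
  rw [listPoly_eq_sum, map_sum]
  refine Finset.sum_congr rfl fun j _ => ?_
  simp

theorem monic : (X ^ D.k + listPoly D.p D.f).Monic :=
  monic_X_pow_add (degree_listPoly_lt D.p D.f)

theorem minpoly_eq : minpoly (ZMod D.p) D.θ = X ^ D.k + listPoly D.p D.f :=
  (minpoly.eq_of_irreducible_of_monic D.pres.irreducible D.pres.root D.monic).symm

theorem degree_minpoly : (minpoly (ZMod D.p) D.θ).degree = D.k := by
  rw [minpoly_eq]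
  exact degree_X_pow_add_listPoly D.p D.f

theorem k_pos : 0 < D.k := by
  have h := Polynomial.degree_pos_of_irreducible D.pres.irreducible
  rw [degree_X_pow_add_listPoly D.p D.f] at h
  exact_mod_cast h

/-- The element with given coordinates. -/
noncomputable def ofFun (g : Fin D.k → ZMod D.p) : D.F :=
  ∑ j : Fin D.k, algebraMap (ZMod D.p) D.F (g j) * D.θ ^ (j : ℕ)

/-- The difference of two coordinate vectors with the same value is a polynomial of degree less than
`k` vanishing at θ, whereas the minimal polynomial of θ has degree `k`. -/
theorem ofFun_injective : Function.Injective D.ofFun := by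
  intro g g' h
  have h1 : aeval D.θ (∑ j : Fin D.k, C (g j - g' j) * X ^ (j : ℕ)) = 0 := by
    simp only [ofFun] at h
    simp [map_sum, sub_mul, Finset.sum_sub_distrib, h]
  by_contra hne
  obtain ⟨j, hj⟩ := Function.ne_iff.1 hne
  have h2 : (∑ j : Fin D.k, C (g j - g' j) * X ^ (j : ℕ)) ≠ 0 := by
    intro h0
    have h3 := congrArg (fun P => P.coeff (j : ℕ)) h0
    simp only [finsetSum_coeff, coeff_C_mul, coeff_X_pow, coeff_zero] at h3
    rw [Finset.sum_eq_single j] at h3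
    · simp at h3
      exact hj (sub_eq_zero.1 h3)
    · intro i _ hi
      have : (j : ℕ) ≠ i := fun h => hi (Fin.ext h.symm)
      simp [this]
    · simp
  have h4 := minpoly.degree_le_of_ne_zero (ZMod D.p) D.θ h2 h1
  rw [degree_minpoly] at h4
  have h5 : (∑ j : Fin D.k, C (g j - g' j) * X ^ (j : ℕ)).degree < (D.k : WithBot ℕ) := by
    refine (Polynomial.degree_sum_le _ _).trans_lt ?_
    rw [Finset.sup_lt_iff (by exact WithBot.bot_lt_coe _)]
    intro j _
    refine (Polynomial.degree_C_mul_X_pow_le _ _).trans_lt ?_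
    exact_mod_cast j.2
  exact absurd h4 (not_le.2 h5)

/-- Injectivity suffices, as both sides have p^k elements. Surjectivity gives every field element a
code. -/
theorem ofFun_bijective : Function.Bijective D.ofFun := by
  have := Fintype.ofFinite D.F
  rw [Fintype.bijective_iff_injective_and_card]
  refine ⟨D.ofFun_injective, ?_⟩
  rw [← Nat.card_eq_fintype_card (α := D.F), card_eq]
  simp [q, ZMod.card]

theorem codesElem_of_sum (g : ℕ → ℕ) : CodesElem D.p D.k D.θ
    ((List.range D.k).map fun j => g j % D.p) (∑ j ∈ Finset.range D.k, (g j : D.F) * D.θ ^ j) := by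
  refine ⟨by simp, ?_, ?_⟩
  · intro a ha
    obtain ⟨j, -, rfl⟩ := List.mem_map.1 ha
    exact Nat.mod_lt _ D.prime.out.pos
  · rw [aeval_listPoly]
    simp only [List.length_map, List.length_range]
    refine Finset.sum_congr rfl fun j hj => ?_
    rw [List.getD_eq_getElem _ _ (by simpa using hj)]
    simp only [List.getElem_map, List.getElem_range]
    rw [← CharP.natCast_eq_natCast_mod D.F D.p]

theorem exists_code (x : D.F) : ∃ c, CodesElem D.p D.k D.θ c x := by
  obtain ⟨g, rfl⟩ := D.ofFun_bijective.2 x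
  have h := D.codesElem_of_sum fun j => if h : j < D.k then (g ⟨j, h⟩).val else 0
  have : NeZero D.p := ⟨D.prime.out.ne_zero⟩
  refine ⟨_, Eq.subst (motive := CodesElem D.p D.k D.θ _) ?_ h⟩
  rw [Finset.sum_range, ofFun]
  refine Finset.sum_congr rfl fun j _ => ?_
  congr 1
  rw [dif_pos j.2, ← map_natCast (algebraMap (ZMod D.p) D.F), ZMod.natCast_zmod_val]

theorem codesElem_unique {c c' : List ℕ} {x : D.F} (h : CodesElem D.p D.k D.θ c x)
    (h' : CodesElem D.p D.k D.θ c' x) : c = c' := by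
  have aux : ∀ c : List ℕ, CodesElem D.p D.k D.θ c x →
      D.ofFun (fun j => ((c.getD j 0 : ℕ) : ZMod D.p)) = x := by
    rintro c ⟨h1, -, h3⟩
    rw [aeval_listPoly, h1, Finset.sum_range] at h3
    simpa [ofFun] using h3
  have e := D.ofFun_injective ((aux c h).trans (aux c' h').symm)
  refine List.ext_getElem (h.1.trans h'.1.symm) fun j hj hj' => ?_
  have e1 := congrFun e ⟨j, h.1 ▸ hj⟩
  simp only [List.getD_eq_getElem _ _ hj, List.getD_eq_getElem _ _ hj'] at e1
  rw [ZMod.natCast_eq_natCast_iff'] at e1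
  rwa [Nat.mod_eq_of_lt (h.2.1 _ (List.getElem_mem hj)),
    Nat.mod_eq_of_lt (h'.2.1 _ (List.getElem_mem hj'))] at e1

/-- The code of a field element. -/
noncomputable def code (x : D.F) : List ℕ := (D.exists_code x).choose

theorem code_spec (x : D.F) : CodesElem D.p D.k D.θ (D.code x) x := (D.exists_code x).choose_spec

variable {D}

theorem code_eq {c : List ℕ} {x : D.F} (h : CodesElem D.p D.k D.θ c x) : D.code x = c :=
  D.codesElem_unique (D.code_spec x) h

theorem code_injective : Function.Injective D.code := fun x y h => by
  rw [← (D.code_spec x).2.2, h, (D.code_spec y).2.2]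

theorem length_code (x : D.F) : (D.code x).length = D.k := (D.code_spec x).1

theorem eq_sum_code (x : D.F) :
    x = ∑ j ∈ Finset.range D.k, (((D.code x).getD j 0 : ℕ) : D.F) * D.θ ^ j := by
  conv_lhs => rw [← (D.code_spec x).2.2, aeval_listPoly, length_code]

theorem code_sum (g : ℕ → ℕ) : D.code (∑ j ∈ Finset.range D.k, (g j : D.F) * D.θ ^ j) =
    (List.range D.k).map fun j => g j % D.p := code_eq (D.codesElem_of_sum g)

theorem code_zero : D.code 0 = (List.range D.k).map fun _ => 0 := by
  simpa using code_sum (D := D) fun _ => 0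

theorem code_one : D.code 1 = (List.range D.k).map fun j => if j = 0 then 1 else 0 := by
  have h := code_sum (D := D) fun j => if j = 0 then 1 else 0
  have e : ∑ j ∈ Finset.range D.k, (((if j = 0 then 1 else 0 : ℕ)) : D.F) * D.θ ^ j = 1 := by
    rw [Finset.sum_eq_single 0]
    · simp
    · intro j _ hj; simp [hj]
    · intro h; exact absurd (Finset.mem_range.2 D.k_pos) h
  rw [e] at h
  rw [h]
  refine List.map_congr_left fun j _ => Nat.mod_eq_of_lt ?_
  have := D.prime.out.one_lt
  split_ifs <;> omega

/-- One operation covers several: `n = 1` is addition, `n = p - 1` gives subtraction, and the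
general case is a step of Horner's rule in `foldr_code`. -/
theorem code_natCast_mul_add (n : ℕ) (x y : D.F) : D.code (n * x + y) =
    (List.range D.k).map fun j => (n * (D.code x).getD j 0 + (D.code y).getD j 0) % D.p := by
  rw [← code_sum]
  congr 1
  conv_lhs => rw [eq_sum_code x, eq_sum_code y, Finset.mul_sum, ← Finset.sum_add_distrib]
  refine Finset.sum_congr rfl fun j _ => ?_
  push_cast
  ring

/-- The defining equation solved for the top power; `p - f_j` represents the negative of `f_j` by a
natural number, which is legitimate as `f_j < p`. -/
theorem pow_k_eq : D.θ ^ D.k =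
    ∑ j ∈ Finset.range D.k, ((D.p - D.f.getD j 0 : ℕ) : D.F) * D.θ ^ j := by
  have h := D.pres.root
  rw [map_add, map_pow, aeval_X, aeval_listPoly] at h
  rw [show D.f.length = D.k from rfl] at h
  rw [eq_neg_of_add_eq_zero_left h, ← Finset.sum_neg_distrib]
  refine Finset.sum_congr rfl fun j hj => ?_
  have h1 : D.f.getD j 0 < D.p := by
    rw [List.getD_eq_getElem _ _ (Finset.mem_range.1 hj)]
    exact D.pres.lt _ (List.getElem_mem _)
  rw [Nat.cast_sub h1.le, CharP.cast_eq_zero D.F D.p]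
  ring

/-- The coordinates are shifted by one place, and the coordinate pushed out at the top is reduced by
`pow_k_eq`. -/
theorem code_root_mul (x : D.F) : D.code (D.θ * x) = (List.range D.k).map fun j =>
    ((if j = 0 then 0 else (D.code x).getD (j - 1) 0) +
      (D.p - D.f.getD j 0) * (D.code x).getD (D.k - 1) 0) % D.p := by
  rw [← code_sum]
  congr 1
  conv_lhs => rw [eq_sum_code x, Finset.mul_sum]
  obtain ⟨k, hk⟩ := Nat.exists_eq_succ_of_ne_zero D.k_pos.ne'
  have h := pow_k_eq (D := D)
  rw [hk] at h ⊢
  simp only [Nat.cast_add, Nat.cast_mul, add_mul, Finset.sum_add_distrib]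
  rw [Finset.sum_range_succ, Finset.sum_range_succ' _ k]
  simp only [Nat.succ_eq_add_one, Nat.add_sub_cancel] at h ⊢
  have e : D.θ * (((D.code x).getD k 0 : ℕ) * D.θ ^ k) = (((D.code x).getD k 0 : ℕ) : D.F) * D.θ ^ (k + 1) := by
    ring
  rw [e, h, Finset.mul_sum]
  simp only [if_true, Nat.cast_zero, zero_mul, add_zero, Nat.add_eq_zero_iff, one_ne_zero, and_false,
    if_false]
  congr 1
  · exact Finset.sum_congr rfl fun j _ => by ring
  · exact Finset.sum_congr rfl fun j _ => by ring

/-- Horner's rule in θ: multiplication in the field is reduced to multiplication by θ and by natural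
numbers. -/
theorem foldr_code (x y : D.F) :
    (D.code x).foldr (fun (n : ℕ) acc => (n : D.F) * y + D.θ * acc) 0 = x * y := by
  have key : ∀ c : List ℕ, c.foldr (fun (n : ℕ) acc => (n : D.F) * y + D.θ * acc) 0 =
      aeval D.θ (listPoly D.p c) * y := by
    intro c
    induction c with
    | nil => simp [listPoly]
    | cons a c ih =>
      rw [List.foldr_cons, ih, listPoly_cons]
      simp
      ring
  rw [key, (D.code_spec x).2.2]

end FieldData

/-! ### Field arithmetic in polynomial time -/

noncomputable instance FieldData.codeF (D : FieldData.{u}) : Code (.list .nat) D.F := ⟨D.code⟩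

instance FieldData.codeData : Code (.prod .nat (.list .nat)) FieldData.{u} := ⟨fun D => (D.p, D.f)⟩

namespace FieldData

theorem csize_eq (D : FieldData.{u}) : csize D = csize D.p + csize D.f + 1 := by
  rw [← csize_prod (D.p, D.f)]
  change Ty.size _ _ = Ty.size _ _
  simp only [Code.enc]
  simp

theorem k_le_csize (D : FieldData.{u}) : D.k ≤ csize D := by
  have h := length_le_csize D.f
  rw [csize_eq]
  change D.f.length ≤ _
  omega

/-- Codes are reduced modulo `p` and have fixed length. Folds with a field element as accumulator
therefore satisfy the size hypothesis of `PolyTime.foldl` automatically, and elimination has no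
coefficient growth. -/
theorem csize_le {D : FieldData.{u}} (y : D.F) : csize y ≤ csize D * (csize D + 1) + 1 := by
  refine Ty.size_list_le (b := .nat) ?_ fun a ha => ?_
  · change (D.code y).length ≤ _
    rw [length_code]
    exact D.k_le_csize
  · have h1 := Nat.size_le_size ((D.code_spec y).2.1 a ha).le
    have h2 := csize_nat D.p
    rw [csize_eq]
    change Nat.size a + 1 ≤ _
    omega

end FieldData

section

variable {ι : Type*} {N : ι → ℕ} {a : Ty} {x : ι → a.Val} {n : ι → ℕ} {D : ι → FieldData.{u}}
  {y z : ∀ i, (D i).F}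

namespace PolyTime

theorem fieldChar (hD : PolyTime N x D) : PolyTime N x fun i => (D i).p := RawPolyTime.fst hD

theorem fieldPoly (hD : PolyTime N x D) : PolyTime N x fun i => (D i).f := by
  simp only [PolyTime, enc_natList]
  exact RawPolyTime.snd hD

theorem fieldDegree (hD : PolyTime N x D) : PolyTime N x fun i => (D i).k := hD.fieldPoly.length

theorem polyBdd_fieldDegree (hD : PolyTime N x D) : PolyBdd N fun i => (D i).k :=
  hD.polyBdd.mono fun i => (D i).k_le_csize

theorem polyBdd_field (hD : PolyTime N x D) :
    PolyBdd N fun i => csize (D i) * (csize (D i) + 1) + 1 :=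
  (hD.polyBdd.mul (hD.polyBdd.add (.const 1))).add (.const 1)

theorem of_code (h : PolyTime N x fun i => (D i).code (y i)) : PolyTime N x y := by
  simp only [PolyTime, enc_natList] at h
  exact h

theorem code (h : PolyTime N x y) : PolyTime N x fun i => (D i).code (y i) := by
  simp only [PolyTime, enc_natList]
  exact h

theorem fieldCard (hD : PolyTime N x D) : PolyTime N x fun i => (D i).q :=
  hD.fieldChar.natPow hD.fieldDegree hD.polyBdd_fieldDegree

theorem rangeDegree (hD : PolyTime N x D) : PolyTime N x fun i => List.range (D i).k :=
  range hD.fieldDegree hD.polyBdd_fieldDegree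

theorem codeEntry (hD : PolyTime N x D) (hy : PolyTime N x y) {j : ι → ℕ} (hj : PolyTime N x j)
    (hj' : ∀ i, j i < (D i).k) : PolyTime N x fun i => ((D i).code (y i)).getD (j i) 0 :=
  getD hy.code hj (hD.polyBdd_fieldDegree.mono fun i => (hj' i).le) (natConst hy.ctx 0)

theorem fieldZero (hD : PolyTime N x D) : PolyTime N x fun i => (0 : (D i).F) := by
  refine of_code ?_
  simp only [FieldData.code_zero]
  exact map (X := fun _ => ℕ) hD.rangeDegree fun hx _ => natConst hx.self 0

theorem fieldOne (hD : PolyTime N x D) : PolyTime N x fun i => (1 : (D i).F) := by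
  refine of_code ?_
  simp only [FieldData.code_one]
  exact map (X := fun _ => ℕ) hD.rangeDegree fun hx hj =>
    ite (.eq_zero hj) (natConst hx.self 1) (natConst hx.self 0)

theorem natCastMulAdd (hD : PolyTime N x D) (hn : PolyTime N x n) (hy : PolyTime N x y)
    (hz : PolyTime N x z) : PolyTime N x fun i => (n i : (D i).F) * y i + z i := by
  refine of_code ?_
  simp only [FieldData.code_natCast_mul_add]
  refine map (X := fun _ => ℕ) hD.rangeDegree fun hx hj => ?_
  have hlt : ∀ j : MemIdx fun i => List.range (D i).k, j.e < (D j.i).k := fun j =>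
    List.mem_range.1 j.mem
  exact (((hn.weaken hx).mul (codeEntry (hD.weaken hx) (hy.weaken hx) hj hlt)).add
    (codeEntry (hD.weaken hx) (hz.weaken hx) hj hlt)).mod (hD.weaken hx).fieldChar

theorem fieldAdd (hD : PolyTime N x D) (hy : PolyTime N x y) (hz : PolyTime N x z) :
    PolyTime N x fun i => y i + z i :=
  (natCastMulAdd hD (natConst hD.ctx 1) hy hz).congr fun i => by simp

theorem fieldSub (hD : PolyTime N x D) (hy : PolyTime N x y) (hz : PolyTime N x z) :
    PolyTime N x fun i => y i - z i :=
  (natCastMulAdd hD (hD.fieldChar.sub (natConst hD.ctx 1)) hz hy).congr fun i => by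
    rw [Nat.cast_sub (D i).prime.out.one_lt.le, CharP.cast_eq_zero (D i).F (D i).p]
    ring

theorem rootMul (hD : PolyTime N x D) (hy : PolyTime N x y) :
    PolyTime N x fun i => (D i).θ * y i := by
  refine of_code ?_
  simp only [FieldData.code_root_mul]
  refine map (X := fun _ => ℕ) hD.rangeDegree fun {d x'} hx hj => ?_
  have hlt : ∀ j : MemIdx fun i => List.range (D i).k, j.e < (D j.i).k := fun j =>
    List.mem_range.1 j.mem
  have hD' := hD.weaken hx
  have hy' := hy.weaken hx
  have h0 := natConst hx.self 0
  have h1 := natConst hx.self 1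
  refine (add (ite (.eq_zero hj) h0 ?_) (mul (hD'.fieldChar.sub (getD hD'.fieldPoly hj ?_ h0))
    (codeEntry hD' hy' (hD'.fieldDegree.sub h1) ?_))).mod hD'.fieldChar
  · exact codeEntry hD' hy' (hj.sub h1) fun j => (Nat.sub_le _ _).trans_lt (hlt j)
  · exact hD'.polyBdd_fieldDegree.mono fun j => (hlt j).le
  · exact fun j => Nat.sub_lt (D j.i).k_pos one_pos

theorem fieldMul (hD : PolyTime N x D) (hy : PolyTime N x y) (hz : PolyTime N x z) :
    PolyTime N x fun i => y i * z i := by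
  have h := foldl (g := fun i (acc : (D i).F) (n : ℕ) => (n : (D i).F) * z i + (D i).θ * acc)
    (s := fun i => (0 : (D i).F)) hy.code.reverse hD.fieldZero hD.polyBdd_field
    (fun i pre suf _ => FieldData.csize_le _) fun hx he hacc =>
      natCastMulAdd (hD.weaken hx) he (hz.weaken hx) (rootMul (hD.weaken hx) hacc)
  refine h.congr fun i => ?_
  rw [List.foldl_reverse]
  exact FieldData.foldr_code (y i) (z i)

end PolyTime

theorem PolyTimeDec.fieldEq (hy : PolyTime N x y) (hz : PolyTime N x z) :
    PolyTimeDec N x fun i => y i = z i :=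
  (natListEq hy.code hz.code).congr fun _ => FieldData.code_injective.eq_iff

namespace PolyTime

theorem fieldPow (hD : PolyTime N x D) (hy : PolyTime N x y) (hn : PolyTime N x n) :
    PolyTime N x fun i => y i ^ n i := by
  have h := foldl (g := fun i (acc : (D i).F) (b : ℕ) => acc * acc * if b = 0 then 1 else y i)
    (s := fun i => (1 : (D i).F)) hn.bitList.reverse hD.fieldOne hD.polyBdd_field
    (fun i pre suf _ => FieldData.csize_le _) fun hx he hacc =>
      fieldMul (hD.weaken hx) (fieldMul (hD.weaken hx) hacc hacc)
        (ite (.eq_zero he) (hD.weaken hx).fieldOne (hy.weaken hx))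
  refine h.congr fun i => ?_
  rw [List.foldl_reverse]
  exact foldr_bitList (y i) (n i)

theorem fieldInv (hD : PolyTime N x D) (hy : PolyTime N x y) :
    PolyTime N x fun i => (y i)⁻¹ := by
  classical
  -- The inverse is the power with exponent q - 2. Zero needs its own branch because this exponent
  -- is 0 when q = 2.
  have h := ite (.fieldEq hy hD.fieldZero) hD.fieldZero
    (fieldPow hD hy (hD.fieldCard.sub (natConst hD.ctx 2)))
  refine h.congr fun i => ?_
  split_ifs with h0
  · rw [h0, inv_zero]
  · have := Fintype.ofFinite (D i).F
    have h1 := FiniteField.pow_card_sub_one_eq_one (y i) h0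
    rw [← Nat.card_eq_fintype_card, FieldData.card_eq] at h1
    have h2 : 1 < (D i).q := by
      rw [← FieldData.card_eq]; exact Finite.one_lt_card
    refine (inv_eq_of_mul_eq_one_right ?_).symm
    rw [← pow_succ']
    rwa [show (D i).q - 2 + 1 = (D i).q - 1 by omega]

end PolyTime

end

/-! ### Extracting roots relative to a known cyclic subgroup -/

section RootDefs

variable {F : Type*} [Field F]

open Classical in
/-- The next digit of the logarithm of `y⁻¹` with respect to `ζ`, if the logarithm is known to
be `s.1` modulo `s.2`. -/
noncomputable def dlogDigit (ζ y : F) (e : ℕ) (s : ℕ × ℕ) (l : ℕ) : ℕ :=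
  ((List.range l).filter fun t => (y * ζ ^ (s.1 + t * s.2)) ^ (e / (s.2 * l)) = 1).headD 0

/-- The known part of the logarithm of `y⁻¹` and its modulus, after treating the factors `ls`. -/
noncomputable def dlogAux (ζ y : F) (e : ℕ) (ls : List ℕ) : ℕ × ℕ :=
  ls.foldl (fun s l => (s.1 + dlogDigit ζ y e s l * s.2, s.2 * l)) (0, 1)

/-- The logarithm of `y⁻¹` with respect to `ζ`, an element of order `ls.prod`. -/
noncomputable def dlog (ζ y : F) (ls : List ℕ) : ℕ := (dlogAux ζ y ls.prod ls).1

/-- The inverse of `r` modulo `d`. -/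
def invMod (r d : ℕ) : ℕ :=
  ((List.range (d + 1)).filter fun s => 1 ≤ s ∧ r * s % d = 1 % d).headD 1

open Classical in
/-- `(b, γ)` with `x = ζ ^ b * γ ^ d`. -/
noncomputable def decomp (d r : ℕ) (ζ : F) (ls : List ℕ) (x : F) : ℕ × F :=
  (dlog ζ (x ^ r) ls * invMod r d * (d - 1) % d,
    if x = 0 then 0 else
      (ζ ^ ((dlog ζ (x ^ r) ls * invMod r d * (d - 1) % d + dlog ζ (x ^ r) ls * invMod r d) / d) *
        x ^ ((r * invMod r d - 1) / d))⁻¹)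

/-- One step in removing the common factors with `d` from a number. -/
def removeFactor (d n l : ℕ) : ℕ := if 2 ≤ l ∧ l ∣ d ∧ l ∣ n then n / l else n

/-- The candidates for factors to be removed from `n`, with repetitions. -/
def factorList (d n : ℕ) : List ℕ :=
  (List.range (d + 1)).flatMap fun l => (bitList n).map fun _ => l

/-- The largest divisor of `n` prime to `d`. -/
def coprimePart (d n : ℕ) : ℕ := (factorList d n).foldl (removeFactor d) n

open Classical in
/-- Elements of the form `x ^ ((q - 1) / l ^ j)` with a prime divisor `l` of `d`. -/
noncomputable def primePowerParts (q d : ℕ) (x : F) : List (F × ℕ) :=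
  (List.range (d + 1)).flatMap fun l => if l.Prime ∧ l ∣ d then
    ((List.range (Nat.size q)).filter fun j => l ^ j ∣ q - 1).map fun j =>
      (x ^ ((q - 1) / l ^ j), l) else []

open Classical in
/-- An element `w` outside the group of elements of order dividing `e` whose `l`-th power lies
inside, together with the prime `l`. -/
noncomputable def newGenerator (q d e : ℕ) (x : F) : F × ℕ :=
  ((primePowerParts q d x).filter fun w => w.1 ^ e ≠ 1 ∧ (w.1 ^ w.2) ^ e = 1).headD (1, 1)

/-- Enlarge the cyclic group generated by `ζ`, whose order is the product of `ls`. -/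
noncomputable def enlarge (q d : ℕ) (s : F × List ℕ) (x : F) : F × List ℕ :=
  (s.1 * (newGenerator q d s.2.prod x).1, (newGenerator q d s.2.prod x).2 :: s.2)

/-- `s.1` has order the product of the list `s.2` of prime factors of `d`. -/
structure IsGenerator (d : ℕ) (s : F × List ℕ) : Prop where
  order : orderOf s.1 = s.2.prod
  prime : ∀ l ∈ s.2, l.Prime
  dvd : ∀ l ∈ s.2, l ∣ d

end RootDefs

/-! ### Correctness of root extraction and of the enlargement of the cyclic group. -/

section RootSpecs

variable {F : Type*} [Field F]

theorem headD_filter_mem {α : Type*} {P : α → Prop} [DecidablePred P] {l : List α} {a : α}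
    (ha : a ∈ l) (hP : P a) (b : α) :
    (l.filter fun e => P e).headD b ∈ l ∧ P ((l.filter fun e => P e).headD b) := by
  have hne : (l.filter fun e => P e) ≠ [] := by
    have : a ∈ l.filter fun e => P e := List.mem_filter.2 ⟨ha, by simpa using hP⟩
    exact List.ne_nil_of_mem this
  have h : (l.filter fun e => P e).headD b ∈ l.filter fun e => P e := by
    cases h : l.filter fun e => P e with
    | nil => exact absurd h hne
    | cons c t => simp
  simpa using List.mem_filter.1 h

theorem headD_filter_range_le (l : ℕ) (P : ℕ → Prop) [DecidablePred P] :
    ((List.range l).filter fun t => P t).headD 0 ≤ l - 1 := by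
  cases h : (List.range l).filter fun t => P t with
  | nil => simp
  | cons c t =>
    have : c ∈ (List.range l).filter fun t => P t := by rw [h]; simp
    have := List.mem_range.1 (List.mem_filter.1 this).1
    simp only [List.headD_cons]
    omega

theorem dlogAux_snd (ζ y : F) (e : ℕ) (ls : List ℕ) : (dlogAux ζ y e ls).2 = ls.prod := by
  induction ls using List.reverseRecOn with
  | nil => rfl
  | append_singleton ls l ih =>
    rw [dlogAux, List.foldl_append]
    simp only [dlogAux] at ih
    simp [ih]

theorem dlogAux_append (ζ y : F) (e : ℕ) (ls : List ℕ) (l : ℕ) :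
    dlogAux ζ y e (ls ++ [l]) = ((dlogAux ζ y e ls).1 +
      dlogDigit ζ y e (dlogAux ζ y e ls) l * ls.prod, ls.prod * l) := by
  rw [← dlogAux_snd ζ y e ls]
  simp [dlogAux]

/-- Each digit is below its base, so this is the bound for numerals in mixed radix. It controls the
size of the accumulator in `PolyTime.dlogAux`. -/
theorem dlogAux_fst_lt (ζ y : F) (e : ℕ) (ls : List ℕ) (h : ∀ l ∈ ls, 0 < l) :
    (dlogAux ζ y e ls).1 < ls.prod := by
  induction ls using List.reverseRecOn with
  | nil => simp [dlogAux]
  | append_singleton ls l ih =>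
    have ih' := ih fun l' hl' => h l' (by simp [hl'])
    have hl := h l (by simp)
    have h1 : dlogDigit ζ y e (dlogAux ζ y e ls) l ≤ l - 1 := by
      classical
      exact headD_filter_range_le _ _
    rw [dlogAux_append, List.prod_append, List.prod_singleton]
    simp only
    obtain ⟨k, rfl⟩ := Nat.exists_eq_succ_of_ne_zero hl.ne'
    have h2 : dlogDigit ζ y e (dlogAux ζ y e ls) k.succ * ls.prod ≤ k * ls.prod :=
      Nat.mul_le_mul_right _ (by simpa using h1)
    rw [Nat.mul_succ, Nat.mul_comm ls.prod k]
    omega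

/-- The Pohlig–Hellman method. After the factors in `pre`, the element `y * ζ ^ a` is killed by the
product of the remaining factors; when none remain it equals 1. -/
theorem mul_pow_dlog {ζ y : F} {ls : List ℕ} (hζ : orderOf ζ = ls.prod) (hls : ∀ l ∈ ls, 0 < l)
    (hy : y ^ ls.prod = 1) : y * ζ ^ dlog ζ y ls = 1 := by
  have hpos : ∀ l : List ℕ, (∀ k ∈ l, 0 < k) → 0 < l.prod := fun l hl =>
    Nat.pos_of_ne_zero (List.prod_ne_zero fun h0 => absurd (hl 0 h0) (lt_irrefl 0))
  have key : ∀ pre suf : List ℕ, ls = pre ++ suf →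
      (y * ζ ^ (dlogAux ζ y ls.prod pre).1) ^ suf.prod = 1 := by
    intro pre
    induction pre using List.reverseRecOn with
    | nil =>
      rintro suf h
      rw [List.nil_append] at h
      simpa [dlogAux, ← h] using hy
    | append_singleton pre l ih =>
      intro suf h
      have h' : ls = pre ++ (l :: suf) := by simpa using h
      have ih' := ih _ h'
      have hl : 0 < l := hls l (by rw [h']; simp)
      have h1 : 0 < pre.prod := hpos _ fun k hk => hls k (by rw [h']; simp [hk])
      have h2 : 0 < suf.prod := hpos _ fun k hk => hls k (by rw [h']; simp [hk])
      have hE : ls.prod = pre.prod * l * suf.prod := by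
        rw [h']; simp [mul_assoc]
      have hdiv : ls.prod / (pre.prod * l) = suf.prod := by
        rw [hE]; exact Nat.mul_div_cancel_left _ (by positivity)
      set u := y * ζ ^ (dlogAux ζ y ls.prod pre).1 with hu
      -- Adding `t * pre.prod` to the exponent multiplies `u ^ suf.prod` by the `t`th power of this
      -- root of unity. As `u ^ suf.prod` is an `l`th root of unity too, some `t < l` turns it into
      -- 1.
      have hω : IsPrimitiveRoot (ζ ^ (pre.prod * suf.prod)) l := by
        have h3 : IsPrimitiveRoot ζ ls.prod := hζ ▸ IsPrimitiveRoot.orderOf ζ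
        refine h3.pow (by rw [hE]; positivity) (by rw [hE]; ring)
      have hu1 : ((u ^ suf.prod)⁻¹) ^ l = 1 := by
        rw [inv_pow, ← pow_mul, mul_comm, ← List.prod_cons, ih', inv_one]
      have : NeZero l := ⟨hl.ne'⟩
      obtain ⟨t, ht, ht'⟩ := hω.eq_pow_of_pow_eq_one hu1
      have hu0 : u ^ suf.prod ≠ 0 := by
        intro h0
        rw [h0, inv_zero, zero_pow hl.ne'] at hu1
        exact zero_ne_one hu1
      classical
      have hex := headD_filter_mem (P := fun t => (y * ζ ^ ((dlogAux ζ y ls.prod pre).1 +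
        t * (dlogAux ζ y ls.prod pre).2)) ^ (ls.prod / ((dlogAux ζ y ls.prod pre).2 * l)) = 1)
        (List.mem_range.2 ht) (by
          rw [dlogAux_snd, hdiv, pow_add, ← mul_assoc, ← hu, mul_pow, ← pow_mul,
            show t * pre.prod * suf.prod = pre.prod * suf.prod * t by ring, pow_mul, ht',
            mul_inv_cancel₀ hu0]) 0
      have h4 := hex.2
      rw [dlogAux_append]
      simp only [dlogAux_snd, hdiv] at h4
      simp only [dlogDigit, dlogAux_snd, hdiv]
      convert h4
  have := key ls [] (by simp)
  simpa [dlog] using this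

theorem invMod_spec {r d : ℕ} (hd : 0 < d) (h : r.Coprime d) :
    1 ≤ invMod r d ∧ r * invMod r d % d = 1 % d := by
  obtain ⟨s, hs, hs'⟩ : ∃ s ∈ List.range (d + 1), 1 ≤ s ∧ r * s % d = 1 % d := by
    -- The search range includes `d` so that the positive value 1 is available when `d = 1`.
    rcases (Nat.one_le_iff_ne_zero.2 hd.ne').eq_or_lt with rfl | hd1
    · exact ⟨1, by simp, le_rfl, by simp [Nat.mod_one]⟩
    · obtain ⟨s, hsd, hs⟩ := Nat.exists_mul_mod_eq_one_of_coprime h hd1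
      refine ⟨s, List.mem_range.2 (by omega), ?_, by rw [hs, Nat.mod_eq_of_lt hd1]⟩
      rw [Nat.one_le_iff_ne_zero]
      rintro rfl
      simp at hs
  have h1 := headD_filter_mem (P := fun s => 1 ≤ s ∧ r * s % d = 1 % d) hs hs' 1
  exact h1.2

/-- The power x^r lies in the group generated by ζ, say x^r ζ^a = 1. With rs ≡ 1 modulo d one has x
= x^(rs) x^(-(rs-1)) = ζ^(-as) (x^(-(rs-1)/d))^d, and -as is replaced by its residue b modulo d at
the cost of another d-th power. -/
theorem decomp_spec {d r : ℕ} (hd : 0 < d) (hr : 0 < r) (h : r.Coprime d) {ζ : F} {ls : List ℕ}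
    (hs : IsGenerator d (ζ, ls)) {x : F} (hx : x = 0 ∨ x ^ (r * ls.prod) = 1) :
    (x ≠ 0 → (decomp d r ζ ls x).2 ≠ 0) ∧
      x = ζ ^ (decomp d r ζ ls x).1 * (decomp d r ζ ls x).2 ^ d := by
  have hpos : ls.prod ≠ 0 := List.prod_ne_zero fun h0 => Nat.not_prime_zero (hs.prime 0 h0)
  have hζ : ζ ≠ 0 := by
    rintro rfl
    have h1 := pow_orderOf_eq_one (0 : F)
    rw [hs.order, zero_pow hpos] at h1
    exact zero_ne_one h1
  by_cases hx0 : x = 0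
  · refine ⟨fun h1 => absurd hx0 h1, ?_⟩
    simp [decomp, hx0, hd.ne']
  replace hx := hx.resolve_left hx0
  obtain ⟨hs1, hs2⟩ := invMod_spec hd h
  have ha := mul_pow_dlog hs.order (fun l hl => (hs.prime l hl).pos) (y := x ^ r)
    (by rw [← pow_mul]; exact hx)
  simp only [decomp, if_neg hx0]
  set a := dlog ζ (x ^ r) ls
  set s := invMod r d
  set b := a * s * (d - 1) % d with hb
  -- The factor `d - 1` in `b` plays the role of -1 modulo `d`.
  have hA : d ∣ b + a * s := by
    rw [Nat.dvd_iff_mod_eq_zero, hb, Nat.mod_add_mod]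
    have : a * s * (d - 1) + a * s = a * s * d := by
      obtain ⟨k, rfl⟩ := Nat.exists_eq_succ_of_ne_zero hd.ne'
      simp [Nat.mul_succ]
    rw [this, Nat.mul_mod_left]
  have hrs : 1 ≤ r * s := Nat.mul_pos hr hs1
  have hB : d ∣ r * s - 1 := (Nat.modEq_iff_dvd' hrs).1 (Eq.symm hs2)
  refine ⟨fun _ => inv_ne_zero (mul_ne_zero (pow_ne_zero _ hζ) (pow_ne_zero _ hx0)), ?_⟩
  have h2 : (ζ ^ ((b + a * s) / d) * x ^ ((r * s - 1) / d)) ^ d =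
      ζ ^ (b + a * s) * x ^ (r * s - 1) := by
    rw [mul_pow, ← pow_mul, ← pow_mul, Nat.div_mul_cancel hA, Nat.div_mul_cancel hB]
  rw [inv_pow, h2, eq_mul_inv_iff_mul_eq₀
    (mul_ne_zero (pow_ne_zero _ hζ) (pow_ne_zero _ hx0))]
  calc x * (ζ ^ (b + a * s) * x ^ (r * s - 1)) = ζ ^ b * (ζ ^ (a * s) * x ^ (r * s - 1 + 1)) := by
        rw [pow_add, pow_succ]; ring
    _ = ζ ^ b * (x ^ r * ζ ^ a) ^ s := by
        rw [Nat.sub_add_cancel hrs, mul_pow, pow_mul, pow_mul]; ring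
    _ = ζ ^ b := by rw [ha, one_pow, mul_one]

theorem decomp_fst_lt {d r : ℕ} (hd : 0 < d) (ζ : F) (ls : List ℕ) (x : F) :
    (decomp d r ζ ls x).1 < d := Nat.mod_lt _ hd

theorem removeFactor_dvd (d n l : ℕ) : removeFactor d n l ∣ n := by
  unfold removeFactor
  split_ifs with h
  · exact Nat.div_dvd_of_dvd h.2.2
  · exact dvd_rfl

theorem foldl_removeFactor_dvd (d n : ℕ) (ls : List ℕ) : ls.foldl (removeFactor d) n ∣ n := by
  induction ls generalizing n with
  | nil => exact dvd_rfl
  | cons l ls ih => exact (ih _).trans (removeFactor_dvd d n l)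

theorem dvd_foldl_removeFactor {d n t : ℕ} (ls : List ℕ) (ht : t ∣ n) (htd : t.Coprime d) :
    t ∣ ls.foldl (removeFactor d) n := by
  induction ls generalizing n with
  | nil => exact ht
  | cons l ls ih =>
    refine ih ?_
    unfold removeFactor
    split_ifs with h
    · have h1 : t.Coprime l := Nat.Coprime.coprime_dvd_right h.2.1 htd
      refine h1.dvd_of_dvd_mul_right ?_
      rwa [Nat.div_mul_cancel h.2.2]
    · exact ht

/-- Each successful division by `l ≥ 2` at least halves the number, so a number below `2 ^ s` cannot
withstand `s` attempts. -/
theorem not_dvd_foldl_replicate {d l : ℕ} (hl : 2 ≤ l) (hld : l ∣ d) (s : ℕ) :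
    ∀ n, 0 < n → n < 2 ^ s → ¬ l ∣ (List.replicate s l).foldl (removeFactor d) n := by
  induction s with
  | zero => intro n h1 h2; omega
  | succ s ih =>
    intro n h1 h2
    rw [List.replicate_succ, List.foldl_cons]
    by_cases h : l ∣ n
    · have e : removeFactor d n l = n / l := by simp [removeFactor, hl, hld, h]
      rw [e]
      refine ih _ (Nat.div_pos (Nat.le_of_dvd h1 h) (by omega)) ?_
      rw [Nat.div_lt_iff_lt_mul (by omega)]
      rw [pow_succ] at h2
      exact h2.trans_le (Nat.mul_le_mul_left _ hl)
    · exact fun h' => h (h'.trans ((foldl_removeFactor_dvd d _ _).trans (removeFactor_dvd d n l)))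

/-- Only divisors of `d` are divided out, so divisors of `n` prime to `d` survive. Conversely the
candidate list contains each prime divisor of `d` with multiplicity `Nat.size n`, enough to remove
it completely; composite candidates do no harm. -/
theorem coprimePart_spec {d n : ℕ} (hd : 0 < d) (hn : 0 < n) :
    (coprimePart d n).Coprime d ∧ coprimePart d n ∣ n ∧
      ∀ t, t ∣ n → t.Coprime d → t ∣ coprimePart d n := by
  refine ⟨?_, foldl_removeFactor_dvd d n _, fun t h1 h2 => dvd_foldl_removeFactor _ h1 h2⟩
  refine Nat.coprime_of_dvd fun l hl h1 h2 => ?_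
  have hmem : l ∈ List.range (d + 1) :=
    List.mem_range.2 (Nat.lt_succ_of_le (Nat.le_of_dvd hd h2))
  obtain ⟨A, B, hAB⟩ := List.append_of_mem hmem
  have e : (bitList n).map (fun _ => l) = List.replicate (Nat.size n) l := by
    exact List.eq_replicate_iff.2 ⟨by simp [bitList], by simp⟩
  rw [coprimePart, factorList, hAB, List.flatMap_append, List.flatMap_cons, List.foldl_append,
    List.foldl_append, e] at h1
  have h3 := foldl_removeFactor_dvd d n (A.flatMap fun l => (bitList n).map fun _ => l)
  exact not_dvd_foldl_replicate hl.two_le h2 _ _ (Nat.pos_of_dvd_of_pos h3 hn)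
    ((Nat.le_of_dvd hn h3).trans_lt (Nat.lt_size_self n)) (h1.trans (foldl_removeFactor_dvd d _ _))

/-- If for every prime l dividing d the l-primary part of x were killed by e, the order of x^e would
be prime to d and hence divide `coprimePart d (q - 1)`, contrary to assumption. -/
theorem newGenerator_spec {q d e : ℕ} (hd : 0 < d) (hq : 1 < q) {x : F}
    (hx1 : x ^ (q - 1) = 1) (hx : x ^ (coprimePart d (q - 1) * e) ≠ 1) :
    ∃ l j : ℕ, l.Prime ∧ l ∣ d ∧ (newGenerator q d e x).2 = l ∧
      (newGenerator q d e x).1 ^ l ^ j = 1 ∧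
      (newGenerator q d e x).1 ^ e ≠ 1 ∧ ((newGenerator q d e x).1 ^ l) ^ e = 1 := by
  classical
  obtain ⟨hr1, hr2, hr3⟩ := coprimePart_spec hd (n := q - 1) (by omega)
  have h1 : ∃ l : ℕ, l.Prime ∧ l ∣ d ∧ (x ^ ((q - 1) / l ^ (q - 1).factorization l)) ^ e ≠ 1 := by
    by_contra! hcon
    refine hx ?_
    rw [mul_comm, pow_mul]
    refine orderOf_dvd_iff_pow_eq_one.1 (hr3 _ ?_ ?_)
    · refine orderOf_dvd_of_pow_eq_one ?_
      rw [← pow_mul, mul_comm, pow_mul, hx1, one_pow]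
    · refine Nat.coprime_of_dvd fun l hl h2 h3 => ?_
      have h4 : orderOf (x ^ e) ∣ (q - 1) / l ^ (q - 1).factorization l := by
        refine orderOf_dvd_of_pow_eq_one ?_
        rw [← pow_mul, mul_comm, pow_mul]
        exact hcon l hl h3
      exact Nat.not_dvd_ordCompl hl (by omega) (h2.trans h4)
  obtain ⟨l, hl, hld, hlx⟩ := h1
  -- With `j` minimal, the `l`th power of the element is the one for `j - 1` and is killed by `e`.
  -- Moreover `j ≠ 0` because `x ^ (q - 1) = 1`.
  have h2 : ∃ j, (x ^ ((q - 1) / l ^ j)) ^ e ≠ 1 := ⟨_, hlx⟩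
  have hj : (x ^ ((q - 1) / l ^ Nat.find h2)) ^ e ≠ 1 := Nat.find_spec h2
  have hjv : l ^ Nat.find h2 ∣ q - 1 :=
    (pow_dvd_pow l (Nat.find_min' h2 hlx)).trans (Nat.ordProj_dvd _ _)
  have hmin : ∀ k < Nat.find h2, (x ^ ((q - 1) / l ^ k)) ^ e = 1 := fun k hk => by
    simpa using Nat.find_min h2 hk
  generalize Nat.find h2 = j at hj hjv hmin
  cases j with
  | zero => simp [hx1] at hj
  | succ j =>
    have h3 : (x ^ ((q - 1) / l ^ (j + 1))) ^ l = x ^ ((q - 1) / l ^ j) := by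
      obtain ⟨c, hc⟩ := hjv
      have h4 : (q - 1) / l ^ (j + 1) = c := by
        rw [hc, Nat.mul_div_cancel_left _ (pow_pos hl.pos _)]
      have h5 : (q - 1) / l ^ j = c * l := by
        rw [hc, pow_succ, mul_assoc, Nat.mul_div_cancel_left _ (pow_pos hl.pos _), mul_comm]
      rw [h4, h5, pow_mul]
    have hmem : (x ^ ((q - 1) / l ^ (j + 1)), l) ∈ primePowerParts q d x := by
      refine List.mem_flatMap.2 ⟨l, List.mem_range.2 (Nat.lt_succ_of_le (Nat.le_of_dvd hd hld)), ?_⟩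
      rw [if_pos ⟨hl, hld⟩]
      refine List.mem_map.2 ⟨j + 1, List.mem_filter.2 ⟨List.mem_range.2 ?_, by simpa using hjv⟩, rfl⟩
      have h6 : 2 ^ (j + 1) ≤ l ^ (j + 1) := Nat.pow_le_pow_left hl.two_le _
      have h7 := Nat.le_of_dvd (by omega) hjv
      have h8 := Nat.lt_size_self q
      exact (Nat.pow_lt_pow_iff_right (by norm_num)).1 (show 2 ^ (j + 1) < 2 ^ Nat.size q by omega)
    -- The search may return another candidate; every candidate passing the filter has the required
    -- properties, since all of them are of prime power order by construction.
    have h9 := headD_filter_mem (P := fun w : F × ℕ => w.1 ^ e ≠ 1 ∧ (w.1 ^ w.2) ^ e = 1) hmem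
      ⟨hj, by rw [h3]; exact hmin j (Nat.lt_succ_self j)⟩ (1, 1)
    obtain ⟨h10, h11⟩ := h9
    have e1 : newGenerator q d e x = ((primePowerParts q d x).filter fun w =>
      w.1 ^ e ≠ 1 ∧ (w.1 ^ w.2) ^ e = 1).headD (1, 1) := by
      simp only [newGenerator]
    rw [← e1] at h10 h11
    obtain ⟨l', -, hl'⟩ := List.mem_flatMap.1 h10
    split_ifs at hl' with h12
    · obtain ⟨j', hj', hw⟩ := List.mem_map.1 hl'
      have h13 : l' ^ j' ∣ q - 1 := by simpa using (List.mem_filter.1 hj').2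
      rw [← hw] at h11 ⊢
      refine ⟨l', j', h12.1, h12.2, rfl, ?_, h11.1, h11.2⟩
      rw [← pow_mul, Nat.div_mul_cancel h13, hx1]
    · simp at hl'

/-- The product ζw has order l·e by the test on maximal proper divisors le/p. For p = l the factor ζ
disappears and w^e ≠ 1 remains; for p ≠ l the factor w, whose order is a power of l, disappears, and
ζ^(le/p) ≠ 1 because p does not divide l. -/
theorem isGenerator_enlarge {q d : ℕ} (hd : 0 < d) (hq : 1 < q) {s : F × List ℕ}
    (hs : IsGenerator d s) {x : F} (hx1 : x ^ (q - 1) = 1)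
    (hx : x ^ (coprimePart d (q - 1) * s.2.prod) ≠ 1) : IsGenerator d (enlarge q d s x) := by
  obtain ⟨l, j, hl, hld, h1, h2, h3, h4⟩ := newGenerator_spec hd hq hx1 hx
  have hpos : s.2.prod ≠ 0 := List.prod_ne_zero fun h0 => Nat.not_prime_zero (hs.prime 0 h0)
  refine ⟨?_, ?_, ?_⟩
  · simp only [enlarge, List.prod_cons, h1]
    set w := (newGenerator q d s.2.prod x).1
    set e := s.2.prod
    have hζ : s.1 ^ e = 1 := by rw [← orderOf_dvd_iff_pow_eq_one, hs.order]
    refine orderOf_eq_of_pow_and_pow_div_prime (Nat.mul_pos hl.pos (Nat.pos_of_ne_zero hpos)) ?_ ?_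
    · rw [mul_pow, pow_mul w, h4, mul_comm l, pow_mul, hζ, one_pow, one_mul]
    · intro p hp hpe h0
      by_cases hpl : p = l
      · subst hpl
        rw [Nat.mul_div_cancel_left _ hp.pos, mul_pow, hζ, one_mul] at h0
        exact h3 h0
      · have hpe' : p ∣ e := (hp.dvd_mul.1 hpe).resolve_left fun h =>
          hpl ((Nat.prime_dvd_prime_iff_eq hp hl).1 h)
        obtain ⟨e', he'⟩ := hpe'
        have e1 : l * e / p = l * e' := by
          rw [he', ← mul_assoc, mul_comm l p, mul_assoc, Nat.mul_div_cancel_left _ hp.pos]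
        have hw : w ^ (l * e') = 1 := by
          refine orderOf_dvd_iff_pow_eq_one.1 ?_
          have h5 : orderOf w ∣ l ^ j := orderOf_dvd_of_pow_eq_one h2
          have h6 : orderOf w ∣ p * (l * e') := by
            refine orderOf_dvd_of_pow_eq_one ?_
            rw [← mul_assoc, mul_comm p l, mul_assoc, ← he', pow_mul, h4]
          refine Nat.Coprime.dvd_of_dvd_mul_left ?_ h6
          refine Nat.Coprime.coprime_dvd_left h5 (Nat.Coprime.pow_left _ ?_)
          exact (Nat.coprime_primes hl hp).2 (Ne.symm hpl)
        rw [e1, mul_pow, hw, mul_one, ← orderOf_dvd_iff_pow_eq_one, hs.order] at h0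
        change e ∣ _ at h0
        rw [he'] at h0
        have he0 : 0 < e' := Nat.pos_of_ne_zero fun h => hpos (by rw [he', h, mul_zero])
        exact hpl ((Nat.prime_dvd_prime_iff_eq hp hl).1 (Nat.dvd_of_mul_dvd_mul_right he0 h0))
  · intro l' hl'
    simp only [enlarge, List.mem_cons] at hl'
    rcases hl' with rfl | hl'
    · rwa [h1]
    · exact hs.prime _ hl'
  · intro l' hl'
    simp only [enlarge, List.mem_cons] at hl'
    rcases hl' with rfl | hl'
    · rwa [h1]
    · exact hs.dvd _ hl'

end RootSpecs

/-! ### Linear relations -/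

section Relation

variable {F : Type*} [Field F]

open Classical in
/-- Eliminate the `c`th coordinate from the vectors in `rows` (of length `n`); the numbers
identify the vectors. -/
noncomputable def elimStep (n : ℕ) (rows : List (ℕ × List F)) (c : ℕ) : List (ℕ × List F) :=
  if (rows.filter fun r => r.2.getD c 0 ≠ 0) = [] then rows else
    (rows.filter fun r =>
      r.1 ≠ ((rows.filter fun r => r.2.getD c 0 ≠ 0).headD (0, [])).1).map fun r =>
        (r.1, (List.range n).map fun k => r.2.getD k 0 -
          r.2.getD c 0 * (((rows.filter fun r => r.2.getD c 0 ≠ 0).headD (0, [])).2.getD c 0)⁻¹ *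
            ((rows.filter fun r => r.2.getD c 0 ≠ 0).headD (0, [])).2.getD k 0)

/-- The vectors in `R`, cut to length `w`, followed by the unit vectors. -/
def augment (R : List (List F)) (w : ℕ) : List (ℕ × List F) :=
  (List.range R.length).map fun j => (j, (List.range (w + R.length)).map fun k =>
    if k < w then (R.getD j []).getD k 0 else if k - w = j then 1 else 0)

/-- The coefficients of a linear relation between the vectors in `R` of length `w`. -/
noncomputable def relation (R : List (List F)) (w : ℕ) : List F :=
  (List.range R.length).map fun j =>
    (((List.range w).foldl (elimStep (w + R.length)) (augment R w)).headD (0, [])).2.getD (w + j) 0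

/-- The state of the elimination after `k` steps. -/
structure ElimInv (R : List (List F)) (w k : ℕ) (rows : List (ℕ × List F)) : Prop where
  length : R.length ≤ rows.length + k
  nodup : (rows.map Prod.fst).Nodup
  lt : ∀ r ∈ rows, r.1 < R.length
  comb : ∀ r ∈ rows, ∀ c < w, r.2.getD c 0 =
    ∑ j ∈ Finset.range R.length, r.2.getD (w + j) 0 * (R.getD j []).getD c 0
  zero : ∀ r ∈ rows, ∀ c < k, r.2.getD c 0 = 0
  unit : ∀ r ∈ rows, ∀ r' ∈ rows, r.2.getD (w + r'.1) 0 = if r'.1 = r.1 then 1 else 0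

theorem getD_map_range {α : Type*} (f : ℕ → α) {n k : ℕ} (h : k < n) (a : α) :
    ((List.range n).map f).getD k a = f k := by
  rw [List.getD_eq_getElem _ _ (by simpa using h)]
  simp

theorem elimInv_augment (R : List (List F)) (w : ℕ) : ElimInv R w 0 (augment R w) where
  length := by simp [augment]
  nodup := by
    have : (augment R w).map Prod.fst = List.range R.length := by
      simp [augment, Function.comp_def]
    rw [this]
    exact List.nodup_range
  lt r hr := by
    obtain ⟨j, hj, rfl⟩ := List.mem_map.1 hr
    exact List.mem_range.1 hj
  comb r hr c hc := by
    obtain ⟨j, hj, rfl⟩ := List.mem_map.1 hr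
    have hj' := List.mem_range.1 hj
    simp only
    rw [getD_map_range _ (by omega), if_pos hc, Finset.sum_eq_single j]
    · rw [getD_map_range _ (by omega)]
      simp
    · intro i hi hij
      rw [getD_map_range _ (by have := Finset.mem_range.1 hi; omega)]
      simp [hij]
    · intro h
      exact absurd (Finset.mem_range.2 hj') h
  zero r _ c hc := by omega
  unit r hr r' hr' := by
    obtain ⟨j, hj, rfl⟩ := List.mem_map.1 hr
    obtain ⟨j', hj', rfl⟩ := List.mem_map.1 hr'
    have := List.mem_range.1 hj'
    simp only
    rw [getD_map_range _ (by omega)]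
    simp

/-- The pivot row has entry 0 at the position of every other surviving row, so subtracting it leaves
the entry 1 of a row at its own number and the entries 0 at the others untouched. This is what keeps
the final relation nontrivial. -/
theorem elimInv_elimStep {R : List (List F)} {w k : ℕ} {rows : List (ℕ × List F)}
    (h : ElimInv R w k rows) (hk : k < w) :
    ElimInv R w (k + 1) (elimStep (w + R.length) rows k) := by
  classical
  unfold elimStep
  split_ifs with hnil
  · refine ⟨by have := h.length; omega, h.nodup, h.lt, h.comb, fun r hr c hc => ?_, h.unit⟩
    rcases Nat.lt_succ_iff_lt_or_eq.1 hc with hc | rfl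
    · exact h.zero r hr c hc
    · have := List.filter_eq_nil_iff.1 hnil r hr
      simpa using this
  · obtain ⟨p0, hp0⟩ := List.exists_mem_of_ne_nil _ hnil
    obtain ⟨hp1, hp2⟩ := List.mem_filter.1 hp0
    have hp := headD_filter_mem (P := fun r : ℕ × List F => r.2.getD k 0 ≠ 0) hp1
      (by simpa using hp2) (0, [])
    generalize hpe : (rows.filter fun r => r.2.getD k 0 ≠ 0).headD (0, []) = p at hp ⊢
    obtain ⟨hpm, hpk⟩ := hp
    have hget : ∀ (r : ℕ × List F) (c : ℕ), c < w + R.length →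
        ((List.range (w + R.length)).map fun k' => r.2.getD k' 0 -
          r.2.getD k 0 * (p.2.getD k 0)⁻¹ * p.2.getD k' 0).getD c 0 =
        r.2.getD c 0 - r.2.getD k 0 * (p.2.getD k 0)⁻¹ * p.2.getD c 0 :=
      fun r c hc => getD_map_range _ hc 0
    refine ⟨?_, ?_, ?_, ?_, ?_, ?_⟩
    -- The numbers are distinct, so discarding the pivot by its number costs one row only.
    · have h1 : (rows.filter fun r => r.1 = p.1).length ≤ 1 := by
        have h2 : ((rows.filter fun r => r.1 = p.1).map Prod.fst).Nodup :=
          h.nodup.sublist (List.Sublist.map _ List.filter_sublist)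
        have h3 : (rows.filter fun r => r.1 = p.1).map Prod.fst =
            List.replicate (rows.filter fun r => r.1 = p.1).length p.1 :=
          List.eq_replicate_iff.2 ⟨by simp, by
            intro b hb
            obtain ⟨r, hr, rfl⟩ := List.mem_map.1 hb
            simpa using (List.mem_filter.1 hr).2⟩
        rw [h3] at h2
        exact List.nodup_replicate.1 h2
      have h4 := List.length_eq_length_filter_add (l := rows) fun r => decide (r.1 = p.1)
      have h5 := h.length
      rw [List.length_map]
      simp only [← decide_not] at h4
      simp only [ne_eq]
      omega
    · rw [List.map_map]
      exact h.nodup.sublist (List.Sublist.map _ List.filter_sublist)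
    · intro r hr
      obtain ⟨r0, hr0, rfl⟩ := List.mem_map.1 hr
      exact h.lt r0 (List.mem_filter.1 hr0).1
    · intro r hr c hc
      obtain ⟨r0, hr0, rfl⟩ := List.mem_map.1 hr
      have h1 := h.comb r0 (List.mem_filter.1 hr0).1 c hc
      have h2 := h.comb p hpm c hc
      simp only
      rw [hget _ _ (by omega), h1, h2, Finset.mul_sum, ← Finset.sum_sub_distrib]
      refine Finset.sum_congr rfl fun j hj => ?_
      rw [hget _ _ (by have := Finset.mem_range.1 hj; omega)]
      ring
    · intro r hr c hc
      obtain ⟨r0, hr0, rfl⟩ := List.mem_map.1 hr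
      simp only
      rw [hget _ _ (by omega)]
      rcases Nat.lt_succ_iff_lt_or_eq.1 hc with hc | rfl
      · rw [h.zero r0 (List.mem_filter.1 hr0).1 c hc, h.zero p hpm c hc, mul_zero, sub_zero]
      · rw [mul_assoc, inv_mul_cancel₀ hpk, mul_one, sub_self]
    · intro r hr r' hr'
      obtain ⟨r0, hr0, rfl⟩ := List.mem_map.1 hr
      obtain ⟨r0', hr0', rfl⟩ := List.mem_map.1 hr'
      obtain ⟨h1, -⟩ := List.mem_filter.1 hr0
      obtain ⟨h1', h2'⟩ := List.mem_filter.1 hr0'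
      have h3' : r0'.1 ≠ p.1 := by simpa using h2'
      simp only
      rw [hget _ _ (by have := h.lt r0' h1'; omega), h.unit r0 h1 r0' h1', h.unit p hpm r0' h1',
        if_neg h3', mul_zero, sub_zero]

theorem length_relation (R : List (List F)) (w : ℕ) : (relation R w).length = R.length := by
  simp [relation]

/-- At most one row is lost per coordinate, so a row remains after `w` steps. Its first `w` entries
vanish, and its augmented part records the combination producing it, with coefficient 1 at its own
number. -/
theorem relation_spec {R : List (List F)} {w : ℕ} (hw : w < R.length) :
    (∃ j < R.length, (relation R w).getD j 0 ≠ 0) ∧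
      ∀ c < w, ∑ j ∈ Finset.range R.length, (relation R w).getD j 0 * (R.getD j []).getD c 0 = 0 := by
  have key : ∀ k ≤ w, ElimInv R w k ((List.range k).foldl (elimStep (w + R.length)) (augment R w)) := by
    intro k
    induction k with
    | zero => intro _; exact elimInv_augment R w
    | succ k ih =>
      intro hk
      rw [List.range_succ, List.foldl_append]
      exact elimInv_elimStep (ih (by omega)) hk
  have h := key w le_rfl
  have hget : ∀ j < R.length, (relation R w).getD j 0 =
      (((List.range w).foldl (elimStep (w + R.length)) (augment R w)).headD (0, [])).2.getD (w + j) 0 :=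
    fun j hj => getD_map_range _ hj 0
  generalize (List.range w).foldl (elimStep (w + R.length)) (augment R w) = rows at h hget
  cases rows with
  | nil => have := h.length; simp at this; omega
  | cons r rows =>
    simp only [List.headD_cons] at hget
    have hr : r ∈ r :: rows := by simp
    refine ⟨⟨r.1, h.lt r hr, ?_⟩, fun c hc => ?_⟩
    · rw [hget _ (h.lt r hr), h.unit r hr r hr, if_pos rfl]
      exact one_ne_zero
    · refine Eq.trans (Finset.sum_congr rfl fun j hj => ?_)
        ((h.comb r hr c hc).symm.trans (h.zero r hr c hc))
      rw [hget j (Finset.mem_range.1 hj)]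

end Relation

/-! ### An alternating sum -/

section Alternating

open Matrix

variable {F : Type*} [Field F] {d : ℕ}

/-- The matrix whose rows are the unit vectors given by `l`. -/
def unitMatrix (F : Type*) [Field F] {d : ℕ} (l : Fin d → Fin d) : Matrix (Fin d) (Fin d) F :=
  Matrix.of fun i j => if l i = j then 1 else 0

/-- An array of vectors all of whose contractions with the vector `z` vanish has vanishing
alternating sum. -/
theorem sum_det_smul_eq_zero {z : Fin d → F} (i₀ : Fin d) (hz : z i₀ ≠ 0)
    {x : (Fin d → Fin d) → F}
    (h : ∀ (i : Fin d) (g : (Fin d → Fin d) → F), (∀ l b, g (Function.update l i b) = g l) →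
      ∑ l, z (l i) * g l * x l = 0) :
    ∑ l, (unitMatrix F l).det * x l = 0 := by
  -- Cramer's rule: with M the unit matrix of `l`, compare the `i₀`th entries of adj(M) M z = det(M)
  -- z, where M z has the entries `z (l i)`.
  have h1 : ∀ l : Fin d → Fin d, (unitMatrix F l).det * z i₀ =
      ∑ i, ((unitMatrix F l).updateRow i (Pi.single i₀ 1)).det * z (l i) := by
    intro l
    have h2 : ((unitMatrix F l).adjugate * unitMatrix F l).mulVec z i₀ =
        (unitMatrix F l).det * z i₀ := by
      rw [adjugate_mul, smul_mulVec, one_mulVec, Pi.smul_apply, smul_eq_mul]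
    have h3 : (unitMatrix F l).mulVec z = fun i => z (l i) := by
      funext i
      simp [unitMatrix, mulVec, dotProduct]
    rw [← h2, ← mulVec_mulVec, h3]
    simp only [mulVec, dotProduct, adjugate_apply]
  have h4 : z i₀ * ∑ l, (unitMatrix F l).det * x l = 0 := by
    calc z i₀ * ∑ l, (unitMatrix F l).det * x l =
        ∑ l, ∑ i, z (l i) * ((unitMatrix F l).updateRow i (Pi.single i₀ 1)).det * x l := by
          rw [Finset.mul_sum]
          refine Finset.sum_congr rfl fun l _ => ?_
          rw [← mul_assoc, mul_comm (z i₀), h1, Finset.sum_mul]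
          exact Finset.sum_congr rfl fun i _ => by ring
      _ = ∑ i, ∑ l, z (l i) * ((unitMatrix F l).updateRow i (Pi.single i₀ 1)).det * x l :=
          Finset.sum_comm
      _ = 0 := Finset.sum_eq_zero fun i _ => by
          -- The replaced row is the only one depending on `l i`, so this determinant is an
          -- admissible weight for the contraction in slot `i`.
          refine h i (fun l => ((unitMatrix F l).updateRow i (Pi.single i₀ 1)).det) fun l b => ?_
          congr 1
          ext i' j
          by_cases hi : i' = i
          · subst hi; simp
          · simp [updateRow_ne hi, unitMatrix, Function.update_of_ne hi]
  exact (mul_eq_zero.1 h4).resolve_left hz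

end Alternating

/-! ### Combining representations -/

/-- A vector with a label and a coefficient. -/
abbrev Term (F : Type*) := List F × List ℕ × F

section CoreDefs

variable {F : Type*} [Field F]

open Classical in
/-- The `c`th coordinate of the sum of the vectors with label `l`. -/
noncomputable def coord (d : ℕ) (T : List (Term F)) (l : List ℕ) (c : ℕ) : F :=
  (T.map fun t => if t.2.1 = l then t.2.2 ^ d * t.1.getD c 0 else 0).sum

/-- Pairs of labels and coordinates. -/
def keys (labs : List (List ℕ)) (m : ℕ) : List (List ℕ × ℕ) :=
  labs.flatMap fun l => (List.range m).map fun c => (l, c)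

/-- The sums of the vectors with each label, concatenated. -/
noncomputable def tensor (d : ℕ) (labs : List (List ℕ)) (m : ℕ) (T : List (Term F)) : List F :=
  (keys labs m).map fun k => coord d T k.1 k.2

/-- A relation between concatenated sums. -/
noncomputable def chunkRelation (d : ℕ) (labs : List (List ℕ)) (m : ℕ)
    (chunk : List (List (Term F))) : List F :=
  relation (chunk.map (tensor d labs m)) (keys labs m).length

open Classical in
/-- The amount by which exponents are shifted in order to make the first one equal to `k`. -/
noncomputable def shift (d k : ℕ) (dec : List (ℕ × F)) : ℕ :=
  d - ((dec.filter fun z => z.2 ≠ 0).headD (0, 0)).1 + k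

/-- Join lists of terms, extending the labels and scaling the coefficients. -/
def joinTerms (d sh : ℕ) (ζ : F) (dec : List (ℕ × F)) (chunk : List (List (Term F))) :
    List (Term F) :=
  (List.range chunk.length).flatMap fun j => (chunk.getD j []).map fun t =>
    (t.1, t.2.1 ++ [((dec.getD j (0, 0)).1 + sh) % d],
      t.2.2 * (ζ ^ (((dec.getD j (0, 0)).1 + sh) / d) * (dec.getD j (0, 0)).2))

/-- Join lists of terms according to a linear relation between them. -/
noncomputable def combine (d r m : ℕ) (s : F × List ℕ) (labs : List (List ℕ)) (k : ℕ)
    (chunk : List (List (Term F))) : List (Term F) :=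
  joinTerms d (shift d k ((chunkRelation d labs m chunk).map (decomp d r s.1 s.2))) s.1
    ((chunkRelation d labs m chunk).map (decomp d r s.1 s.2)) chunk

/-- Cut a list into pieces of length `n`. -/
def chunks {α : Type*} (n : ℕ) (l : List α) : List (List α) :=
  (List.range (l.length / n)).map fun c => (l.drop (c * n)).take n

/-- All labels obtained by adding one entry. -/
def extendLabels (d : ℕ) (labs : List (List ℕ)) : List (List ℕ) :=
  labs.flatMap fun l => (List.range d).map fun b => l ++ [b]

/-- The labels, the lists of terms and the coefficients met so far. -/
abbrev CoreState (F : Type*) := List (List ℕ) × List (List (Term F)) × List F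

/-- Pass to labels with one entry more. -/
noncomputable def coreStep (d r m : ℕ) (s : F × List ℕ) (st : CoreState F) (k : ℕ) :
    CoreState F :=
  (extendLabels d st.1,
    (chunks (st.1.length * (m + 1)) st.2.1).map (combine d r m s st.1 k),
    st.2.2 ++ (chunks (st.1.length * (m + 1)) st.2.1).flatMap (chunkRelation d st.1 m))

/-- Start with unlabelled vectors. -/
def coreInit (V : List (List F)) : CoreState F := ([[]], V.map fun v => [(v, [], 1)], [])

/-- The result of the first `k` rounds. -/
noncomputable def core (d r m : ℕ) (s : F × List ℕ) (V : List (List F)) (k : ℕ) : CoreState F :=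
  (List.range k).foldl (coreStep d r m s) (coreInit V)

/-- The number of lists of terms after `k` rounds. -/
def numObjects (d m k : ℕ) : ℕ := ∏ i ∈ Finset.Ico k d, d ^ i * (m + 1)

end CoreDefs

/-! ### Labels, lengths and order of the vectors during the rounds. -/

section CoreSpecs

variable {F : Type*} [Field F]

/-- This is the origin of G: round `k` merges `d ^ k * (m + 1)` lists into one, and the exponents of
`d` add up to 0 + 1 + ⋯ + (d - 1). -/
theorem numObjects_zero (d m : ℕ) : numObjects d m 0 = numVectors d m := by
  rw [numObjects, numVectors, Finset.prod_mul_distrib, Finset.prod_const, Nat.card_Ico,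
    Nat.sub_zero, Finset.prod_pow_eq_pow_sum, ← Finset.range_eq_Ico, Finset.sum_range_id]

theorem numObjects_succ {d k : ℕ} (m : ℕ) (hk : k < d) :
    numObjects d m k = d ^ k * (m + 1) * numObjects d m (k + 1) :=
  Finset.prod_eq_prod_Ico_succ_bot hk _

theorem length_chunks {α : Type*} (n : ℕ) (l : List α) : (chunks n l).length = l.length / n := by
  simp [chunks]

theorem flatten_chunks {α : Type*} {n M : ℕ} {l : List α} (hn : 0 < n) (hl : l.length = n * M) :
    (chunks n l).flatten = l := by
  have key : ∀ M, ((List.range M).map fun c => (l.drop (c * n)).take n).flatten =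
      l.take (M * n) := by
    intro M
    induction M with
    | zero => simp
    | succ M ih =>
      rw [List.range_succ, List.map_append, List.flatten_append, ih, Nat.succ_mul, List.take_add]
      simp
  rw [chunks, hl, Nat.mul_div_cancel_left _ hn, key, List.take_of_length_le]
  rw [hl, mul_comm]

theorem length_of_mem_chunks {α : Type*} {n M : ℕ} {l c : List α} (hn : 0 < n)
    (hl : l.length = n * M) (hc : c ∈ chunks n l) : c.length = n := by
  obtain ⟨j, hj, rfl⟩ := List.mem_map.1 hc
  rw [hl, Nat.mul_div_cancel_left _ hn, List.mem_range] at hj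
  rw [List.length_take, List.length_drop, hl]
  have h1 : (j + 1) * n ≤ M * n := Nat.mul_le_mul_right _ hj
  rw [Nat.succ_mul] at h1
  rw [mul_comm n M]
  omega

/-- Joining changes labels and coefficients only. The vectors keep their order and each occurs once,
so a position in the final list is the index of an input vector. -/
theorem map_fst_joinTerms (d sh : ℕ) (ζ : F) (dec : List (ℕ × F)) (chunk : List (List (Term F))) :
    (joinTerms d sh ζ dec chunk).map Prod.fst = chunk.flatten.map Prod.fst := by
  have e : chunk = (List.range chunk.length).map fun j => chunk.getD j [] := by
    refine List.ext_getElem (by simp) fun j h1 h2 => ?_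
    simp [h1]
  conv_rhs => rw [e]
  rw [joinTerms, List.map_flatMap, List.map_flatten, List.map_map, List.flatMap]
  congr 1
  refine List.map_congr_left fun j _ => ?_
  simp [Function.comp_def]

/-- The labels of length `k`. -/
structure IsLabels (d k : ℕ) (labs : List (List ℕ)) : Prop where
  length : labs.length = d ^ k
  mem : ∀ l ∈ labs, l.length = k ∧ ∀ b ∈ l, b < d
  complete : ∀ l : List ℕ, l.length = k → (∀ b ∈ l, b < d) → l ∈ labs

theorem isLabels_extendLabels {d k : ℕ} {labs : List (List ℕ)} (h : IsLabels d k labs) :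
    IsLabels d (k + 1) (extendLabels d labs) where
  length := by
    simp [extendLabels, List.length_flatMap, h.length, pow_succ, List.map_const']
  mem l hl := by
    obtain ⟨l', hl', hl⟩ := List.mem_flatMap.1 hl
    obtain ⟨b, hb, rfl⟩ := List.mem_map.1 hl
    refine ⟨by simp [(h.mem l' hl').1], fun b' hb' => ?_⟩
    rcases List.mem_append.1 hb' with h1 | h1
    · exact (h.mem l' hl').2 b' h1
    · rw [List.mem_singleton.1 h1]
      exact List.mem_range.1 hb
  complete l hl hlt := by
    have hne : l ≠ [] := by rintro rfl; simp at hl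
    refine List.mem_flatMap.2 ⟨l.dropLast, h.complete _ (by simp [hl])
      (fun b hb => hlt b (List.mem_of_mem_dropLast hb)), List.mem_map.2
      ⟨l.getLast hne, List.mem_range.2 (hlt _ (List.getLast_mem hne)),
        List.dropLast_append_getLast hne⟩⟩

/-- The part of the invariant of the rounds not depending on the extraction of roots. -/
structure CoreShape (d m k : ℕ) (V : List (List F)) (st : CoreState F) : Prop where
  labels : IsLabels d k st.1
  length : st.2.1.length = numObjects d m k
  vectors : st.2.1.flatten.map Prod.fst = V
  label_mem : ∀ T ∈ st.2.1, ∀ t ∈ T, t.2.1 ∈ st.1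

theorem mem_joinTerms {d sh : ℕ} {ζ : F} {dec : List (ℕ × F)} {chunk : List (List (Term F))}
    {t : Term F} (ht : t ∈ joinTerms d sh ζ dec chunk) : ∃ T ∈ chunk, ∃ t' ∈ T, ∃ j,
      t = (t'.1, t'.2.1 ++ [((dec.getD j (0, 0)).1 + sh) % d],
        t'.2.2 * (ζ ^ (((dec.getD j (0, 0)).1 + sh) / d) * (dec.getD j (0, 0)).2)) := by
  obtain ⟨j, hj, ht⟩ := List.mem_flatMap.1 ht
  obtain ⟨t', ht', rfl⟩ := List.mem_map.1 ht
  refine ⟨chunk.getD j [], ?_, t', ht', j, rfl⟩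
  rw [List.getD_eq_getElem _ _ (List.mem_range.1 hj)]
  exact List.getElem_mem _

omit [Field F] in
theorem CoreShape.chunk_pos {d m k : ℕ} {V : List (List F)} {st : CoreState F} (hd : 0 < d)
    (h : CoreShape d m k V st) : 0 < st.1.length * (m + 1) := by
  rw [h.labels.length]; positivity

omit [Field F] in
theorem CoreShape.length_eq {d m k : ℕ} {V : List (List F)} {st : CoreState F} (hk : k < d)
    (h : CoreShape d m k V st) :
    st.2.1.length = st.1.length * (m + 1) * numObjects d m (k + 1) := by
  rw [h.length, numObjects_succ m hk, h.labels.length]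

theorem coreShape_coreStep {d m k : ℕ} {V : List (List F)} {st : CoreState F} (r : ℕ)
    (s : F × List ℕ) (hk : k < d) (h : CoreShape d m k V st) :
    CoreShape d m (k + 1) V (coreStep d r m s st k) := by
  have hd : 0 < d := by omega
  have hpos := h.chunk_pos hd
  have hlen := h.length_eq hk
  refine ⟨isLabels_extendLabels h.labels, ?_, ?_, ?_⟩
  · simp only [coreStep, List.length_map, length_chunks]
    rw [hlen, Nat.mul_div_cancel_left _ hpos]
  · rw [← h.vectors, ← flatten_chunks hpos hlen]
    simp only [coreStep]
    rw [List.map_flatten, List.map_map, List.map_flatten, List.map_flatten, List.flatten_flatten]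
    rw [List.map_map]
    congr 1
    refine List.map_congr_left fun c _ => ?_
    rw [Function.comp_apply, Function.comp_apply, combine, map_fst_joinTerms, List.map_flatten]
  · intro T hT t ht
    obtain ⟨c, hc, rfl⟩ := List.mem_map.1 hT
    obtain ⟨T', hT', t', ht', j, rfl⟩ := mem_joinTerms ht
    refine List.mem_flatMap.2 ⟨t'.2.1, h.label_mem T' ?_ t' ht', List.mem_map.2
      ⟨_, List.mem_range.2 (Nat.mod_lt _ hd), rfl⟩⟩
    rw [← flatten_chunks hpos hlen]
    exact List.mem_flatten.2 ⟨c, hc, hT'⟩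

theorem coreShape_coreInit {d m : ℕ} {V : List (List F)} (hV : V.length = numVectors d m) :
    CoreShape d m 0 V (coreInit V) where
  labels := ⟨by simp [coreInit], by simp [coreInit], by simp [coreInit]⟩
  length := by simp [coreInit, hV, numObjects_zero]
  vectors := by
    clear hV
    simp only [coreInit]
    induction V <;> simp_all
  label_mem T hT t ht := by
    obtain ⟨v, -, rfl⟩ := List.mem_map.1 hT
    rw [List.mem_singleton.1 ht]
    simp [coreInit]

theorem core_succ (d r m : ℕ) (s : F × List ℕ) (V : List (List F)) (k : ℕ) :
    core d r m s V (k + 1) = coreStep d r m s (core d r m s V k) k := by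
  simp [core, List.range_succ]

theorem coreShape_core {d m : ℕ} {V : List (List F)} (hV : V.length = numVectors d m) (r : ℕ)
    (s : F × List ℕ) {k : ℕ} (hk : k ≤ d) : CoreShape d m k V (core d r m s V k) := by
  induction k with
  | zero => exact coreShape_coreInit hV
  | succ k ih =>
    rw [core_succ]
    exact coreShape_coreStep r s hk (ih (by omega))

end CoreSpecs

/-! ### Vanishing contractions and their preservation by a round. -/

section Weighted

variable {F : Type*} [Field F]

/-- The `c`th coordinate of the sum of the vectors, weighted by a function of the labels. -/
def weighted (d : ℕ) (T : List (Term F)) (h : List ℕ → F) (c : ℕ) : F :=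
  (T.map fun t => h t.2.1 * (t.2.2 ^ d * t.1.getD c 0)).sum

theorem weighted_congr {d : ℕ} {T : List (Term F)} {h h' : List ℕ → F} {c : ℕ}
    (e : ∀ t ∈ T, h t.2.1 = h' t.2.1) : weighted d T h c = weighted d T h' c := by
  unfold weighted
  congr 1
  exact List.map_congr_left fun t ht => by rw [e t ht]

theorem weighted_const_mul (d : ℕ) (T : List (Term F)) (a : F) (h : List ℕ → F) (c : ℕ) :
    weighted d T (fun l => a * h l) c = a * weighted d T h c := by
  unfold weighted
  rw [← List.sum_map_mul_left]
  simp only [mul_assoc]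

/-- Grouping terms by label turns a weighted sum over a list into a linear form in the tensor
entries. -/
theorem weighted_eq_sum_coord {d : ℕ} {T : List (Term F)} {S : Finset (List ℕ)}
    (hS : ∀ t ∈ T, t.2.1 ∈ S) (h : List ℕ → F) (c : ℕ) :
    weighted d T h c = ∑ l ∈ S, h l * coord d T l c := by
  classical
  unfold weighted coord
  induction T with
  | nil => simp
  | cons t T ih =>
    have h1 := hS t (by simp)
    rw [List.map_cons, List.sum_cons, ih fun t' ht' => hS t' (by simp [ht'])]
    simp only [List.map_cons, List.sum_cons, mul_add, Finset.sum_add_distrib]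
    congr 1
    rw [Finset.sum_eq_single t.2.1]
    · simp
    · intro l _ hl
      rw [if_neg (Ne.symm hl), mul_zero]
    · exact fun h2 => absurd h1 h2

theorem weighted_joinTerms (d sh : ℕ) (ζ : F) (dec : List (ℕ × F)) (chunk : List (List (Term F)))
    (h : List ℕ → F) (c : ℕ) : weighted d (joinTerms d sh ζ dec chunk) h c =
      ∑ j ∈ Finset.range chunk.length,
        (ζ ^ (((dec.getD j (0, 0)).1 + sh) / d) * (dec.getD j (0, 0)).2) ^ d *
        weighted d (chunk.getD j []) (fun l => h (l ++ [((dec.getD j (0, 0)).1 + sh) % d])) c := by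
  have aux : ∀ n, ∀ f : ℕ → List (Term F), weighted d ((List.range n).flatMap f) h c =
      ∑ j ∈ Finset.range n, weighted d (f j) h c := by
    intro n f
    induction n with
    | zero => simp [weighted]
    | succ n ih =>
      rw [List.range_succ, List.flatMap_append, Finset.sum_range_succ, ← ih]
      simp [weighted]
  rw [joinTerms, aux]
  refine Finset.sum_congr rfl fun j _ => ?_
  unfold weighted
  rw [← List.sum_map_mul_left, List.map_map]
  congr 1
  refine List.map_congr_left fun t _ => ?_
  simp only [Function.comp_apply, mul_pow]
  ring

/-- All contractions with the powers of `ζ` vanish, and some term has label `0, …, k - 1`. -/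
structure ObjInv (d m k : ℕ) (ζ : F) (T : List (Term F)) : Prop where
  contract : ∀ i < k, ∀ c < m, ∀ h : List ℕ → F, (∀ l b, h (l.set i b) = h l) →
    weighted d T (fun l => ζ ^ l.getD i 0 * h l) c = 0
  exists_range : ∃ t ∈ T, t.2.1 = List.range k ∧ t.2.2 ≠ 0

/-- The coefficient `x` can be decomposed. -/
def Decomposable (r : ℕ) (s : F × List ℕ) (x : F) : Prop := x = 0 ∨ x ^ (r * s.2.prod) = 1

theorem length_keys (labs : List (List ℕ)) (m : ℕ) : (keys labs m).length = labs.length * m := by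
  simp [keys, List.length_flatMap, List.map_const']

/-- Contractions in the old slots are combinations of old contractions. In the new slot the power of
ζ from the label and the d-th power of the new factor multiply to the coefficient of the relation,
up to a common power of ζ, so the contraction is the relation itself. -/
theorem objInv_combine {d r m k : ℕ} {s : F × List ℕ} {labs : List (List ℕ)}
    {chunk : List (List (Term F))} (hd : 0 < d) (hr : 0 < r) (hrd : r.Coprime d)
    (hs : IsGenerator d s) (hk : k < d) (hlabs : IsLabels d k labs)
    (hlen : chunk.length = labs.length * (m + 1))
    (hlab : ∀ T ∈ chunk, ∀ t ∈ T, t.2.1 ∈ labs) (hinv : ∀ T ∈ chunk, ObjInv d m k s.1 T)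
    (hgood : ∀ x ∈ chunkRelation d labs m chunk, Decomposable r s x) :
    ObjInv d m (k + 1) s.1 (combine d r m s labs k chunk) := by
  classical
  obtain ⟨ζ, ls⟩ := s
  have hlabs0 : 0 < labs.length := by rw [hlabs.length]; positivity
  have hζ : ζ ≠ 0 := by
    rintro rfl
    have hpos : ls.prod ≠ 0 := List.prod_ne_zero fun h0 => Nat.not_prime_zero (hs.prime 0 h0)
    have h1 := pow_orderOf_eq_one (0 : F)
    rw [hs.order, zero_pow hpos] at h1
    exact zero_ne_one h1
  -- There are `labs.length * (m + 1)` tensors with only `labs.length * m` coordinates.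
  have hR := relation_spec (R := chunk.map (tensor d labs m)) (w := (keys labs m).length) (by
    rw [length_keys, List.length_map, hlen, Nat.mul_succ]; omega)
  obtain ⟨⟨j₁, hj₁, hβ₁⟩, hrel⟩ := hR
  rw [List.length_map] at hj₁ hrel
  set β := chunkRelation d labs m chunk with hβ
  change β.getD j₁ 0 ≠ 0 at hβ₁
  have hβlen : β.length = chunk.length := by
    rw [hβ, chunkRelation, length_relation, List.length_map]
  set dec := β.map (decomp d r ζ ls) with hdec
  have hdecj : ∀ j < chunk.length, dec.getD j (0, 0) = decomp d r ζ ls (β.getD j 0) := by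
    intro j hj
    rw [hdec, List.getD_eq_getElem _ _ (by simpa [hβlen] using hj),
      List.getD_eq_getElem _ _ (by rwa [hβlen]), List.getElem_map]
  have hspec : ∀ j < chunk.length, (β.getD j 0 ≠ 0 → (dec.getD j (0, 0)).2 ≠ 0) ∧
      β.getD j 0 = ζ ^ (dec.getD j (0, 0)).1 * (dec.getD j (0, 0)).2 ^ d := by
    intro j hj
    rw [hdecj j hj]
    refine decomp_spec hd hr hrd hs (hgood _ ?_)
    rw [List.getD_eq_getElem _ _ (by rwa [hβlen])]
    exact List.getElem_mem _
  have hcoord : ∀ l ∈ labs, ∀ c < m,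
      ∑ j ∈ Finset.range chunk.length, β.getD j 0 * coord d (chunk.getD j []) l c = 0 := by
    intro l hl c hc
    have hmem : (l, c) ∈ keys labs m :=
      List.mem_flatMap.2 ⟨l, hl, List.mem_map.2 ⟨c, List.mem_range.2 hc, rfl⟩⟩
    obtain ⟨n, hn, hn'⟩ := List.getElem_of_mem hmem
    refine Eq.trans (Finset.sum_congr rfl fun j hj => ?_) (hrel n hn)
    have hj := Finset.mem_range.1 hj
    congr 1
    have e : (chunk.map (tensor d labs m)).getD j [] = tensor d labs m (chunk.getD j []) := by
      rw [List.getD_eq_getElem _ _ (by simpa using hj), List.getElem_map,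
        List.getD_eq_getElem _ _ hj]
    rw [e, List.getD_eq_getElem (n := n) _ _ (by simpa [tensor] using hn)]
    simp only [tensor, List.getElem_map, hn']
  set sh := shift d k dec with hsh
  have hT : combine d r m (ζ, ls) labs k chunk = joinTerms d sh ζ dec chunk := rfl
  -- The remainder of the shifted exponent becomes the label entry, while the quotient goes into the
  -- coefficient, whose d-th power restores it.
  have hG : ∀ j < chunk.length, ζ ^ (((dec.getD j (0, 0)).1 + sh) % d) *
      (ζ ^ (((dec.getD j (0, 0)).1 + sh) / d) * (dec.getD j (0, 0)).2) ^ d =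
      ζ ^ sh * β.getD j 0 := by
    intro j hj
    rw [(hspec j hj).2, mul_pow, ← pow_mul, ← mul_assoc, ← pow_add,
      mul_comm (_ / d) d, Nat.mod_add_div, pow_add]
    ring
  have hget : ∀ j < chunk.length, chunk.getD j [] ∈ chunk := by
    intro j hj
    rw [List.getD_eq_getElem _ _ hj]
    exact List.getElem_mem _
  rw [hT]
  refine ⟨fun i hi c hc h hh => ?_, ?_⟩
  · rw [weighted_joinTerms]
    rcases Nat.lt_succ_iff_lt_or_eq.1 hi with hi | rfl
    · refine Finset.sum_eq_zero fun j hj => ?_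
      have hj := Finset.mem_range.1 hj
      have hinvj := (hinv _ (hget j hj)).contract i hi c hc
        (fun l => h (l ++ [((dec.getD j (0, 0)).1 + sh) % d])) (fun l b => by
          by_cases hil : i < l.length
          · rw [← hh (l ++ _) b, List.set_append_left _ _ hil]
          · rw [List.set_eq_of_length_le (by omega)])
      refine mul_eq_zero_of_right _ (Eq.trans (weighted_congr fun t ht => ?_) hinvj)
      have hl := (hlabs.mem _ (hlab _ (hget j hj) t ht)).1
      rw [List.getD_append _ _ _ _ (by omega)]
    -- The weight does not depend on the new entry, which may therefore be replaced by 0; it then no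
    -- longer depends on `j`.
    · have h1 : ∀ j ∈ Finset.range chunk.length,
          (ζ ^ (((dec.getD j (0, 0)).1 + sh) / d) * (dec.getD j (0, 0)).2) ^ d *
          weighted d (chunk.getD j []) (fun l =>
            ζ ^ (l ++ [((dec.getD j (0, 0)).1 + sh) % d]).getD i 0 *
              h (l ++ [((dec.getD j (0, 0)).1 + sh) % d])) c =
          ∑ l ∈ labs.toFinset, ζ ^ sh * h (l ++ [0]) *
            (β.getD j 0 * coord d (chunk.getD j []) l c) := by
        intro j hj
        have hj := Finset.mem_range.1 hj
        rw [weighted_congr (h' := fun l => ζ ^ (((dec.getD j (0, 0)).1 + sh) % d) * h (l ++ [0]))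
          (fun t ht => ?_), weighted_const_mul, ← mul_assoc, mul_comm _ (ζ ^ (_ % d)), hG j hj,
          weighted_eq_sum_coord (S := labs.toFinset)
            (fun t ht => List.mem_toFinset.2 (hlab _ (hget j hj) t ht)), Finset.mul_sum]
        · exact Finset.sum_congr rfl fun l _ => by ring
        · have hl := (hlabs.mem _ (hlab _ (hget j hj) t ht)).1
          have e1 : (t.2.1 ++ [((dec.getD j (0, 0)).1 + sh) % d]).getD i 0 =
              ((dec.getD j (0, 0)).1 + sh) % d := by
            rw [List.getD_append_right _ _ _ _ (by omega), hl]
            simp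
          have e2 : h (t.2.1 ++ [((dec.getD j (0, 0)).1 + sh) % d]) = h (t.2.1 ++ [0]) := by
            rw [← hh (t.2.1 ++ [0]) (((dec.getD j (0, 0)).1 + sh) % d),
              List.set_append_right _ _ (by omega), hl]
            simp
          simp only [e1, e2]
      rw [Finset.sum_congr rfl h1, Finset.sum_comm]
      refine Finset.sum_eq_zero fun l hl => ?_
      rw [← Finset.mul_sum, hcoord l (List.mem_toFinset.1 hl) c hc, mul_zero]
  · have hmem1 : dec.getD j₁ (0, 0) ∈ dec := by
      rw [List.getD_eq_getElem _ _ (by simpa [hdec, hβlen] using hj₁)]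
      exact List.getElem_mem _
    -- The shift is chosen so that the first list with nonzero factor receives the new entry `k`.
    -- Its term labelled `0, …, k - 1` becomes the required term of the next round.
    have hz := headD_filter_mem (P := fun z : ℕ × F => z.2 ≠ 0) hmem1 ((hspec j₁ hj₁).1 hβ₁) (0, 0)
    have hsh' : sh = d - ((dec.filter fun z => z.2 ≠ 0).headD (0, 0)).1 + k := by
      rw [hsh, shift]
    generalize (dec.filter fun z => z.2 ≠ 0).headD (0, 0) = z at hz hsh'
    obtain ⟨n, hn, hnz⟩ := List.getElem_of_mem hz.1
    have hn' : n < chunk.length := by simpa [hdec, hβlen] using hn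
    have hzn : dec.getD n (0, 0) = z := by rw [List.getD_eq_getElem _ _ hn, hnz]
    have hzd : z.1 < d := by
      rw [← hzn, hdecj n hn']
      exact decomp_fst_lt hd _ _ _
    obtain ⟨t, ht, ht1, ht2⟩ := (hinv _ (hget n hn')).exists_range
    refine ⟨_, List.mem_flatMap.2 ⟨n, List.mem_range.2 hn', List.mem_map.2 ⟨t, ht, rfl⟩⟩, ?_, ?_⟩
    · simp only
      rw [ht1, List.range_succ, hzn, hsh', show z.1 + (d - z.1 + k) = k + d by omega,
        Nat.add_mod_right, Nat.mod_eq_of_lt hk]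
    · simp only
      rw [hzn]
      exact mul_ne_zero ht2 (mul_ne_zero (pow_ne_zero _ hζ) hz.2)

theorem objInv_core {d r m : ℕ} {s : F × List ℕ} {V : List (List F)}
    (hV : V.length = numVectors d m) (hr : 0 < r) (hrd : r.Coprime d) (hs : IsGenerator d s)
    (hgood : ∀ x ∈ (core d r m s V d).2.2, Decomposable r s x) {k : ℕ} (hk : k ≤ d) :
    (∀ x ∈ (core d r m s V k).2.2, Decomposable r s x) ∧
      ∀ T ∈ (core d r m s V k).2.1, ObjInv d m k s.1 T := by
  -- Coefficients are only appended, so checking those collected at the end covers every round.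
  have hmono : ∀ k ≤ d, ∀ x ∈ (core d r m s V k).2.2, Decomposable r s x := by
    intro k hk
    induction hk using Nat.decreasingInduction with
    | self => exact hgood
    | of_succ k hk ih =>
      intro x hx
      refine ih x ?_
      rw [core_succ]
      exact List.mem_append_left _ hx
  refine ⟨hmono k hk, ?_⟩
  induction k with
  | zero =>
    intro T hT
    obtain ⟨v, -, rfl⟩ := List.mem_map.1 hT
    exact ⟨fun i hi => absurd hi (Nat.not_lt_zero i), _, List.mem_singleton_self _, rfl,
      one_ne_zero⟩
  | succ k ih =>
    have hd : 0 < d := by omega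
    have hsh := coreShape_core hV r s (k := k) (by omega)
    have hg := hmono (k + 1) hk
    have ih := ih (by omega)
    rw [core_succ] at hg ⊢
    intro T hT
    obtain ⟨c, hc, rfl⟩ := List.mem_map.1 hT
    have hsub : ∀ T ∈ c, T ∈ (core d r m s V k).2.1 := by
      intro T hT
      rw [← flatten_chunks (hsh.chunk_pos hd) (hsh.length_eq hk)]
      exact List.mem_flatten.2 ⟨c, hc, hT⟩
    exact objInv_combine hd hr hrd hs hk hsh.labels
      (length_of_mem_chunks (hsh.chunk_pos hd) (hsh.length_eq hk) hc)
      (fun T hT => hsh.label_mem T (hsub T hT)) (fun T hT => ih T (hsub T hT))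
      (fun x hx => hg x (List.mem_append_right _ (List.mem_flatMap.2 ⟨c, hc, hx⟩)))

end Weighted

/-! ### Signs of permutations computed by counting inversions. -/

section Signs

/-- Pairs of positions in a label. -/
def positionPairs (d : ℕ) : List (ℕ × ℕ) :=
  (List.range d).flatMap fun i => (List.range d).map fun j => (i, j)

/-- The entries of a label are distinct. -/
def IsInjLabel (d : ℕ) (l : List ℕ) : Prop :=
  ∀ ij ∈ positionPairs d, ij.1 < ij.2 → l.getD ij.1 0 ≠ l.getD ij.2 0

/-- The number of inversions of a label. -/
def inversions (d : ℕ) (l : List ℕ) : ℕ :=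
  ((positionPairs d).filter fun ij => ij.1 < ij.2 ∧ l.getD ij.2 0 < l.getD ij.1 0).length

theorem mem_positionPairs {d : ℕ} {ij : ℕ × ℕ} :
    ij ∈ positionPairs d ↔ ij.1 < d ∧ ij.2 < d := by
  obtain ⟨i, j⟩ := ij
  simp [positionPairs]

theorem nodup_positionPairs (d : ℕ) : (positionPairs d).Nodup := by
  have h : positionPairs d = List.range d ×ˢ List.range d := rfl
  rw [h]
  exact List.nodup_range.product List.nodup_range

theorem isInjLabel_iff {d : ℕ} {l : List ℕ} {f : Fin d → Fin d}
    (hf : ∀ j : Fin d, l.getD j 0 = f j) : IsInjLabel d l ↔ Function.Injective f := by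
  constructor
  · intro h i j hij
    by_contra hne
    rcases lt_or_gt_of_ne hne with h1 | h1
    · exact h (i, j) (mem_positionPairs.2 ⟨i.2, j.2⟩) h1 (by simp only [hf, hij])
    · exact h (j, i) (mem_positionPairs.2 ⟨j.2, i.2⟩) h1 (by simp only [hf, hij])
  · rintro h ⟨i, j⟩ hij hlt heq
    obtain ⟨hi, hj⟩ := mem_positionPairs.1 hij
    have h1 : f ⟨i, hi⟩ = f ⟨j, hj⟩ := Fin.ext (by
      rw [← hf, ← hf]; exact heq)
    have := congrArg Fin.val (h h1)
    simp only at this hlt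
    omega

/-- The shape of the double sum matches the product formula for the sign in
`Equiv.Perm.sign_eq_prod_prod_Iio`. -/
theorem inversions_eq {d : ℕ} {l : List ℕ} {f : Fin d → Fin d}
    (hf : ∀ j : Fin d, l.getD j 0 = f j) : inversions d l =
      ∑ j : Fin d, ∑ i ∈ Finset.Iio j, if f i < f j then 0 else if f j < f i then 1 else 0 := by
  classical
  have h1 : inversions d l = ((Finset.univ : Finset (Fin d × Fin d)).filter
      fun ij => ij.1 < ij.2 ∧ f ij.2 < f ij.1).card := by
    rw [inversions, ← List.toFinset_card_of_nodup ((nodup_positionPairs d).filter _)]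
    symm
    refine Finset.card_bij (fun ij _ => ((ij.1 : ℕ), (ij.2 : ℕ))) ?_ ?_ ?_
    · rintro ⟨i, j⟩ h
      simp only [Finset.mem_filter, Finset.mem_univ, true_and] at h
      simp only [List.mem_toFinset, List.mem_filter, mem_positionPairs, decide_eq_true_eq, hf]
      exact ⟨⟨i.2, j.2⟩, h⟩
    · rintro ⟨i, j⟩ _ ⟨i', j'⟩ _ h
      simp only [Prod.mk.injEq] at h
      exact Prod.ext (Fin.ext h.1) (Fin.ext h.2)
    · rintro ⟨i, j⟩ h
      simp only [List.mem_toFinset, List.mem_filter, mem_positionPairs, decide_eq_true_eq] at h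
      obtain ⟨⟨hi, hj⟩, h2, h3⟩ := h
      refine ⟨(⟨i, hi⟩, ⟨j, hj⟩), ?_, rfl⟩
      simp only [Finset.mem_filter, Finset.mem_univ, true_and]
      refine ⟨h2, ?_⟩
      have e1 := hf ⟨i, hi⟩
      have e2 := hf ⟨j, hj⟩
      simp only at e1 e2
      rw [Fin.lt_def, ← e1, ← e2]
      exact h3
  rw [h1, Finset.card_filter, Fintype.sum_prod_type_right]
  refine Finset.sum_congr rfl fun j _ => ?_
  have : Finset.Iio j = Finset.univ.filter fun i => i < j := by ext; simp
  rw [this, Finset.sum_filter]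
  refine Finset.sum_congr rfl fun i _ => ?_
  by_cases h2 : i < j <;> by_cases h3 : f j < f i <;> simp [h2, h3, not_lt_of_gt]

/-- An injective label gives a permutation matrix, whose determinant is the sign; otherwise two rows
coincide. -/
theorem det_unitMatrix {F : Type*} [Field F] {d : ℕ} {l : List ℕ} {f : Fin d → Fin d}
    (hf : ∀ j : Fin d, l.getD j 0 = f j) [Decidable (IsInjLabel d l)] :
    (unitMatrix F f).det = if IsInjLabel d l then (-1) ^ inversions d l else 0 := by
  classical
  split_ifs with h
  · have hinj := (isInjLabel_iff hf).1 h
    let σ : Equiv.Perm (Fin d) := Equiv.ofBijective f (Finite.injective_iff_bijective.1 hinj)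
    have e : unitMatrix F f = σ.permMatrix F := by
      ext i j
      simp [unitMatrix, Equiv.Perm.permMatrix, PEquiv.toMatrix_apply, σ, eq_comm]
    rw [e, Matrix.det_permutation, Equiv.Perm.sign_eq_prod_prod_Iio, inversions_eq hf]
    simp only [← Finset.prod_pow_eq_pow_sum]
    push_cast
    refine Finset.prod_congr rfl fun j _ => Finset.prod_congr rfl fun i hi => ?_
    have hij : f i ≠ f j := fun h => (Finset.mem_Iio.1 hi).ne (hinj h)
    change (((if f i < f j then (1 : ℤˣ) else -1 : ℤˣ) : ℤ) : F) = _
    rcases lt_or_gt_of_ne hij with h1 | h1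
    · simp [h1]
    · simp [h1, not_lt_of_gt h1]
  · have hninj : ¬ Function.Injective f := fun h' => h ((isInjLabel_iff hf).2 h')
    simp only [Function.Injective, not_forall] at hninj
    obtain ⟨i, j, hij, hne⟩ := hninj
    exact Matrix.det_zero_of_row_eq hne (by ext k; simp [unitMatrix, hij])

end Signs

/-! ### Repeated passes and correctness of the resulting collision. -/

section Passes

variable {F : Type*} [Field F]

open Classical in
/-- Enlarge the known cyclic group if it does not suffice for the computation. -/
noncomputable def pass (q d m r : ℕ) (V : List (List F)) (s : F × List ℕ) : F × List ℕ :=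
  if ((core d r m s V d).2.2.filter fun x => x ≠ 0 ∧ x ^ (r * s.2.prod) ≠ 1) = [] then s else
    enlarge q d s
      (((core d r m s V d).2.2.filter fun x => x ≠ 0 ∧ x ^ (r * s.2.prod) ≠ 1).headD 0)

/-- The known cyclic group after the given number of passes. -/
noncomputable def passes (q d m : ℕ) (V : List (List F)) (n : ℕ) : F × List ℕ :=
  (List.range n).foldl (fun s _ => pass q d m (coprimePart d (q - 1)) V s) (1, [])

/-- Labels and coefficients for all vectors. -/
noncomputable def finalTerms (q d m : ℕ) (V : List (List F)) : List (Term F) :=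
  (core d (coprimePart d (q - 1)) m (passes q d m V (Nat.size q)) V d).2.1.headD []

open Classical in
/-- The positions of the terms with nonzero coefficients whose labels are permutations of a given
parity. -/
noncomputable def positions (d b : ℕ) (T : List (Term F)) : List ℕ :=
  (List.range T.length).filter fun i => (T.getD i ([], [], 0)).2.2 ≠ 0 ∧
    IsInjLabel d (T.getD i ([], [], 0)).2.1 ∧ inversions d (T.getD i ([], [], 0)).2.1 % 2 = b

theorem passes_succ (q d m : ℕ) (V : List (List F)) (n : ℕ) : passes q d m V (n + 1) =
    pass q d m (coprimePart d (q - 1)) V (passes q d m V n) := by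
  simp [passes, List.range_succ]

/-- A pass either gains a prime factor of the group order or changes nothing, and in the second case
all roots needed by the rounds could be extracted. -/
theorem pass_spec {q d m : ℕ} (hd : 0 < d) (hq : 1 < q) (hF : ∀ x : F, x ≠ 0 → x ^ (q - 1) = 1)
    (V : List (List F)) {s : F × List ℕ} (hs : IsGenerator d s) :
    IsGenerator d (pass q d m (coprimePart d (q - 1)) V s) ∧
      ((pass q d m (coprimePart d (q - 1)) V s).2.length = s.2.length + 1 ∨
        pass q d m (coprimePart d (q - 1)) V s = s ∧
        ∀ x ∈ (core d (coprimePart d (q - 1)) m s V d).2.2,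
          Decomposable (coprimePart d (q - 1)) s x) := by
  classical
  unfold pass
  split_ifs with h
  · refine ⟨hs, Or.inr ⟨rfl, fun x hx => ?_⟩⟩
    have h1 := List.filter_eq_nil_iff.1 h x hx
    simp only [decide_eq_true_eq, not_and, not_not] at h1
    by_cases hx0 : x = 0
    · exact Or.inl hx0
    · exact Or.inr (h1 hx0)
  · obtain ⟨x0, hx0⟩ := List.exists_mem_of_ne_nil _ h
    obtain ⟨h1, h2⟩ := List.mem_filter.1 hx0
    obtain ⟨-, h3, h4⟩ := headD_filter_mem
      (P := fun x : F => x ≠ 0 ∧ x ^ (coprimePart d (q - 1) * s.2.prod) ≠ 1) h1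
      (by simpa using h2) 0
    exact ⟨isGenerator_enlarge hd hq hs (hF _ h3) h4, Or.inl rfl⟩

theorem isGenerator_passes {q d m : ℕ} (hd : 0 < d) (hq : 1 < q)
    (hF : ∀ x : F, x ≠ 0 → x ^ (q - 1) = 1) (V : List (List F)) (n : ℕ) :
    IsGenerator d (passes q d m V n) := by
  induction n with
  | zero => exact ⟨by simp [passes], by simp [passes], by simp [passes]⟩
  | succ n ih =>
    rw [passes_succ]
    exact (pass_spec hd hq hF V ih).1

/-- Every prime factor is at least 2 and the order divides q - 1 < 2^(`Nat.size q`). -/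
theorem IsGenerator.length_lt {q d : ℕ} (hq : 1 < q) (hF : ∀ x : F, x ≠ 0 → x ^ (q - 1) = 1)
    {s : F × List ℕ} (hs : IsGenerator d s) : s.2.prod ∣ q - 1 ∧ s.2.length < Nat.size q := by
  have hpos : s.2.prod ≠ 0 := List.prod_ne_zero fun h0 => Nat.not_prime_zero (hs.prime 0 h0)
  have hs0 : s.1 ≠ 0 := by
    intro h0
    have h1 := pow_orderOf_eq_one s.1
    rw [hs.order, h0, zero_pow hpos] at h1
    exact zero_ne_one h1
  have h1 : s.2.prod ∣ q - 1 := by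
    rw [← hs.order]
    exact orderOf_dvd_of_pow_eq_one (hF _ hs0)
  refine ⟨h1, ?_⟩
  have h2 := Nat.le_of_dvd (by omega) h1
  have h3 : 2 ^ s.2.length ≤ s.2.prod := List.pow_card_le_prod _ _ fun l hl => (hs.prime l hl).two_le
  have h4 := Nat.lt_size_self q
  exact (Nat.pow_lt_pow_iff_right (by norm_num)).1 (show 2 ^ s.2.length < 2 ^ Nat.size q by omega)

/-- A pass that changes nothing is followed only by such passes. `Nat.size q` successive gains would
contradict `IsGenerator.length_lt`, so the last state is a fixed point. -/
theorem decomposable_passes {q d m : ℕ} (hd : 0 < d) (hq : 1 < q)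
    (hF : ∀ x : F, x ≠ 0 → x ^ (q - 1) = 1) (V : List (List F)) :
    ∀ x ∈ (core d (coprimePart d (q - 1)) m (passes q d m V (Nat.size q)) V d).2.2,
      Decomposable (coprimePart d (q - 1)) (passes q d m V (Nat.size q)) x := by
  have key : ∀ n, n ≤ (passes q d m V n).2.length ∨
      (pass q d m (coprimePart d (q - 1)) V (passes q d m V n) = passes q d m V n ∧
      ∀ x ∈ (core d (coprimePart d (q - 1)) m (passes q d m V n) V d).2.2,
        Decomposable (coprimePart d (q - 1)) (passes q d m V n) x) := by
    intro n
    induction n with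
    | zero => exact Or.inl (Nat.zero_le _)
    | succ n ih =>
      rw [passes_succ]
      have h := (pass_spec (m := m) hd hq hF V (isGenerator_passes (m := m) hd hq hF V n)).2
      rcases ih with ih | ih
      · rcases h with h | h
        · exact Or.inl (by omega)
        · rw [h.1]
          exact Or.inr h
      · rw [ih.1]
        exact Or.inr ih
  rcases key (Nat.size q) with h | h
  · have := ((isGenerator_passes (m := m) hd hq hF V (Nat.size q)).length_lt hq hF).2
    omega
  · exact h.2

/-- The digits of a label, reduced modulo `d`. -/
def labelFun {d : ℕ} (hd : 0 < d) (l : List ℕ) (j : Fin d) : Fin d :=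
  ⟨l.getD j 0 % d, Nat.mod_lt _ hd⟩

theorem labelFun_set {d : ℕ} (hd : 0 < d) {l : List ℕ} {i : Fin d} (hi : (i : ℕ) < l.length)
    (b : ℕ) : labelFun hd (l.set i b) =
      Function.update (labelFun hd l) i ⟨b % d, Nat.mod_lt _ hd⟩ := by
  funext j
  by_cases hj : j = i
  · subst hj
    simp [labelFun, List.getD_eq_getElem?_getD, hi]
  · have : (i : ℕ) ≠ j := fun h => hj (Fin.ext h.symm)
    simp [labelFun, List.getD_eq_getElem?_getD, hj, this]

/-- Labels are identified with functions `Fin d → Fin d`, and `sum_det_smul_eq_zero` is applied with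
z_b = ζ^b, whose entry z_0 = 1 is nonzero. -/
theorem sum_det_finalTerms {d m : ℕ} (hd : 0 < d) {ζ : F} {T : List (Term F)}
    (hT : ObjInv d m d ζ T) (hlab : ∀ t ∈ T, t.2.1.length = d ∧ ∀ b ∈ t.2.1, b < d) {c : ℕ}
    (hc : c < m) : weighted d T (fun l => (unitMatrix F (labelFun hd l)).det) c = 0 := by
  classical
  let e : (Fin d → Fin d) → List ℕ := fun f => List.ofFn fun j => (f j : ℕ)
  have he : Function.Injective e := by
    intro f g h
    have := List.ofFn_injective h
    funext j
    exact Fin.ext (congrFun this j)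
  have hef : ∀ f, labelFun hd (e f) = f := by
    intro f
    funext j
    refine Fin.ext ?_
    simp [labelFun, e, List.getD_eq_getElem?_getD, Nat.mod_eq_of_lt (f j).2]
  have hS : ∀ t ∈ T, t.2.1 ∈ Finset.univ.map ⟨e, he⟩ := by
    intro t ht
    obtain ⟨h1, h2⟩ := hlab t ht
    refine Finset.mem_map.2 ⟨labelFun hd t.2.1, Finset.mem_univ _, ?_⟩
    refine List.ext_getElem (by simp [e, h1]) fun j hj hj' => ?_
    have : t.2.1[j] < d := h2 _ (List.getElem_mem _)
    simp [e, labelFun, List.getElem?_eq_getElem hj', Nat.mod_eq_of_lt this]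
  rw [weighted_eq_sum_coord hS, Finset.sum_map]
  simp only [Function.Embedding.coeFn_mk, hef]
  refine sum_det_smul_eq_zero (z := fun b => ζ ^ (b : ℕ)) ⟨0, hd⟩ (by simp) fun i g hg => ?_
  have h1 := hT.contract i i.2 c hc (fun l => g (labelFun hd l)) fun l b => by
    by_cases hil : (i : ℕ) < l.length
    · rw [labelFun_set hd hil, hg]
    · rw [List.set_eq_of_length_le (by omega)]
  rw [weighted_eq_sum_coord hS, Finset.sum_map] at h1
  simp only [Function.Embedding.coeFn_mk, hef] at h1
  refine Eq.trans (Finset.sum_congr rfl fun f _ => ?_) h1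
  simp [e, List.getD_eq_getElem?_getD]

theorem finalTerms_spec {q d m : ℕ} (hd : 0 < d) (hq : 1 < q)
    (hF : ∀ x : F, x ≠ 0 → x ^ (q - 1) = 1) {V : List (List F)}
    (hV : V.length = numVectors d m) :
    (finalTerms q d m V).map Prod.fst = V ∧
      (∀ t ∈ finalTerms q d m V, t.2.1.length = d ∧ ∀ b ∈ t.2.1, b < d) ∧
      (∃ ζ : F, ObjInv d m d ζ (finalTerms q d m V)) := by
  obtain ⟨h1, h2, -⟩ := coprimePart_spec hd (n := q - 1) (by omega)
  have hr : 0 < coprimePart d (q - 1) := Nat.pos_of_dvd_of_pos h2 (by omega)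
  have hsh := coreShape_core hV (coprimePart d (q - 1)) (passes q d m V (Nat.size q)) le_rfl
  have hinv := (objInv_core hV hr h1 (isGenerator_passes hd hq hF V _)
    (decomposable_passes hd hq hF V) le_rfl).2
  unfold finalTerms
  generalize core d (coprimePart d (q - 1)) m (passes q d m V (Nat.size q)) V d = st at hsh hinv
  have hlen := hsh.length
  rw [numObjects, Finset.Ico_self, Finset.prod_empty] at hlen
  obtain ⟨T, hT⟩ := List.length_eq_one_iff.1 hlen
  have hv := hsh.vectors
  have hl := hsh.label_mem
  rw [hT] at hv hl hinv ⊢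
  refine ⟨by simpa using hv, fun t ht => ?_, _, hinv T (by simp)⟩
  exact hsh.labels.mem _ (hl T (by simp) t ht)

theorem mem_positions {d b : ℕ} {T : List (Term F)} {i : ℕ} : i ∈ positions d b T ↔
    i < T.length ∧ (T.getD i ([], [], 0)).2.2 ≠ 0 ∧ IsInjLabel d (T.getD i ([], [], 0)).2.1 ∧
      inversions d (T.getD i ([], [], 0)).2.1 % 2 = b := by
  simp [positions]

theorem sum_map_eq_sum_range {α : Type*} (T : List α) (f : α → F) (t : α) :
    (T.map f).sum = ∑ i ∈ Finset.range T.length, f (T.getD i t) := by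
  induction T with
  | nil => simp
  | cons a T ih =>
    rw [List.map_cons, List.sum_cons, List.length_cons, Finset.sum_range_succ', ih, add_comm]
    rfl

-- The difference of the two sides is the determinant-weighted sum: even permutations contribute +1,
-- odd ones -1 and all other labels 0. Terms with coefficient 0 may be left out because `d > 0`.
open Classical in
theorem isCollision_finalTerms {q d m : ℕ} (hd : 0 < d) (hq : 1 < q)
    (hF : ∀ x : F, x ≠ 0 → x ^ (q - 1) = 1) (v : Fin (numVectors d m) → Fin m → F)
    {V : List (List F)} (hV : V = List.ofFn fun i => List.ofFn (v i)) :
    (finalTerms q d m V).length = numVectors d m ∧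
    IsCollision d v
      (Finset.univ.filter fun i => (i : ℕ) ∈ positions d 0 (finalTerms q d m V))
      (Finset.univ.filter fun i => (i : ℕ) ∈ positions d 1 (finalTerms q d m V))
      (fun i => ((finalTerms q d m V).getD i ([], [], 0)).2.2) := by
  have hVlen : V.length = numVectors d m := by rw [hV, List.length_ofFn]
  obtain ⟨h1, h2, ζ, h3⟩ := finalTerms_spec hd hq hF hVlen
  generalize finalTerms q d m V = T at h1 h2 h3
  have hTlen : T.length = numVectors d m := by
    rw [← hVlen, ← h1, List.length_map]
  have hmem : ∀ i : Fin (numVectors d m), T.getD i ([], [], 0) ∈ T := fun i => by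
    rw [List.getD_eq_getElem _ _ (by rw [hTlen]; exact i.2)]
    exact List.getElem_mem _
  have hvec : ∀ (i : Fin (numVectors d m)) (c : Fin m),
      (T.getD i ([], [], 0)).1.getD c 0 = v i c := by
    intro i c
    have hi : (i : ℕ) < T.length := by rw [hTlen]; exact i.2
    have e : (T.getD i ([], [], 0)).1 = List.ofFn (v i) := by
      rw [List.getD_eq_getElem _ _ hi]
      have e1 : (T.map Prod.fst)[(i : ℕ)]'(by simpa using hi) = T[(i : ℕ)].1 := by simp
      rw [← e1]
      simp only [h1, hV]
      simp
    rw [e]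
    simp [List.getD_eq_getElem?_getD]
  refine ⟨hTlen, ?_, ?_, ?_, ?_⟩
  · rw [Finset.disjoint_left]
    intro i hi hj
    have hi := (mem_positions.1 (Finset.mem_filter.1 hi).2).2.2.2
    have hj := (mem_positions.1 (Finset.mem_filter.1 hj).2).2.2.2
    omega
  -- The term labelled `0, …, d - 1` has no inversions, so its position lies in the even set.
  · obtain ⟨t, ht, ht1, ht2⟩ := h3.exists_range
    obtain ⟨n, hn, rfl⟩ := List.getElem_of_mem ht
    refine ⟨⟨n, hTlen ▸ hn⟩, Finset.mem_filter.2 ⟨Finset.mem_univ _, mem_positions.2 ⟨hn, ?_⟩⟩⟩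
    simp only [List.getD_eq_getElem _ _ hn, ht1]
    refine ⟨ht2, ?_, ?_⟩
    · rintro ⟨i, j⟩ hij hlt
      obtain ⟨hi, hj⟩ := mem_positionPairs.1 hij
      rw [List.getD_eq_getElem _ _ (by simpa using hi), List.getD_eq_getElem _ _ (by simpa using hj)]
      simpa using hlt.ne
    · have : inversions d (List.range d) = 0 := by
        rw [inversions, List.length_eq_zero_iff, List.filter_eq_nil_iff]
        rintro ⟨i, j⟩ hij
        obtain ⟨hi, hj⟩ := mem_positionPairs.1 hij
        simp only at hi hj
        simp only [List.getD_eq_getElem?_getD, List.getElem?_range hi, List.getElem?_range hj,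
          Option.getD_some, decide_eq_true_eq]
        omega
      rw [this]
  · intro i hi
    rcases Finset.mem_union.1 hi with hi | hi
    · exact (mem_positions.1 (Finset.mem_filter.1 hi).2).2.1
    · exact (mem_positions.1 (Finset.mem_filter.1 hi).2).2.1
  · funext c
    have h4 := sum_det_finalTerms hd h3 h2 c.2
    rw [weighted, sum_map_eq_sum_range _ _ ([], [], 0), hTlen, Finset.sum_range] at h4
    rw [Finset.sum_apply, Finset.sum_apply, ← sub_eq_zero, Finset.sum_filter, Finset.sum_filter,
      ← Finset.sum_sub_distrib]
    refine Eq.trans (Finset.sum_congr rfl fun i _ => ?_) h4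
    have hi : (i : ℕ) < T.length := by rw [hTlen]; exact i.2
    obtain ⟨h5, h6⟩ := h2 _ (hmem i)
    have h7 : ∀ j : Fin d, (T.getD i ([], [], 0)).2.1.getD j 0 =
        labelFun hd (T.getD i ([], [], 0)).2.1 j := by
      intro j
      have hj : (j : ℕ) < (T.getD i ([], [], 0)).2.1.length := by rw [h5]; exact j.2
      rw [labelFun]
      simp only
      rw [Nat.mod_eq_of_lt]
      rw [List.getD_eq_getElem _ _ hj]
      exact h6 _ (List.getElem_mem _)
    rw [det_unitMatrix h7, hvec]
    simp only [mem_positions, hi, true_and, Pi.smul_apply, smul_eq_mul]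
    generalize T.getD i ([], [], 0) = t
    by_cases h8 : t.2.2 = 0
    · simp [h8, hd.ne']
    · by_cases h9 : IsInjLabel d t.2.1
      · rcases Nat.mod_two_eq_zero_or_one (inversions d t.2.1) with h10 | h10
        · simp [h8, h9, h10, (Nat.even_iff.2 h10).neg_one_pow]
        · simp [h8, h9, h10, (Nat.odd_iff.2 h10).neg_one_pow]
      · simp [h9]

end Passes

/-! ### Running time of the extraction of roots -/

section

variable {ι : Type*} {N : ι → ℕ} {a : Ty} {x : ι → a.Val} {n q d e r l : ι → ℕ}
  {D : ι → FieldData.{u}} {y z ζ : ∀ i, (D i).F} {ls : ι → List ℕ}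

theorem PolyBdd.memRange (hn : PolyBdd N n) :
    PolyBdd (fun j : MemIdx fun i => List.range (n i) => N j.i) fun j => j.e :=
  (hn.comp MemIdx.i).mono fun j => (List.mem_range.1 j.mem).le

theorem PolyBdd.foldRange (hn : PolyBdd N n) :
    PolyBdd (fun j : FoldIdx fun i => List.range (n i) => N j.i) fun j => j.e :=
  (hn.comp FoldIdx.i).mono fun j =>
    (List.mem_range.1 (by rw [j.eq]; simp : j.e ∈ List.range (n j.i))).le

theorem PolyTime.natSize (hn : PolyTime N x n) : PolyTime N x fun i => Nat.size (n i) :=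
  hn.bitList.length.congr fun i => by simp [DiagonalSystems.bitList]

theorem PolyTimeDec.natPrime (hl : PolyTime N x l) (hl' : PolyBdd N l) :
    PolyTimeDec N x fun i => (l i).Prime := by
  refine ((natLe (.natConst hl.ctx 2) hl).and (forall_mem (P := fun i m => ¬ (2 ≤ m ∧ m ∣ l i))
    (.range hl hl') fun hx he => ((natLe (.natConst hx.self 2) he).and
      (natDvd he (hl.weaken hx))).not)).congr fun i => ?_
  rw [Nat.prime_def_lt']
  simp only [List.mem_range, not_and]
  exact and_congr_right fun _ => forall_congr' fun m => ⟨fun h h1 h2 => h h2 h1, fun h h1 h2 => h h2 h1⟩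

namespace PolyTime

theorem fieldSum {L : ∀ i, List (D i).F} (hD : PolyTime N x D) (hL : PolyTime N x L) :
    PolyTime N x fun i => (L i).sum := by
  have h := foldl (g := fun i (acc : (D i).F) (y : (D i).F) => acc + y)
    (s := fun i => (0 : (D i).F)) hL hD.fieldZero hD.polyBdd_field
    (fun i pre suf _ => FieldData.csize_le _) fun hx he hacc =>
      fieldAdd (hD.weaken hx) hacc he
  exact h.congr fun i => List.sum_eq_foldl.symm

open Classical in
theorem dlogDigit {s : ι → ℕ × ℕ} (hD : PolyTime N x D) (hζ : PolyTime N x ζ)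
    (hy : PolyTime N x y) (he : PolyTime N x e) (hs : PolyTime N x s) (hl : PolyTime N x l)
    (hl' : PolyBdd N l) : PolyTime N x fun i => dlogDigit (ζ i) (y i) (e i) (s i) (l i) := by
  unfold DiagonalSystems.dlogDigit
  refine (filter (range hl hl') fun {b x'} hx ht => ?_).headD (natConst hD.ctx 0)
  have hD' := hD.weaken hx
  have hs' := hs.weaken hx
  refine .fieldEq (fieldPow hD' (fieldMul hD' (hy.weaken hx) (fieldPow hD' (hζ.weaken hx)
    (hs'.fst.add (ht.mul hs'.snd)))) ((he.weaken hx).div (hs'.snd.mul (hl.weaken hx)))) hD'.fieldOne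

/-- Digits are found by trying all values, so the factors themselves must be polynomially bounded;
in the application they divide `d`. -/
theorem dlogAux {M : ι → ℕ} (hD : PolyTime N x D) (hζ : PolyTime N x ζ)
    (hy : PolyTime N x y) (he : PolyTime N x e) (hls : PolyTime N x ls) (hM : PolyBdd N M)
    (hpos : ∀ i, ∀ l ∈ ls i, 0 < l) (hle : ∀ i, ∀ l ∈ ls i, l ≤ M i) :
    PolyTime N x fun i => dlogAux (ζ i) (y i) (e i) (ls i) := by
  unfold DiagonalSystems.dlogAux
  refine foldl (B := fun i => (csize (ls i) + 1) + (csize (ls i) + 1) + 1) hls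
    ((natConst hD.ctx 0).prod (natConst hD.ctx 1))
    (((hls.polyBdd.add (.const 1)).add (hls.polyBdd.add (.const 1))).add (.const 1)) ?_ ?_
  · intro i pre suf h
    have h0 := dlogAux_fst_lt (ζ i) (y i) (e i) pre fun l hl =>
      hpos i l (by rw [h]; exact List.mem_append_left _ hl)
    have h1 := dlogAux_snd (ζ i) (y i) (e i) pre
    have h2 := Nat.size_prod_le pre
    have h3 : (pre.map Nat.size).sum ≤ (pre.map csize).sum :=
      List.sum_le_sum fun k _ => by rw [csize_nat]; omega
    have h4 := csize_prefix_le h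
    rw [csize_list] at h4
    change csize (DiagonalSystems.dlogAux (ζ i) (y i) (e i) pre) ≤ _
    rw [csize_prod, csize_nat, csize_nat, h1]
    have h5 := Nat.size_le_size h0.le
    omega
  · intro b x' hx hl hacc
    have hmem : ∀ j : FoldIdx ls, j.e ∈ ls j.i := fun j => by rw [j.eq]; simp
    exact (hacc.fst.add ((dlogDigit (hD.weaken hx) (hζ.weaken hx) (hy.weaken hx) (he.weaken hx)
      hacc hl ((hM.comp FoldIdx.i).mono fun j => hle _ _ (hmem j))).mul hacc.snd)).prod
      (hacc.snd.mul hl)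

theorem invMod (hr : PolyTime N x r) (hd : PolyTime N x d) (hd' : PolyBdd N d) :
    PolyTime N x fun i => invMod (r i) (d i) := by
  unfold DiagonalSystems.invMod
  refine (filter (P := fun i s => 1 ≤ s ∧ r i * s % d i = 1 % d i)
    (range (hd.add (natConst hd.ctx 1)) (hd'.add (.const 1)))
    fun {b x'} hx hs => ?_).headD (natConst hd.ctx 1)
  have h1 := natConst hx.self 1
  exact (PolyTimeDec.natLe h1 hs).and (.natEq (((hr.weaken hx).mul hs).mod (hd.weaken hx))
    (h1.mod (hd.weaken hx)))

open Classical in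
theorem decomp {s : ∀ i, (D i).F × List ℕ} (hD : PolyTime N x D) (hd : PolyTime N x d)
    (hd' : PolyBdd N d) (hd0 : ∀ i, 0 < d i) (hr : PolyTime N x r) (hs : PolyTime N x s)
    (hgen : ∀ i, IsGenerator (d i) (s i)) (hy : PolyTime N x y) :
    PolyTime N x fun i => decomp (d i) (r i) (s i).1 (s i).2 (y i) := by
  have h1 : PolyTime N x fun i => dlog (s i).1 (y i ^ r i) (s i).2 :=
    (dlogAux hD hs.fst (fieldPow hD hy hr) hs.snd.natProd hs.snd hd'
      (fun i l hl => ((hgen i).prime l hl).pos)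
      (fun i l hl => Nat.le_of_dvd (hd0 i) ((hgen i).dvd l hl))).fst
  have h2 := invMod hr hd hd'
  have hc1 := natConst hD.ctx 1
  have h3 := ((h1.mul h2).mul (hd.sub hc1)).mod hd
  unfold DiagonalSystems.decomp
  exact h3.prod (ite (.fieldEq hy hD.fieldZero) hD.fieldZero (fieldInv hD
    (fieldMul hD (fieldPow hD hs.fst ((h3.add (h1.mul h2)).div hd))
      (fieldPow hD hy (((hr.mul h2).sub hc1).div hd)))))

theorem coprimePart (hd : PolyTime N x d) (hd' : PolyBdd N d) (hn : PolyTime N x n) :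
    PolyTime N x fun i => coprimePart (d i) (n i) := by
  have hle : ∀ (d : ℕ) (ls : List ℕ) (n : ℕ), ls.foldl (removeFactor d) n ≤ n := by
    intro d ls
    induction ls with
    | nil => exact fun n => le_rfl
    | cons l ls ih =>
      intro n
      refine (ih _).trans ?_
      unfold removeFactor
      split_ifs
      · exact Nat.div_le_self _ _
      · exact le_rfl
  unfold DiagonalSystems.coprimePart factorList
  refine foldl (B := fun i => csize (n i)) (g := fun i => removeFactor (d i)) ?_ hn hn.polyBdd ?_ ?_
  · exact flatMap (range (hd.add (natConst hd.ctx 1)) (hd'.add (.const 1))) fun hx hl =>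
      map (X := fun _ => ℕ) (bitList (hn.weaken hx)) fun hx' _ => hl.weaken hx'
  · intro i pre suf _
    rw [csize_nat, csize_nat]
    exact Nat.add_le_add_right (Nat.size_le_size (hle _ _ _)) 1
  · intro b x' hx hl hacc
    exact ite ((PolyTimeDec.natLe (natConst hx.self 2) hl).and ((PolyTimeDec.natDvd hl
      (hd.weaken hx)).and (.natDvd hl hacc))) (hacc.div hl) hacc

open Classical in
theorem primePowerParts (hD : PolyTime N x D) (hd : PolyTime N x d) (hd' : PolyBdd N d)
    (hq : PolyTime N x q) (hy : PolyTime N x y) :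
    PolyTime N x fun i => primePowerParts (q i) (d i) (y i) := by
  have hd1 := hd'.add (.const 1)
  unfold DiagonalSystems.primePowerParts
  refine flatMap (X := fun _ => ℕ) (range (hd.add (natConst hd.ctx 1)) hd1) fun {b x'} hx hl => ?_
  have hD' := hD.weaken hx
  have hq' := hq.weaken hx
  have hq1 := hq'.sub (natConst hx.self 1)
  refine ite ((PolyTimeDec.natPrime hl hd1.memRange).and (.natDvd hl (hd.weaken hx)))
    (map (X := fun _ => ℕ) (filter (P := fun (i : MemIdx fun i => List.range (d i + 1)) j => i.e ^ j ∣ q i.i - 1) (range hq'.natSize hq'.polyBdd_size) fun hx2 hj => ?_)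
      fun {b x2} hx2 hj => ?_) (nil hx.self)
  · exact .natDvd ((hl.weaken hx2).natPow hj hq'.polyBdd_size.memRange) (hq1.weaken hx2)
  · have hb : PolyBdd (fun j : MemIdx fun i : MemIdx fun i => List.range (d i + 1) =>
        (List.range (Nat.size (q i.i))).filter fun j => i.e ^ j ∣ q i.i - 1 => N j.i.i)
        fun j => j.e :=
      (hq'.polyBdd_size.comp MemIdx.i).mono fun j =>
        (List.mem_range.1 (List.mem_filter.1 j.mem).1).le
    exact (fieldPow (hD'.weaken hx2) ((hy.weaken hx).weaken hx2) ((hq1.weaken hx2).div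
      ((hl.weaken hx2).natPow hj hb))).prod (hl.weaken hx2)

open Classical in
theorem newGenerator (hD : PolyTime N x D) (hd : PolyTime N x d) (hd' : PolyBdd N d)
    (hq : PolyTime N x q) (he : PolyTime N x e) (hy : PolyTime N x y) :
    PolyTime N x fun i => newGenerator (q i) (d i) (e i) (y i) := by
  unfold DiagonalSystems.newGenerator
  refine (filter (primePowerParts hD hd hd' hq hy) fun {b x'} hx hw => ?_).headD
    (hD.fieldOne.prod (natConst hD.ctx 1))
  have hD' := hD.weaken hx
  have he' := he.weaken hx
  exact (PolyTimeDec.fieldEq (fieldPow hD' hw.fst he') hD'.fieldOne).not.and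
    (.fieldEq (fieldPow hD' (fieldPow hD' hw.fst hw.snd) he') hD'.fieldOne)

theorem enlarge {s : ∀ i, (D i).F × List ℕ} (hD : PolyTime N x D) (hd : PolyTime N x d)
    (hd' : PolyBdd N d) (hq : PolyTime N x q) (hs : PolyTime N x s) (hy : PolyTime N x y) :
    PolyTime N x fun i => enlarge (q i) (d i) (s i) (y i) := by
  have h := newGenerator hD hd hd' hq hs.snd.natProd hy
  exact (fieldMul hD hs.fst h.fst).prod (h.snd.cons hs.snd)

end PolyTime

end

/-! ### Running time of the elimination -/

/-- Together with the uniform bound for field elements, this bounds the size of the elimination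
state after any number of steps. -/
theorem length_foldl_elimStep {F : Type*} [Field F] (R : List (List F)) (w : ℕ) (cs : List ℕ) :
    (cs.foldl (elimStep (w + R.length)) (augment R w)).length ≤ R.length ∧
      ∀ t ∈ cs.foldl (elimStep (w + R.length)) (augment R w),
        t.1 < R.length ∧ t.2.length = w + R.length := by
  induction cs using List.reverseRecOn with
  | nil =>
    refine ⟨by simp [augment], fun t ht => ?_⟩
    obtain ⟨j, hj, rfl⟩ := List.mem_map.1 ht
    exact ⟨List.mem_range.1 hj, by simp⟩
  | append_singleton cs c ih =>
    rw [List.foldl_append, List.foldl_cons, List.foldl_nil]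
    generalize cs.foldl (elimStep (w + R.length)) (augment R w) = rows at ih
    unfold elimStep
    split_ifs
    · exact ih
    · refine ⟨?_, fun t ht => ?_⟩
      · rw [List.length_map]
        exact (List.length_filter_le _ _).trans ih.1
      · obtain ⟨t', ht', rfl⟩ := List.mem_map.1 ht
        exact ⟨(ih.2 t' (List.mem_filter.1 ht').1).1, by simp⟩

section

variable {ι : Type*} {N : ι → ℕ} {a : Ty} {x : ι → a.Val} {n c w : ι → ℕ}
  {D : ι → FieldData.{u}}

namespace PolyTime

open Classical in
theorem elimStep {rows : ∀ i, List (ℕ × List (D i).F)} (hD : PolyTime N x D) (hn : PolyTime N x n)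
    (hn' : PolyBdd N n) (hrows : PolyTime N x rows) (hc : PolyTime N x c) (hc' : PolyBdd N c) :
    PolyTime N x fun i => elimStep (n i) (rows i) (c i) := by
  have h1 : PolyTime N x fun i => (rows i).filter fun t => t.2.getD (c i) 0 ≠ 0 :=
    filter hrows fun {b x'} hx ht =>
      (PolyTimeDec.fieldEq (ht.snd.getD (hc.weaken hx) (hc'.comp _) (hD.weaken hx).fieldZero)
        (hD.weaken hx).fieldZero).not
  have h2 := h1.headD ((natConst hD.ctx 0).prod (nil hD.ctx (Y := fun i => (D i).F)))
  unfold DiagonalSystems.elimStep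
  refine ite (.eq_nil h1) hrows (map (filter hrows fun hx ht =>
    (PolyTimeDec.natEq ht.fst (h2.weaken hx).fst).not) fun {b x'} hx ht =>
      ht.fst.prod (map (X := fun _ => ℕ) (range (hn.weaken hx) (hn'.comp _))
        fun {b2 x2} hx2 hk => ?_))
  have hD' := (hD.weaken hx).weaken hx2
  have hc1 := (hc.weaken hx).weaken hx2
  have ht2 := (ht.weaken hx2).snd
  have hp2 := ((h2.weaken hx).weaken hx2).snd
  exact fieldSub hD' (ht2.getD hk (hn'.comp _).memRange hD'.fieldZero) (fieldMul hD' (fieldMul hD'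
    (ht2.getD hc1 ((hc'.comp _).comp _) hD'.fieldZero) (fieldInv hD' (hp2.getD hc1 ((hc'.comp _).comp _) hD'.fieldZero)))
      (hp2.getD hk (hn'.comp _).memRange hD'.fieldZero))

theorem augment {R : ∀ i, List (List (D i).F)} (hD : PolyTime N x D) (hR : PolyTime N x R)
    (hw : PolyTime N x w) (hw' : PolyBdd N w) :
    PolyTime N x fun i => augment (R i) (w i) := by
  have hR' : PolyBdd N fun i => (R i).length := hR.polyBdd.mono fun i => length_le_csize _
  unfold DiagonalSystems.augment
  refine map (X := fun _ => ℕ) (range hR.length hR') fun {b x'} hx hj =>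
    hj.prod (map (X := fun _ => ℕ) (range ((hw.add hR.length).weaken hx) ((hw'.add hR').comp _))
      fun {b2 x2} hx2 hk => ?_)
  have hD' := (hD.weaken hx).weaken hx2
  have hw2 := (hw.weaken hx).weaken hx2
  exact ite (.natLt hk hw2) ((((hR.weaken hx).weaken hx2).getD (hj.weaken hx2)
    (hR'.memRange.comp _) (nil hx2.self)).getD hk (((hw'.add hR').comp _).memRange) hD'.fieldZero)
    (ite (.natEq (hk.sub hw2) (hj.weaken hx2)) hD'.fieldOne hD'.fieldZero)

theorem relation {R : ∀ i, List (List (D i).F)} (hD : PolyTime N x D) (hR : PolyTime N x R)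
    (hw : PolyTime N x w) (hw' : PolyBdd N w) :
    PolyTime N x fun i => relation (R i) (w i) := by
  have hR' : PolyBdd N fun i => (R i).length := hR.polyBdd.mono fun i => length_le_csize _
  have hrows : PolyTime N x fun i => (List.range (w i)).foldl
      (DiagonalSystems.elimStep (w i + (R i).length)) (DiagonalSystems.augment (R i) (w i)) := by
    refine foldl (X := fun _ => ℕ) (B := fun i => (R i).length * ((R i).length + 1 +
      ((w i + (R i).length) * (csize (D i) * (csize (D i) + 1) + 1 + 1) + 1) + 1 + 1) + 1)
      (range hw hw') (augment hD hR hw hw') ?_ ?_ ?_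
    · exact (hR'.mul ((((hR'.add (.const 1)).add (((hw'.add hR').mul
        (hD.polyBdd_field.add (.const 1))).add (.const 1))).add (.const 1)).add
          (.const 1))).add (.const 1)
    · intro i pre suf _
      obtain ⟨h1, h2⟩ := length_foldl_elimStep (R i) (w i) pre
      refine csize_list_le h1 fun t ht => ?_
      obtain ⟨h3, h4⟩ := h2 t ht
      have h5 := csize_list_le h4.le fun y _ => FieldData.csize_le y
      have h6 := Nat.size_le_self t.1
      rw [csize_prod, csize_nat]
      omega
    · intro b x' hx hc hacc
      exact elimStep (hD.weaken hx) ((hw.add hR.length).weaken hx) ((hw'.add hR').comp _) hacc hc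
        hw'.foldRange
  have h1 := hrows.headD ((natConst hD.ctx 0).prod (nil hD.ctx (Y := fun i => (D i).F)))
  unfold DiagonalSystems.relation
  exact map (X := fun _ => ℕ) (range hR.length hR') fun {b x'} hx hj =>
    ((h1.weaken hx).snd).getD ((hw.weaken hx).add hj) ((hw'.comp _).add hR'.memRange)
      (hD.weaken hx).fieldZero

end PolyTime

/-! ### Running time of the rounds -/

variable {d m k r s : ι → ℕ} {labs : ι → List (List ℕ)} {T : ∀ i, List (Term (D i).F)}
  {chunk : ∀ i, List (List (Term (D i).F))} {gen : ∀ i, (D i).F × List ℕ}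

namespace PolyTime

open Classical in
theorem coord {l : ι → List ℕ} (hD : PolyTime N x D) (hd : PolyTime N x d) (hT : PolyTime N x T)
    (hl : PolyTime N x l) (hc : PolyTime N x c) (hc' : PolyBdd N c) :
    PolyTime N x fun i => coord (d i) (T i) (l i) (c i) := by
  unfold DiagonalSystems.coord
  refine fieldSum hD (map (X := fun i => Term (D i).F) hT fun {b x'} hx ht => ?_)
  have hD' := hD.weaken hx
  exact ite (.natListEq ht.snd.fst (hl.weaken hx)) (fieldMul hD'
    (fieldPow hD' ht.snd.snd (hd.weaken hx))
      (ht.fst.getD (hc.weaken hx) (hc'.comp _) hD'.fieldZero)) hD'.fieldZero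

theorem keys (hlabs : PolyTime N x labs) (hm : PolyTime N x m) (hm' : PolyBdd N m) :
    PolyTime N x fun i => keys (labs i) (m i) := by
  unfold DiagonalSystems.keys
  exact flatMap hlabs fun hx hl => map (X := fun _ => ℕ) (range (hm.weaken hx) (hm'.comp _))
    fun hx2 hc => (hl.weaken hx2).prod hc

theorem tensor (hD : PolyTime N x D) (hd : PolyTime N x d) (hlabs : PolyTime N x labs)
    (hm : PolyTime N x m) (hm' : PolyBdd N m) (hT : PolyTime N x T) :
    PolyTime N x fun i => tensor (d i) (labs i) (m i) (T i) := by
  unfold DiagonalSystems.tensor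
  refine map (keys hlabs hm hm') fun {b x'} hx hk => coord (hD.weaken hx) (hd.weaken hx)
    (hT.weaken hx) hk.fst hk.snd ((hm'.comp MemIdx.i).mono fun j => ?_)
  obtain ⟨l, -, hl⟩ := List.mem_flatMap.1 j.mem
  obtain ⟨c, hc, hc'⟩ := List.mem_map.1 hl
  rw [← hc']
  exact (List.mem_range.1 hc).le

theorem chunkRelation (hD : PolyTime N x D) (hd : PolyTime N x d) (hlabs : PolyTime N x labs)
    (hm : PolyTime N x m) (hm' : PolyBdd N m) (hchunk : PolyTime N x chunk) :
    PolyTime N x fun i => chunkRelation (d i) (labs i) (m i) (chunk i) := by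
  have hk := keys hlabs hm hm'
  unfold DiagonalSystems.chunkRelation
  exact relation hD (map hchunk fun hx hT => tensor (hD.weaken hx) (hd.weaken hx)
    (hlabs.weaken hx) (hm.weaken hx) (hm'.comp _) hT) hk.length
    (hk.polyBdd.mono fun i => length_le_csize _)

open Classical in
theorem shift {dec : ∀ i, List (ℕ × (D i).F)} (hD : PolyTime N x D) (hd : PolyTime N x d)
    (hk : PolyTime N x k) (hdec : PolyTime N x dec) :
    PolyTime N x fun i => shift (d i) (k i) (dec i) := by
  unfold DiagonalSystems.shift
  exact (hd.sub ((filter hdec fun hx hz => (PolyTimeDec.fieldEq hz.snd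
    (hD.weaken hx).fieldZero).not).headD ((natConst hD.ctx 0).prod hD.fieldZero)).fst).add hk

theorem joinTerms {ζ : ∀ i, (D i).F} {dec : ∀ i, List (ℕ × (D i).F)} (hD : PolyTime N x D)
    (hd : PolyTime N x d) (hs : PolyTime N x s) (hζ : PolyTime N x ζ) (hdec : PolyTime N x dec)
    (hchunk : PolyTime N x chunk) :
    PolyTime N x fun i => joinTerms (d i) (s i) (ζ i) (dec i) (chunk i) := by
  have hc : PolyBdd N fun i => (chunk i).length := hchunk.polyBdd.mono fun i => length_le_csize _
  unfold DiagonalSystems.joinTerms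
  refine flatMap (X := fun _ => ℕ) (range hchunk.length hc) fun {b x'} hx hj => ?_
  have hD' := hD.weaken hx
  have h1 := (hdec.weaken hx).getD hj hc.memRange ((natConst hx.self 0).prod hD'.fieldZero)
  have h2 := h1.fst.add (hs.weaken hx)
  have h3 := fieldMul hD' (fieldPow hD' (hζ.weaken hx) (h2.div (hd.weaken hx))) h1.snd
  exact map (X := fun j : MemIdx fun i => List.range (chunk i).length => Term (D j.i).F) ((hchunk.weaken hx).getD hj hc.memRange (nil hx.self))
    fun hx2 ht => ht.fst.prod ((ht.snd.fst.append
      ((h2.mod (hd.weaken hx)).weaken hx2).singleton).prod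
        (fieldMul (hD'.weaken hx2) ht.snd.snd (h3.weaken hx2)))

theorem combine (hD : PolyTime N x D) (hd : PolyTime N x d) (hd' : PolyBdd N d)
    (hd0 : ∀ i, 0 < d i) (hr : PolyTime N x r) (hm : PolyTime N x m) (hm' : PolyBdd N m)
    (hgen : PolyTime N x gen) (hgen' : ∀ i, IsGenerator (d i) (gen i))
    (hlabs : PolyTime N x labs) (hk : PolyTime N x k) (hchunk : PolyTime N x chunk) :
    PolyTime N x fun i => combine (d i) (r i) (m i) (gen i) (labs i) (k i) (chunk i) := by
  have h1 := map (chunkRelation hD hd hlabs hm hm' hchunk) (g := fun i =>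
    DiagonalSystems.decomp (d i) (r i) (gen i).1 (gen i).2) fun hx hy =>
      decomp (hD.weaken hx) (hd.weaken hx) (hd'.comp _) (fun j => hd0 j.i) (hr.weaken hx)
        (hgen.weaken hx) (fun j => hgen' j.i) hy
  exact joinTerms hD hd (shift hD hd hk h1) hgen.fst h1 hchunk

theorem chunks {b : Ty} {Y : ι → Type*} [∀ i, Code b (Y i)] {l : ∀ i, List (Y i)}
    (hn : PolyTime N x n) (hl : PolyTime N x l) : PolyTime N x fun i => chunks (n i) (l i) := by
  have hl' : PolyBdd N fun i => (l i).length := hl.polyBdd.mono fun i => length_le_csize _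
  unfold DiagonalSystems.chunks
  refine map (X := fun _ => ℕ) (range (hl.length.div hn) (hl'.mono fun i => Nat.div_le_self _ _))
    fun hx hc => ((hl.weaken hx).drop (hc.mul (hn.weaken hx))
      ((hl'.comp MemIdx.i).mono fun j => ?_)).take (hn.weaken hx)
  exact (Nat.mul_le_mul_right _ (List.mem_range.1 j.mem).le).trans (Nat.div_mul_le_self _ _)

theorem extendLabels (hd : PolyTime N x d) (hd' : PolyBdd N d) (hlabs : PolyTime N x labs) :
    PolyTime N x fun i => extendLabels (d i) (labs i) := by
  unfold DiagonalSystems.extendLabels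
  exact flatMap hlabs fun hx hl => map (X := fun _ => ℕ) (range (hd.weaken hx) (hd'.comp _))
    fun hx2 hb => (hl.weaken hx2).append hb.singleton

theorem coreStep {st : ∀ i, CoreState (D i).F} (hD : PolyTime N x D) (hd : PolyTime N x d)
    (hd' : PolyBdd N d) (hd0 : ∀ i, 0 < d i) (hr : PolyTime N x r) (hm : PolyTime N x m)
    (hm' : PolyBdd N m) (hgen : PolyTime N x gen) (hgen' : ∀ i, IsGenerator (d i) (gen i))
    (hst : PolyTime N x st) (hk : PolyTime N x k) :
    PolyTime N x fun i => coreStep (d i) (r i) (m i) (gen i) (st i) (k i) := by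
  have h1 : PolyTime N x fun i => DiagonalSystems.chunks ((st i).1.length * (m i + 1)) (st i).2.1 :=
    chunks (hst.fst.length.mul (hm.add (natConst hD.ctx 1))) hst.snd.fst
  unfold DiagonalSystems.coreStep
  refine (extendLabels hd hd' hst.fst).prod ((map h1 fun hx hc => ?_).prod
    (hst.snd.snd.append (flatMap h1 fun hx hc => ?_)))
  · exact combine (hD.weaken hx) (hd.weaken hx) (hd'.comp _) (fun j => hd0 j.i) (hr.weaken hx)
      (hm.weaken hx) (hm'.comp _) (hgen.weaken hx) (fun j => hgen' j.i) (hst.fst.weaken hx)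
      (hk.weaken hx) hc
  · exact chunkRelation (hD.weaken hx) (hd.weaken hx) (hst.fst.weaken hx) (hm.weaken hx)
      (hm'.comp _) hc

end PolyTime

end

theorem FieldData.one_lt_q (D : FieldData.{u}) : 1 < D.q := by
  rw [← FieldData.card_eq]; exact Finite.one_lt_card

theorem FieldData.pow_q_sub_one {D : FieldData.{u}} (y : D.F) (hy : y ≠ 0) :
    y ^ (D.q - 1) = 1 := by
  have := Fintype.ofFinite D.F
  rw [← FieldData.card_eq, Nat.card_eq_fintype_card]
  exact FiniteField.pow_card_sub_one_eq_one y hy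

/-! ### Size of the intermediate results -/

theorem numObjects_le {d m k : ℕ} (hk : k ≤ d) : numObjects d m k ≤ numVectors d m := by
  rw [← numObjects_zero]
  induction k with
  | zero => exact le_rfl
  | succ k ih =>
    refine le_trans ?_ (ih (by omega))
    have hd : 0 < d := by omega
    rw [numObjects_succ m hk]
    exact Nat.le_mul_of_pos_left _ (by positivity)

theorem length_chunkRelation {F : Type*} [Field F] (d : ℕ) (labs : List (List ℕ)) (m : ℕ)
    (chunk : List (List (Term F))) : (chunkRelation d labs m chunk).length = chunk.length := by
  rw [chunkRelation, length_relation, List.length_map]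

/-- A round yields one coefficient for each current list of terms, and there are never more lists
than input vectors. -/
theorem length_core_coeffs {F : Type*} [Field F] {d m k : ℕ} {V : List (List F)}
    (hV : V.length = numVectors d m) (r : ℕ) (s : F × List ℕ) (hk : k ≤ d) :
    (core d r m s V k).2.2.length ≤ k * V.length := by
  induction k with
  | zero => simp [core, coreInit]
  | succ k ih =>
    have h := coreShape_core hV r s (k := k) (by omega)
    rw [core_succ]
    generalize core d r m s V k = st at h ih
    have e : ((chunks (st.1.length * (m + 1)) st.2.1).flatMap (chunkRelation d st.1 m)).length =
        st.2.1.length := by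
      conv_rhs => rw [← flatten_chunks (h.chunk_pos (by omega)) (h.length_eq hk)]
      rw [List.length_flatMap, List.length_flatten]
      simp only [length_chunkRelation]
    simp only [coreStep, List.length_append, e, Nat.succ_mul]
    have h1 := ih (by omega)
    have h2 := numObjects_le (d := d) (m := m) (k := k) (by omega)
    rw [h.length]
    omega

/-- A bound for the size of a label. -/
def labelBound (d : ℕ) : ℕ := d * (d + 1 + 1) + 1

/-- A bound for the size of the intermediate results. -/
def stateBound (D : FieldData.{u}) (d n v : ℕ) : ℕ :=
  d ^ d * (labelBound d + 1) + 1 + (n * (n * (v + (labelBound d +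
    (csize D * (csize D + 1) + 1) + 1) + 1 + 1) + 1 + 1) + 1 +
      (d * n * (csize D * (csize D + 1) + 1 + 1) + 1) + 1) + 1

/-- There are at most `d ^ d` labels, and the terms of all lists together correspond to the input
vectors, so the state does not grow from round to round beyond this bound. -/
theorem csize_core_le {D : FieldData.{u}} {d m k : ℕ} {V : List (List D.F)}
    (hV : V.length = numVectors d m) (r : ℕ) (s : D.F × List ℕ) (hd : 0 < d) (hk : k ≤ d) :
    csize (core d r m s V k) ≤ stateBound D d V.length (csize V) := by
  have h := coreShape_core hV r s hk
  have hcoef := length_core_coeffs hV r s hk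
  generalize core d r m s V k = st at h hcoef
  have hlab : ∀ l ∈ st.1, csize l ≤ labelBound d := fun l hl => by
    obtain ⟨h1, h2⟩ := h.labels.mem l hl
    refine csize_list_le (h1.trans_le hk) fun b hb => ?_
    rw [csize_nat]
    exact Nat.add_le_add_right ((Nat.size_le_self b).trans (h2 b hb).le) 1
  have hlen : st.2.1.flatten.length = V.length := by
    rw [← h.vectors, List.length_map]
  rw [csize_prod, csize_prod, stateBound]
  refine Nat.add_le_add_right (Nat.add_le_add ?_ (Nat.add_le_add_right (Nat.add_le_add ?_ ?_) _)) _
  · exact csize_list_le (h.labels.length.trans_le (Nat.pow_le_pow_right hd hk)) hlab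
  · refine csize_list_le ?_ fun T hT => csize_list_le ?_ fun t ht => ?_
    · rw [h.length, hV]
      exact numObjects_le hk
    · rw [← hlen]
      exact (List.sublist_flatten_of_mem hT).length_le
    · have h1 : t.1 ∈ V := by
        rw [← h.vectors]
        exact List.mem_map_of_mem (List.mem_flatten.2 ⟨T, hT, ht⟩)
      have h2 := csize_le_of_mem h1
      have h3 := hlab _ (h.label_mem T hT t ht)
      have h4 := FieldData.csize_le t.2.2
      rw [csize_prod, csize_prod]
      omega
  · exact csize_list_le (hcoef.trans (Nat.mul_le_mul_right _ hk)) fun y _ => FieldData.csize_le y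

/-! ### Running time of all rounds, of the passes and of the sign computation. -/

section

variable {ι : Type*} {N : ι → ℕ} {a : Ty} {x : ι → a.Val} {d m r : ι → ℕ}
  {D : ι → FieldData.{u}} {V : ∀ i, List (List (D i).F)} {gen : ∀ i, (D i).F × List ℕ}

namespace PolyTime

theorem core (hD : PolyTime N x D) (hd : PolyTime N x d) (hd' : PolyBdd N fun i => d i ^ d i)
    (hd0 : ∀ i, 0 < d i) (hr : PolyTime N x r) (hm : PolyTime N x m) (hm' : PolyBdd N m)
    (hgen : PolyTime N x gen) (hgen' : ∀ i, IsGenerator (d i) (gen i)) (hV : PolyTime N x V)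
    (hV' : ∀ i, (V i).length = numVectors (d i) (m i)) :
    PolyTime N x fun i => core (d i) (r i) (m i) (gen i) (V i) (d i) := by
  have hdd : PolyBdd N d := hd'.mono fun i => Nat.le_self_pow (hd0 i).ne' _
  have hlen : PolyBdd N fun i => (V i).length := hV.polyBdd.mono fun i => length_le_csize _
  unfold DiagonalSystems.core
  refine foldl (X := fun _ => ℕ) (B := fun i => stateBound (D i) (d i) (V i).length (csize (V i)))
    (range hd hdd) ?_ ?_ ?_ ?_
  · exact ((nil hD.ctx (Y := fun _ => ℕ)).singleton).prod ((map hV fun hx hv =>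
      (hv.prod ((nil hx.self (Y := fun _ => ℕ)).prod (hD.weaken hx).fieldOne)).singleton).prod
        (nil hD.ctx (Y := fun i => (D i).F)))
  · have hlab : PolyBdd N fun i => labelBound (d i) :=
      (hdd.mul ((hdd.add (.const 1)).add (.const 1))).add (.const 1)
    have hF := hD.polyBdd_field
    exact (((hd'.mul (hlab.add (.const 1))).add (.const 1)).add ((((hlen.mul (((hlen.mul
      (((hV.polyBdd.add ((hlab.add hF).add (.const 1))).add (.const 1)).add (.const 1))).add
        (.const 1)).add (.const 1))).add (.const 1)).add (((hdd.mul hlen).mul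
          (hF.add (.const 1))).add (.const 1))).add (.const 1))).add (.const 1)
  · intro i pre suf h
    have h1 : pre.length ≤ d i := by
      have := congrArg List.length h
      simp only [List.length_range, List.length_append] at this
      omega
    -- A prefix of a range is a range, so the partial fold is the state after `pre.length` rounds.
    have h2 : pre = List.range pre.length := by
      have h3 := congrArg (List.take pre.length) h
      rw [List.take_left, List.take_range, min_eq_left h1] at h3
      exact h3.symm
    rw [h2]
    exact csize_core_le (hV' i) (r i) (gen i) (hd0 i) h1
  · intro b x' hx hk hacc
    exact coreStep (hD.weaken hx) (hd.weaken hx) (hdd.comp _) (fun j => hd0 j.i) (hr.weaken hx)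
      (hm.weaken hx) (hm'.comp _) (hgen.weaken hx) (fun j => hgen' j.i) hacc hk

open Classical in
theorem pass (hD : PolyTime N x D) (hd : PolyTime N x d) (hd' : PolyBdd N fun i => d i ^ d i)
    (hd0 : ∀ i, 0 < d i) (hr : PolyTime N x r) (hm : PolyTime N x m) (hm' : PolyBdd N m)
    (hgen : PolyTime N x gen) (hgen' : ∀ i, IsGenerator (d i) (gen i)) (hV : PolyTime N x V)
    (hV' : ∀ i, (V i).length = numVectors (d i) (m i)) :
    PolyTime N x fun i => pass (D i).q (d i) (m i) (r i) (V i) (gen i) := by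
  have hdd : PolyBdd N d := hd'.mono fun i => Nat.le_self_pow (hd0 i).ne' _
  have h1 := (core hD hd hd' hd0 hr hm hm' hgen hgen' hV hV').snd.snd
  have h2 := hr.mul hgen.snd.natProd
  have h3 := filter (P := fun i y => y ≠ 0 ∧ y ^ (r i * (gen i).2.prod) ≠ 1) h1 fun {b x'} hx hy =>
    (PolyTimeDec.fieldEq hy (hD.weaken hx).fieldZero).not.and
      (PolyTimeDec.fieldEq (fieldPow (hD.weaken hx) hy (h2.weaken hx)) (hD.weaken hx).fieldOne).not
  unfold DiagonalSystems.pass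
  exact ite (.eq_nil h3) hgen (enlarge hD hd hdd hD.fieldCard hgen (h3.headD hD.fieldZero))

theorem passes (hD : PolyTime N x D) (hd : PolyTime N x d) (hd' : PolyBdd N fun i => d i ^ d i)
    (hd0 : ∀ i, 0 < d i) (hm : PolyTime N x m) (hm' : PolyBdd N m) (hV : PolyTime N x V)
    (hV' : ∀ i, (V i).length = numVectors (d i) (m i)) :
    PolyTime N x fun i => passes (D i).q (d i) (m i) (V i) (Nat.size (D i).q) := by
  have hdd : PolyBdd N d := hd'.mono fun i => Nat.le_self_pow (hd0 i).ne' _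
  have hq := hD.fieldCard
  have hr := coprimePart hd hdd (hq.sub (natConst hD.ctx 1))
  have key : ∀ (i : ι) (l : List ℕ), l.foldl (fun s _ => DiagonalSystems.pass (D i).q (d i) (m i)
      (DiagonalSystems.coprimePart (d i) ((D i).q - 1)) (V i) s) (1, []) =
      DiagonalSystems.passes (D i).q (d i) (m i) (V i) l.length := by
    intro i l
    induction l using List.reverseRecOn with
    | nil => rfl
    | append_singleton l k ih =>
      rw [List.foldl_append, ih, List.length_append, List.length_singleton, passes_succ]
      rfl
  -- The cost of a pass is bounded only for genuine generators, so this property is recorded for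
  -- every partial fold.
  have hgen : ∀ (i : ι) (l : List ℕ), IsGenerator (d i) (l.foldl (fun s _ =>
      DiagonalSystems.pass (D i).q (d i) (m i) (DiagonalSystems.coprimePart (d i) ((D i).q - 1))
        (V i) s) (1, [])) := fun i l => by
    rw [key]
    exact isGenerator_passes (hd0 i) (D i).one_lt_q (FieldData.pow_q_sub_one) (V i) _
  unfold DiagonalSystems.passes
  refine foldl (X := fun _ => ℕ) (B := fun i => csize (D i) * (csize (D i) + 1) + 1 +
    (Nat.size (D i).q * (d i + 1 + 1) + 1) + 1) (range hq.natSize hq.polyBdd_size)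
      (hD.fieldOne.prod (nil hD.ctx (Y := fun _ => ℕ)))
      ((hD.polyBdd_field.add ((hq.polyBdd_size.mul ((hdd.add (.const 1)).add (.const 1))).add
        (.const 1))).add (.const 1)) ?_ ?_
  · intro i pre suf _
    have h := hgen i pre
    generalize pre.foldl _ _ = s at h ⊢
    have h1 := (h.length_lt (D i).one_lt_q FieldData.pow_q_sub_one).2
    have h2 := FieldData.csize_le s.1
    have h3 := csize_list_le (s := d i + 1) h1.le fun l hl => by
      rw [csize_nat]
      exact Nat.add_le_add_right
        ((Nat.size_le_self l).trans (Nat.le_of_dvd (hd0 i) (h.dvd l hl))) 1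
    rw [csize_prod]
    omega
  · intro b x' hx _ hacc
    exact pass (hD.weaken hx) (hd.weaken hx) (hd'.comp _) (fun j => hd0 j.i) (hr.weaken hx)
      (hm.weaken hx) (hm'.comp _) hacc (fun j => hgen j.i j.pre) (hV.weaken hx) fun j => hV' j.i

theorem finalTerms (hD : PolyTime N x D) (hd : PolyTime N x d)
    (hd' : PolyBdd N fun i => d i ^ d i)
    (hd0 : ∀ i, 0 < d i) (hm : PolyTime N x m) (hm' : PolyBdd N m) (hV : PolyTime N x V)
    (hV' : ∀ i, (V i).length = numVectors (d i) (m i)) :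
    PolyTime N x fun i => finalTerms (D i).q (d i) (m i) (V i) := by
  have hdd : PolyBdd N d := hd'.mono fun i => Nat.le_self_pow (hd0 i).ne' _
  exact (core hD hd hd' hd0 (coprimePart hd hdd (hD.fieldCard.sub (natConst hD.ctx 1))) hm hm'
    (passes hD hd hd' hd0 hm hm' hV hV')
    (fun i => isGenerator_passes (hd0 i) (D i).one_lt_q FieldData.pow_q_sub_one (V i) _)
    hV hV').snd.fst.headD (nil hD.ctx)

theorem positionPairs (hd : PolyTime N x d) (hd' : PolyBdd N d) :
    PolyTime N x fun i => positionPairs (d i) := by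
  unfold DiagonalSystems.positionPairs
  exact flatMap (X := fun _ => ℕ) (range hd hd') fun hx hi => map (X := fun _ => ℕ)
    (range (hd.weaken hx) (hd'.comp _)) fun hx2 hj => (hi.weaken hx2).prod hj

end PolyTime

theorem PolyBdd.memPositionPairs (hd' : PolyBdd N d) :
    PolyBdd (fun j : MemIdx fun i => positionPairs (d i) => N j.i) (fun j => j.e.1) ∧
      PolyBdd (fun j : MemIdx fun i => positionPairs (d i) => N j.i) fun j => j.e.2 :=
  ⟨(hd'.comp MemIdx.i).mono fun j => (mem_positionPairs.1 j.mem).1.le,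
    (hd'.comp MemIdx.i).mono fun j => (mem_positionPairs.1 j.mem).2.le⟩

theorem PolyTimeDec.isInjLabel {l : ι → List ℕ} (hd : PolyTime N x d) (hd' : PolyBdd N d)
    (hl : PolyTime N x l) : PolyTimeDec N x fun i => IsInjLabel (d i) (l i) := by
  refine (forall_mem (P := fun i ij => ¬ (ij.1 < ij.2 ∧ (l i).getD ij.1 0 = (l i).getD ij.2 0))
    (PolyTime.positionPairs hd hd') fun hx hij => ?_).congr fun i =>
      forall_congr' fun ij => forall_congr' fun _ => not_and
  have h0 := PolyTime.natConst hx.self 0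
  have hl2 := hl.weaken hx
  exact ((natLt hij.fst hij.snd).and (natEq (hl2.getD hij.fst hd'.memPositionPairs.1 h0)
    (hl2.getD hij.snd hd'.memPositionPairs.2 h0))).not

namespace PolyTime

theorem inversions {l : ι → List ℕ} (hd : PolyTime N x d) (hd' : PolyBdd N d)
    (hl : PolyTime N x l) : PolyTime N x fun i => inversions (d i) (l i) := by
  unfold DiagonalSystems.inversions
  refine length (filter (positionPairs hd hd') fun hx hij => ?_)
  have h0 := natConst hx.self 0
  have hl2 := hl.weaken hx
  exact (PolyTimeDec.natLt hij.fst hij.snd).and (.natLt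
    (hl2.getD hij.snd hd'.memPositionPairs.2 h0) (hl2.getD hij.fst hd'.memPositionPairs.1 h0))

open Classical in
theorem positions {T : ∀ i, List (Term (D i).F)} (hD : PolyTime N x D) (hd : PolyTime N x d)
    (hd' : PolyBdd N d) (hT : PolyTime N x T) (b : ℕ) :
    PolyTime N x fun i => positions (d i) b (T i) := by
  have hT' : PolyBdd N fun i => (T i).length := hT.polyBdd.mono fun i => length_le_csize _
  unfold DiagonalSystems.positions
  refine filter (X := fun _ => ℕ) (range hT.length hT') fun hx hi => ?_
  have hD' := hD.weaken hx
  have h1 := (hT.weaken hx).getD hi hT'.memRange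
    ((nil hx.self (Y := fun j => (D j.i).F)).prod ((nil hx.self (Y := fun _ => ℕ)).prod
      hD'.fieldZero))
  exact (PolyTimeDec.fieldEq h1.snd.snd hD'.fieldZero).not.and
    ((PolyTimeDec.isInjLabel (hd.weaken hx) (hd'.comp _) h1.snd.fst).and
      (.natEq ((inversions (hd.weaken hx) (hd'.comp _) h1.snd.fst).mod (natConst hx.self 2))
        (natConst hx.self b)))

end PolyTime

end

/-! ### The algorithm -/

/-- A valid input. -/
structure ValidInput : Type (u + 1) where
  /-- The field. -/
  D : FieldData.{u}
  /-- The exponent. -/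
  d : ℕ
  /-- The dimension. -/
  m : ℕ
  dvd : d ∣ Nat.card D.F - 1
  /-- The vectors. -/
  v : Fin (numVectors d m) → Fin m → D.F

namespace ValidInput

variable (i : ValidInput.{u})

/-- The number of vectors plus the logarithm of the number of field elements. -/
noncomputable def param : ℕ := numVectors i.d i.m + Nat.log 2 (Nat.card i.D.F)

/-- The list of vectors. -/
def vectors : List (List i.D.F) := List.ofFn fun j => List.ofFn (i.v j)

/-- The input as it is presented to the program. -/
noncomputable def input : inputTy.Val :=
  (i.D.p, i.D.f, i.d, i.m, i.vectors.map fun w => w.map i.D.code)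

/-- The computed representations. -/
noncomputable def terms : List (Term i.D.F) := finalTerms i.D.q i.d i.m i.vectors

/-- The output of the program. -/
noncomputable def output : outputTy.Val :=
  (positions i.d 0 i.terms, positions i.d 1 i.terms, i.terms.map fun t => i.D.code t.2.2)

theorem d_pos : 0 < i.d := by
  refine Nat.pos_of_dvd_of_pos i.dvd ?_
  rw [i.D.card_eq]
  have := i.D.one_lt_q
  omega

/-- The number of labels has to be polynomial in G. -/
theorem pow_le : i.d ^ i.d ≤ i.d * numVectors i.d i.m := by
  have hd := i.d_pos
  -- Equality holds for `d = 1` and `d = 2`, which is why one extra factor `d` is needed; from `d =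
  -- 3` on, `d * (d - 1) / 2 ≥ d`.
  have h1 : i.d ≤ i.d * (i.d - 1) / 2 + 1 := by
    obtain ⟨e, he⟩ := Nat.exists_eq_succ_of_ne_zero hd.ne'
    rw [he, Nat.succ_eq_add_one, Nat.add_sub_cancel]
    rcases e with _ | _ | e
    · simp
    · simp
    · have h2 : (e + 1 + 1 + 1) * 2 ≤ (e + 1 + 1 + 1) * (e + 1 + 1) := Nat.mul_le_mul_left _ (by omega)
      have h3 := (Nat.le_div_iff_mul_le (by norm_num)).2 h2
      omega
  calc i.d ^ i.d ≤ i.d ^ (i.d * (i.d - 1) / 2 + 1) := Nat.pow_le_pow_right hd h1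
    _ = i.d * i.d ^ (i.d * (i.d - 1) / 2) := pow_succ' _ _
    _ ≤ i.d * numVectors i.d i.m :=
      Nat.mul_le_mul_left _ (Nat.le_mul_of_pos_right _ (by positivity))

theorem d_le : i.d ≤ numVectors i.d i.m := by
  have hd := i.d_pos
  have h1 : 1 ≤ i.d ^ (i.d * (i.d - 1) / 2) := Nat.pow_pos hd
  have h2 : 1 ≤ (i.m + 1) ^ i.d := Nat.pow_pos (Nat.succ_pos _)
  -- For `d = 1` the exponent d(d-1)/2 vanishes and the bound is trivial; otherwise the exponent is
  -- positive.
  rcases (Nat.succ_le_of_lt hd).eq_or_lt with h | h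
  · refine le_trans ?_ (Nat.mul_le_mul h1 h2)
    omega
  · have h3 : 1 ≤ i.d * (i.d - 1) / 2 := by
      refine (Nat.le_div_iff_mul_le (by norm_num)).2 ?_
      exact le_trans (by omega) (Nat.mul_le_mul (Nat.succ_le_of_lt h) (Nat.le_sub_of_add_le h))
    refine le_trans ?_ (Nat.mul_le_mul (Nat.le_self_pow (by omega : i.d * (i.d - 1) / 2 ≠ 0) i.d) h2)
    omega

theorem m_le : i.m ≤ numVectors i.d i.m := by
  refine le_trans ?_ (Nat.mul_le_mul (Nat.pow_pos i.d_pos : 1 ≤ i.d ^ (i.d * (i.d - 1) / 2))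
    (Nat.le_self_pow i.d_pos.ne' (i.m + 1)))
  omega

/-- Since q = p^k, both the bit length of `p` and the degree `k` are bounded in terms of log q. -/
theorem csize_field_le : csize i.D ≤ (i.param + 2) + (i.param * (i.param + 2 + 1) + 1) + 1 := by
  have hq : i.D.q ≠ 0 := i.D.q_pos.ne'
  have hL : Nat.log 2 i.D.q ≤ i.param := by
    rw [← i.D.card_eq]; exact Nat.le_add_left _ _
  have h1 : i.D.p ≤ i.D.q := Nat.le_self_pow i.D.k_pos.ne' _
  have h2 : Nat.size i.D.p ≤ i.param + 1 := by
    refine (Nat.size_le_size h1).trans ((Nat.size_le.2 (Nat.lt_pow_succ_log_self (by norm_num) _)).trans ?_)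
    omega
  have h3 : i.D.k ≤ i.param := by
    refine (Nat.le_log_of_pow_le (by norm_num) ?_).trans hL
    exact Nat.pow_le_pow_left i.D.prime.out.two_le _
  have h4 := csize_list_le (s := i.param + 2) (show i.D.f.length ≤ i.param from h3) fun a ha => by
    rw [csize_nat]
    have := Nat.size_le_size (i.D.pres.lt a ha).le
    omega
  rw [FieldData.csize_eq, csize_nat]
  omega

theorem length_vectors : i.vectors.length = numVectors i.d i.m := List.length_ofFn

end ValidInput

/-- All hypotheses reduce to G + log q: `d`, `m` and the number of vectors are bounded by G, the
field data by `csize_field_le`, and `d ^ d` by `pow_le`. -/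
theorem polyTime_output : RawPolyTime ValidInput.param.{u} ValidInput.input ValidInput.output := by
  have hG : PolyBdd ValidInput.param.{u} fun i => numVectors i.d i.m :=
    PolyBdd.self.mono fun i => Nat.le_add_right _ _
  have hd' := hG.mono ValidInput.d_le
  have hm' := hG.mono ValidInput.m_le
  have hD' : PolyBdd ValidInput.param.{u} fun i => csize i.D :=
    (((PolyBdd.self.add (.const 2)).add ((PolyBdd.self.mul ((PolyBdd.self.add (.const 2)).add
      (.const 1))).add (.const 1))).add (.const 1)).mono ValidInput.csize_field_le
  have hF : PolyBdd ValidInput.param.{u} fun i => csize i.D * (csize i.D + 1) + 1 :=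
    (hD'.mul (hD'.add (.const 1))).add (.const 1)
  have hV' : PolyBdd ValidInput.param.{u} fun i => csize i.vectors := by
    refine ((hG.mul (((hm'.mul (hF.add (.const 1))).add (.const 1)).add (.const 1))).add
      (.const 1)).mono fun i => csize_list_le i.length_vectors.le fun w hw => ?_
    obtain ⟨j, rfl⟩ := (List.mem_ofFn' _ _).1 hw
    exact csize_list_le (by simp) fun y _ => FieldData.csize_le y
  have hsmall : Small ValidInput.param.{u} ValidInput.input := by
    refine (hD'.add ((hd'.add (.const 1)).add ((hm'.add (.const 1)).add
      (hV'.add (.const 3))))).mono fun i => ?_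
    have h1 : csize i.D = Ty.nat.size i.D.p + (Ty.list .nat).size i.D.f + 1 := rfl
    have h2 := Nat.size_le_self i.d
    have h3 := Nat.size_le_self i.m
    change Ty.nat.size i.D.p + ((Ty.list .nat).size i.D.f +
      (csize i.d + (csize i.m + csize i.vectors + 1) + 1) + 1) + 1 ≤ _
    rw [csize_nat i.d, csize_nat i.m]
    omega
  have hin := RawPolyTime.id hsmall
  have hD : PolyTime ValidInput.param.{u} ValidInput.input fun i => i.D :=
    hin.fst.pair hin.snd.fst
  have hd : PolyTime ValidInput.param.{u} ValidInput.input fun i => i.d := hin.snd.snd.fst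
  have hm : PolyTime ValidInput.param.{u} ValidInput.input fun i => i.m := hin.snd.snd.snd.fst
  have hV : PolyTime ValidInput.param.{u} ValidInput.input fun i => i.vectors :=
    hin.snd.snd.snd.snd
  have hT : PolyTime ValidInput.param.{u} ValidInput.input fun i => i.terms :=
    PolyTime.finalTerms hD hd ((hd'.mul hG).mono ValidInput.pow_le) ValidInput.d_pos hm hm' hV
      ValidInput.length_vectors
  have h := (PolyTime.positions hD hd hd' hT 0).prod ((PolyTime.positions hD hd hd' hT 1).prod
    (PolyTime.map (Y := fun i => i.D.F) (g := fun i t => t.2.2) hT fun hx ht => ht.snd.snd))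
  have e : ValidInput.output.{u} = fun i => Code.enc (positions i.d 0 i.terms,
      positions i.d 1 i.terms, i.terms.map fun t => t.2.2) := by
    funext i
    change _ = (Code.enc (positions i.d 0 i.terms), Code.enc (positions i.d 1 i.terms),
      (i.terms.map fun t => t.2.2).map i.D.code)
    rw [enc_natList, enc_natList, List.map_map]
    rfl
  rw [e]
  exact h

theorem CodesTuple.eq_map {α β : Type*} {R : α → β → Prop} {n : ℕ} {l : List α} {v : Fin n → β}
    {g : β → α} (h : CodesTuple R l v) (hg : ∀ c y, R c y → c = g y) : l = (List.ofFn v).map g := by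
  unfold CodesTuple at h
  generalize List.ofFn v = w at h
  induction h with
  | nil => rfl
  | cons h1 _ ih => rw [List.map_cons, ← ih, ← hg _ _ h1]

theorem codesTuple_map {α β γ : Type*} {R : α → β → Prop} {n : ℕ} {l : List γ} {v : Fin n → β}
    {f : γ → α} {g : γ → β} (h : ∀ c, R (f c) (g c)) (hv : List.ofFn v = l.map g) :
    CodesTuple R (l.map f) v := by
  unfold CodesTuple
  rw [hv, List.forall₂_map_left_iff, List.forall₂_map_right_iff]
  exact List.forall₂_same.2 fun c _ => h c

open Classical in
theorem ValidInput.exists_isCollision (i : ValidInput.{u}) :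
    ∃ (I J : Finset (Fin (numVectors i.d i.m))) (γ : Fin (numVectors i.d i.m) → i.D.F),
      CodesSet i.output.1 I ∧ CodesSet i.output.2.1 J ∧
      CodesTuple (CodesElem i.D.p i.D.k i.D.θ) i.output.2.2 γ ∧ IsCollision i.d i.v I J γ := by
  obtain ⟨h1, h2⟩ := isCollision_finalTerms i.d_pos i.D.one_lt_q FieldData.pow_q_sub_one i.v
    (V := i.vectors) rfl
  have hset : ∀ b, CodesSet (positions i.d b i.terms)
      (Finset.univ.filter fun j : Fin (numVectors i.d i.m) => (j : ℕ) ∈ positions i.d b i.terms) := by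
    refine fun b => ⟨List.nodup_range.filter _, fun a => ⟨fun ha => ?_, ?_⟩⟩
    · exact ⟨⟨a, h1 ▸ (mem_positions.1 ha).1⟩, by simpa using ha, rfl⟩
    · rintro ⟨j, hj, rfl⟩
      exact (Finset.mem_filter.1 hj).2
  refine ⟨_, _, _, hset 0, hset 1, codesTuple_map (fun t => i.D.code_spec t.2.2) ?_, h2⟩
  refine List.ext_getElem (by simp [ValidInput.terms, h1]) fun j hj hj' => ?_
  have hj2 : j < (finalTerms i.D.q i.d i.m i.vectors).length := by
    rw [h1]; simpa using hj
  rw [List.getElem_ofFn, List.getD_eq_getElem _ _ hj2, List.getElem_map]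
  rfl

end DiagonalSystems

theorem mainTheorem2 :
    ∃ (A : DiagonalSystems.Prog DiagonalSystems.inputTy DiagonalSystems.outputTy)
      (P : MvPolynomial (Fin 2) ℕ),
      ∀ (p : ℕ) [Fact p.Prime] (F : Type*) [Field F] [Fintype F] [Algebra (ZMod p) F]
        (f : List ℕ) (θ : F), DiagonalSystems.Presents p f θ →
      ∀ d m : ℕ, d ∣ Fintype.card F - 1 →
      ∀ (v : Fin (DiagonalSystems.numVectors d m) → Fin m → F) (V : List (List (List ℕ))),
        DiagonalSystems.CodesTuple
          (DiagonalSystems.CodesTuple (DiagonalSystems.CodesElem p f.length θ)) V v →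
      ∃ (I' J' : List ℕ) (γ' : List (List ℕ)) (t : ℕ),
        A.Runs (p, f, d, m, V) (I', J', γ') t ∧
        t ≤ MvPolynomial.eval
              ![DiagonalSystems.numVectors d m, Nat.log 2 (Fintype.card F)] P ∧
        ∃ (I J : Finset (Fin (DiagonalSystems.numVectors d m)))
          (γ : Fin (DiagonalSystems.numVectors d m) → F),
          DiagonalSystems.CodesSet I' I ∧ DiagonalSystems.CodesSet J' J ∧
          DiagonalSystems.CodesTuple (DiagonalSystems.CodesElem p f.length θ) γ' γ ∧
          DiagonalSystems.IsCollision d v I J γ := by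
  obtain ⟨A, t, ⟨c, hc⟩, hA⟩ := DiagonalSystems.polyTime_output
  -- This is the bound `(N + 2) ^ c` of `PolyBdd` with N = G + log q.
  refine ⟨A, (MvPolynomial.X 0 + MvPolynomial.X 1 + 2) ^ c, ?_⟩
  intro p _ F _ _ _ f θ hpres d m hd v V hV
  let D : DiagonalSystems.FieldData := { p := p, F := F, f := f, θ := θ, pres := hpres }
  let i : DiagonalSystems.ValidInput :=
    { D := D, d := d, m := m, dvd := by rw [Nat.card_eq_fintype_card]; exact hd, v := v }
  -- Codes of field elements are unique, so any list coding the vectors is the canonical one.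
  have hVeq : (p, f, d, m, V) = i.input := by
    have h := hV.eq_map (g := fun w => (List.ofFn w).map D.code) fun c w hcw =>
      DiagonalSystems.CodesTuple.eq_map hcw fun c y hcy => (D.code_eq hcy).symm
    rw [h]
    change _ = (p, f, d, m, (List.ofFn fun j => List.ofFn (v j)).map fun w => w.map D.code)
    congr 4
    simp [List.map_ofFn, Function.comp_def]
  refine ⟨i.output.1, i.output.2.1, i.output.2.2, t i, ?_, ?_, i.exists_isCollision⟩
  · rw [hVeq]
    exact hA i
  · refine (hc i).trans (le_of_eq ?_)
    rw [DiagonalSystems.ValidInput.param, Nat.card_eq_fintype_card]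
    simp [i, D]
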